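/- Let $\mathbb{P}^1$ be the projective line of $\mathbb{R}^2$, on which $SL(2,\mathbb{R})$ acts, and let $\sigma$ be the shift on $\Sigma=\{1,2\}^{\mathbb{Z}}$. A pair $(A_1,A_2)\in SL(2,\mathbb{R})^2$ is \emph{uniformly hyperbolic} if there are continuous maps $E^s,E^u:\Sigma\to\mathbb{P}^1$ with $E^s(x)\neq E^u(x)$, $A_{x_0}E^{s}(x)=E^{s}(\sigma x)$ and $A_{x_0}E^{u}(x)=E^{u}(\sigma x)$ for all $x$, and constants $C>0$, $0<r<1$ such that for all $x\in\Sigma$ and $n\ge 0$ one has $\|A_{x_{n-1}}\cdots A_{x_0}v\|\le Cr^n\|v\|$ for $v\in E^s(x)$ and $\|A_{x_{-n}}^{-1}\cdots A_{x_{-1}}^{-1}v\|\le Cr^n\|v\|$ for $v\in E^u(x)$. Let $\mathcal{H}\subset SL(2,\mathbb{R})^2$ be the set of uniformly hyperbolic pairs. A \emph{multicone} for $(A,B)$ is a nonempty open set $M\subset\mathbb{P}^1$ with $\overline{M}\neq\mathbb{P}^1$, with finitely many connected components, these having pairwise disjoint closures, such that $\overline{A(M)}\subset M$ and $\overline{B(M)}\subset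 M$. A connected component of $\mathcal{H}$ is \emph{principal} if every pair in it has a multicone consisting of a single interval. Let $H_{\mathrm{id}}$ be the set of pairs $(A,B)\in SL(2,\mathbb{R})^2$ that do not belong to a principal component and have a multicone which is a union of two intervals (that is, with exactly two connected components); the connected components of $H_{\mathrm{id}}$ are called \emph{free components}. Let $\mathcal{M}$ be the monoid, under composition, of self-maps of $SL(2,\mathbb{R})^2$ generated by $F_+(A,B)=(A,AB)$ and $F_-(A,B)=(BA,B)$. \textbf{Theorem.} There are exactly $4$ principal components. The connected components of $\mathcal{H}$ are exactly the principal components and the sets $F^{-1}(H')$ with $F\in\mathcal{M}$ and $H'$ a free component. Moreover, all of these components are distinct: no $F^{-1}(H')$ is a principal component, and if $F^{-1}(H')=G^{-1}(H'')$ with $F,G\in\mathcal{M}$ and $H',H''$ free components, then $F=G$ and $H'=H''$. -/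

import Mathlib

open scoped LinearAlgebra.Projectivization

noncomputable section

/-- The group `SL(2,ℝ)`, with the topology that Mathlib puts on it (induced from matrices). -/
abbrev SL2R : Type := Matrix.SpecialLinearGroup (Fin 2) ℝ

/-- The projective line `ℙ¹` of `ℝ²`; Mathlib supplies the action of `SL(2,ℝ)` on it. -/
abbrev P1 : Type := ℙ ℝ (Fin 2 → ℝ)

/-- The quotient topology on the projective line. -/
instance P1.instTopologicalSpace : TopologicalSpace P1 :=
  TopologicalSpace.coinduced
    (fun v : {v : Fin 2 → ℝ // v ≠ 0} => Projectivization.mk ℝ v.1 v.2) inferInstance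

/-- The set of connected components of a subset `S` of a topological space. -/
def componentsOf {X : Type*} [TopologicalSpace X] (S : Set X) : Set (Set X) :=
  connectedComponentIn S '' S

/-! ### Uniform hyperbolicity over the full shift -/

/-- The full shift space `N^ℤ` (with the product of the discrete topologies). -/
abbrev FullShift (N : ℕ) : Type := ℤ → Fin N

/-- The shift map `σ`. -/
def shiftMap {N : ℕ} (x : FullShift N) : FullShift N := fun i => x (i + 1)

/-- The forward products `A^n(x) = A_{x_{n-1}} ⋯ A_{x_1} A_{x_0}`, `n ≥ 0`. -/
def forwardProd {N : ℕ} (A : Fin N → SL2R) (x : FullShift N) : ℕ → SL2R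
  | 0 => 1
  | n + 1 => A (x (n : ℤ)) * forwardProd A x n

/-- The backward products `A^{-n}(x) = A_{x_{-n}}⁻¹ ⋯ A_{x_{-1}}⁻¹`, `n ≥ 0`. -/
def backwardProd {N : ℕ} (A : Fin N → SL2R) (x : FullShift N) : ℕ → SL2R
  | 0 => 1
  | n + 1 => (A (x (-((n : ℤ) + 1))))⁻¹ * backwardProd A x n

/-- The `N`-tuple `A` is uniformly hyperbolic with respect to the full shift: the trivial bundle
`N^ℤ × ℝ²` splits continuously as `E^s ⊕ E^u`, both line bundles are invariant under the cocycle
`(x, v) ↦ (σ x, A_{x_0} v)`, and `E^s` is uniformly contracted in the future, `E^u` in the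
past. -/
def IsUniformlyHyperbolic {N : ℕ} (A : Fin N → SL2R) : Prop :=
  ∃ Es Eu : FullShift N → P1,
    Continuous Es ∧ Continuous Eu ∧
    (∀ x, Es x ≠ Eu x) ∧
    (∀ x, A (x 0) • Es x = Es (shiftMap x)) ∧
    (∀ x, A (x 0) • Eu x = Eu (shiftMap x)) ∧
    ∃ C : ℝ, 0 < C ∧ ∃ r : ℝ, 0 < r ∧ r < 1 ∧
      ∀ (x : FullShift N) (n : ℕ),
        (∀ v ∈ (Es x).submodule, ‖forwardProd A x n • v‖ ≤ C * r ^ n * ‖v‖) ∧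
        (∀ v ∈ (Eu x).submodule, ‖backwardProd A x n • v‖ ≤ C * r ^ n * ‖v‖)

/-- The hyperbolic locus of the full `2`-shift. -/
def hyperbolicLocus : Set (SL2R × SL2R) :=
  {p | IsUniformlyHyperbolic ![p.1, p.2]}

/-! ### Multicones, principal components, free components -/

/-- `M` is a multicone for the `N`-tuple `A` (over the full shift): a nonempty open subset of `ℙ¹`
that is not dense, has finitely many connected components, these having pairwise disjoint closures,
and is mapped by each `A i` to a set whose closure is contained in the interior of `M`. -/
structure IsMulticone {N : ℕ} (A : Fin N → SL2R) (M : Set P1) : Prop where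
  isOpen : IsOpen M
  nonempty : M.Nonempty
  closure_ne : closure M ≠ Set.univ
  finite_components : (componentsOf M).Finite
  disjoint_closures : (componentsOf M).PairwiseDisjoint closure
  maps_into : ∀ i, closure ((fun q : P1 => A i • q) '' M) ⊆ interior M

/-- The pair has a multicone that is a union of exactly `k` intervals (its components). -/
def HasMulticoneWith (k : ℕ) (p : SL2R × SL2R) : Prop :=
  ∃ M : Set P1, IsMulticone ![p.1, p.2] M ∧ (componentsOf M).ncard = k

/-- The principal components: those connected components of the hyperbolic locus every element of
which has a multicone consisting of a single interval. -/
def principalComponents : Set (Set (SL2R × SL2R)) :=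
  {C | C ∈ componentsOf hyperbolicLocus ∧ ∀ p ∈ C, HasMulticoneWith 1 p}

/-- The set `H_id` of pairs that do not belong to a principal component and have a multicone which
is a union of two intervals. -/
def Hid : Set (SL2R × SL2R) :=
  {p | (∀ C ∈ principalComponents, p ∉ C) ∧ HasMulticoneWith 2 p}

/-- The free components: the connected components of `H_id`. -/
def freeComponents : Set (Set (SL2R × SL2R)) := componentsOf Hid

/-! ### The monoid generated by `F_+` and `F_-` -/

/-- `F_+(A,B) = (A,AB)`. -/
def Fplus : Function.End (SL2R × SL2R) := fun p => (p.1, p.1 * p.2)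

/-- `F_-(A,B) = (BA,B)`. -/
def Fminus : Function.End (SL2R × SL2R) := fun p => (p.2 * p.1, p.2)

/-- The monoid (under composition) of self-maps of `SL(2,ℝ)²` generated by `F_+` and `F_-`. -/
def monoidFpm : Submonoid (Function.End (SL2R × SL2R)) :=
  Submonoid.closure {Fplus, Fminus}

/-- The preimage `F⁻¹(S)`. -/
def pullback (F : Function.End (SL2R × SL2R)) (S : Set (SL2R × SL2R)) : Set (SL2R × SL2R) :=
  {p | F p ∈ S}

end

open Topology Filter

/-! ### Entries, traces and the square norm on `SL(2,ℝ)` -/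

namespace SL2R

/-! Hyperbolicity and multicones are both translated into inequalities between the traces x = tr A,
y = tr B, z = tr AB. The principal components turn out to be the four sets `principalSet s` of pairs
that are, up to the signs s, simultaneously conjugate to positive matrices. The set `Hid` turns out
to be `freeSet`: |x|, |y|, |z| > 2 and xyz < 0. The core is that the hyperbolic locus is the
disjoint union of the open sets `principalSet s` and the preimages of `freeSet` under the words in
F_+ and F_-. The components of a disjoint union of open sets are those of the pieces, and the words
act by homeomorphisms, so the theorem follows.

The pieces are hyperbolic. Exponential growth of all products suffices
(`isUniformlyHyperbolic_of_growth`). For positive matrices the growth is visible on the vector (1,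
1). A pair in `freeSet` is, up to signs and conjugation, A = -R₀R₁, B = -R₁R₂ with reflections in
three pairwise disjoint geodesics, and words without repeated neighbours in the reflections grow
exponentially. This controls the whole free group generated by A and B, not only its positive words,
so it survives the automorphisms underlying F_+ and F_- (`groupGrowth_of_wordMap`).

The pieces exhaust the locus. Hyperbolicity keeps |tr| of all words above 2 + η
(`exists_trace_bound`). A nonprincipal pair is triangular in the basis of expanding directions with
off-diagonal product ≤ 0, hence weakly twisted. F_+ and F_- preserve the commutator trace and act on
(x, y, z) by Markov-type moves. As long as xyz > 0 one of them keeps the pair weakly twisted and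
shrinks |x||y| by a definite factor, so the descent ends with xyz < 0
(`exists_wordMap_mem_freeSet`).

The pieces are disjoint. If a word leads from p to `freeSet`, then p is twisted. At most one of
F_+(p), F_-(p) is twisted, and the sign of xyz tells whether the word is empty, so p determines the
word (`word_unique`). Positive pairs are never weakly twisted.

Multicones are matched with the pieces as follows. Elements preserving a multicone strictly are
hyperbolic, with expanding direction inside and contracting direction outside. For a nonprincipal
pair the contracting directions separate the expanding ones inside the multicone, which excludes a
single interval. With two intervals each generator must carry the other's expanding direction
across, and this forces tr AB < 2 after normalizing tr A and tr B to be positive, hence membership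
in `freeSet`. -/

theorem det_entries (g : SL2R) : g 0 0 * g 1 1 - g 0 1 * g 1 0 = 1 := by
  have := g.2
  rwa [Matrix.det_fin_two] at this

theorem mul_entry (g h : SL2R) (i j : Fin 2) :
    (g * h) i j = g i 0 * h 0 j + g i 1 * h 1 j := by
  simp [Matrix.mul_apply, Fin.sum_univ_two]

theorem inv_entry00 (g : SL2R) : g⁻¹ 0 0 = g 1 1 := by
  rw [Matrix.SpecialLinearGroup.SL2_inv_expl]; simp

theorem inv_entry01 (g : SL2R) : g⁻¹ 0 1 = -g 0 1 := by
  rw [Matrix.SpecialLinearGroup.SL2_inv_expl]; simp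

theorem inv_entry10 (g : SL2R) : g⁻¹ 1 0 = -g 1 0 := by
  rw [Matrix.SpecialLinearGroup.SL2_inv_expl]; simp

theorem inv_entry11 (g : SL2R) : g⁻¹ 1 1 = g 0 0 := by
  rw [Matrix.SpecialLinearGroup.SL2_inv_expl]; simp

theorem neg_entry (g : SL2R) (i j : Fin 2) : (-g) i j = -g i j := by
  simp

theorem smul_entry (g : SL2R) (v : Fin 2 → ℝ) (i : Fin 2) :
    (g • v) i = g i 0 * v 0 + g i 1 * v 1 := by
  show (g.1 • v) i = _
  simp [Matrix.smul_eq_mulVec, Matrix.mulVec, dotProduct, Fin.sum_univ_two]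

theorem ext_entries {g h : SL2R} (h00 : g 0 0 = h 0 0) (h01 : g 0 1 = h 0 1)
    (h10 : g 1 0 = h 1 0) (h11 : g 1 1 = h 1 1) : g = h := by
  ext i j
  fin_cases i <;> fin_cases j <;> assumption

/-- The element of `SL(2,ℝ)` with given entries. -/
def mk (a b c d : ℝ) (h : a * d - b * c = 1) : SL2R :=
  ⟨!![a, b; c, d], by rw [Matrix.det_fin_two_of]; exact h⟩

@[simp] theorem mk_00 (a b c d : ℝ) (h) : mk a b c d h 0 0 = a := rfl
@[simp] theorem mk_01 (a b c d : ℝ) (h) : mk a b c d h 0 1 = b := rfl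
@[simp] theorem mk_10 (a b c d : ℝ) (h) : mk a b c d h 1 0 = c := rfl
@[simp] theorem mk_11 (a b c d : ℝ) (h) : mk a b c d h 1 1 = d := rfl

/-- The trace. -/
def tr (g : SL2R) : ℝ := g 0 0 + g 1 1

/-- The square of the Frobenius norm. -/
def nsq (g : SL2R) : ℝ := g 0 0 ^ 2 + g 0 1 ^ 2 + g 1 0 ^ 2 + g 1 1 ^ 2

theorem tr_neg (g : SL2R) : tr (-g) = -tr g := by
  simp only [tr, neg_entry]; ring

theorem tr_mul_comm (g h : SL2R) : tr (g * h) = tr (h * g) := by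
  simp only [tr, mul_entry]; ring

theorem nsq_neg (g : SL2R) : nsq (-g) = nsq g := by
  simp only [nsq, neg_entry]; ring

theorem nsq_inv (g : SL2R) : nsq g⁻¹ = nsq g := by
  simp only [nsq, inv_entry00, inv_entry11, inv_entry01, inv_entry10]; ring

theorem two_le_nsq (g : SL2R) : 2 ≤ nsq g := by
  have := det_entries g
  unfold nsq
  nlinarith [sq_nonneg (g 0 0 - g 1 1), sq_nonneg (g 0 1 + g 1 0)]

theorem nsq_pos (g : SL2R) : 0 < nsq g := lt_of_lt_of_le two_pos (two_le_nsq g)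

theorem nsq_mul_le (g h : SL2R) : nsq (g * h) ≤ nsq g * nsq h := by
  have key : ∀ a b c d : ℝ, (a * c + b * d) ^ 2 ≤ (a ^ 2 + b ^ 2) * (c ^ 2 + d ^ 2) :=
    fun a b c d => by nlinarith [sq_nonneg (a * d - b * c)]
  have h1 := key (g 0 0) (g 0 1) (h 0 0) (h 1 0)
  have h2 := key (g 0 0) (g 0 1) (h 0 1) (h 1 1)
  have h3 := key (g 1 0) (g 1 1) (h 0 0) (h 1 0)
  have h4 := key (g 1 0) (g 1 1) (h 0 1) (h 1 1)
  simp only [nsq, mul_entry]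
  nlinarith

theorem nsq_one : nsq 1 = 2 := by
  simp [nsq]; norm_num

end SL2R

open SL2R

/-- The square of the Euclidean length of a plane vector. -/
def vsq (v : Fin 2 → ℝ) : ℝ := v 0 ^ 2 + v 1 ^ 2

theorem vsq_nonneg (v : Fin 2 → ℝ) : 0 ≤ vsq v := by unfold vsq; positivity

theorem vsq_pos {v : Fin 2 → ℝ} (hv : v ≠ 0) : 0 < vsq v := by
  unfold vsq
  by_contra h
  apply hv
  have h0 : v 0 = 0 := by nlinarith [sq_nonneg (v 0), sq_nonneg (v 1)]
  have h1 : v 1 = 0 := by nlinarith [sq_nonneg (v 0), sq_nonneg (v 1)]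
  ext i
  fin_cases i
  · exact h0
  · exact h1

theorem vsq_smul (a : ℝ) (v : Fin 2 → ℝ) : vsq (a • v) = a ^ 2 * vsq v := by
  simp [vsq]; ring

theorem vsq_smul_le (g : SL2R) (v : Fin 2 → ℝ) : vsq (g • v) ≤ SL2R.nsq g * vsq v := by
  simp only [vsq, SL2R.nsq, SL2R.smul_entry]
  nlinarith [sq_nonneg (g 0 0 * v 1 - g 0 1 * v 0), sq_nonneg (g 1 0 * v 1 - g 1 1 * v 0)]

theorem sq_norm_le_vsq (v : Fin 2 → ℝ) : ‖v‖ ^ 2 ≤ vsq v := by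
  have h : ‖v‖ ≤ Real.sqrt (vsq v) := by
    rw [pi_norm_le_iff_of_nonneg (Real.sqrt_nonneg _)]
    intro i
    rw [Real.norm_eq_abs]
    apply Real.abs_le_sqrt
    unfold vsq
    fin_cases i
    · simp only [Fin.zero_eta]; nlinarith [sq_nonneg (v 1)]
    · simp only [Fin.mk_one]; nlinarith [sq_nonneg (v 0)]
  calc ‖v‖ ^ 2 ≤ Real.sqrt (vsq v) ^ 2 := by gcongr
    _ = vsq v := Real.sq_sqrt (vsq_nonneg v)

theorem vsq_le_sq_norm (v : Fin 2 → ℝ) : vsq v ≤ 2 * ‖v‖ ^ 2 := by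
  have h : ∀ i, v i ^ 2 ≤ ‖v‖ ^ 2 := fun i => by
    rw [← sq_abs, ← Real.norm_eq_abs]
    have := norm_le_pi_norm v i
    gcongr
  have h0 := h 0
  have h1 := h 1
  unfold vsq
  linarith

theorem plane_ext {v w : Fin 2 → ℝ} (h0 : v 0 = w 0) (h1 : v 1 = w 1) : v = w := by
  ext i
  fin_cases i
  · exact h0
  · exact h1

theorem plane_ne_zero {v : Fin 2 → ℝ} (h : v 0 ≠ 0 ∨ v 1 ≠ 0) : v ≠ 0 := by
  rintro rfl
  simp at h

/-! ### The topology of the projective line -/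

namespace P1

/-- The point of the projective line below a nonzero vector (with a default value at `0`). -/
noncomputable def pt (v : Fin 2 → ℝ) : P1 :=
  if h : v ≠ 0 then Projectivization.mk ℝ v h else Projectivization.mk ℝ ![1, 0] (by simp)

theorem pt_eq_mk {v : Fin 2 → ℝ} (h : v ≠ 0) : pt v = Projectivization.mk ℝ v h := by
  simp [pt, h]

theorem exists_pt (q : P1) : ∃ v, v ≠ 0 ∧ pt v = q :=
  ⟨q.rep, q.rep_nonzero, by rw [pt_eq_mk q.rep_nonzero, Projectivization.mk_rep]⟩

theorem isQuotientMap_mk : IsQuotientMap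
    (fun v : {v : Fin 2 → ℝ // v ≠ 0} => (Projectivization.mk ℝ v.1 v.2 : P1)) := by
  refine ⟨⟨rfl⟩, ?_⟩
  intro q
  exact ⟨⟨q.rep, q.rep_nonzero⟩, Projectivization.mk_rep q⟩

theorem isQuotientMap_pt : IsQuotientMap (fun v : {v : Fin 2 → ℝ // v ≠ 0} => pt v.1) := by
  have : (fun v : {v : Fin 2 → ℝ // v ≠ 0} => pt v.1) =
      (fun v : {v : Fin 2 → ℝ // v ≠ 0} => (Projectivization.mk ℝ v.1 v.2 : P1)) := by
    ext v
    exact pt_eq_mk v.2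
  rw [this]
  exact isQuotientMap_mk

theorem isOpen_ne_zero : IsOpen {v : Fin 2 → ℝ | v ≠ 0} := isOpen_ne

theorem continuousAt_pt {v : Fin 2 → ℝ} (h : v ≠ 0) : ContinuousAt pt v := by
  have h1 : ContinuousOn pt {v : Fin 2 → ℝ | v ≠ 0} := by
    rw [continuousOn_iff_continuous_domRestrict]
    exact isQuotientMap_pt.continuous
  exact h1.continuousAt (isOpen_ne_zero.mem_nhds h)

theorem isOpen_iff (s : Set P1) : IsOpen s ↔ IsOpen {v : Fin 2 → ℝ | v ≠ 0 ∧ pt v ∈ s} := by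
  rw [← isQuotientMap_pt.isOpen_preimage]
  have : {v : Fin 2 → ℝ | v ≠ 0 ∧ pt v ∈ s} = Subtype.val ''
      ((fun v : {v : Fin 2 → ℝ // v ≠ 0} => pt v.1) ⁻¹' s) := by
    ext v
    constructor
    · rintro ⟨h, h'⟩
      exact ⟨⟨v, h⟩, h', rfl⟩
    · rintro ⟨w, h, rfl⟩
      exact ⟨w.2, h⟩
  rw [this]
  exact (isOpen_ne_zero.isOpenEmbedding_subtypeVal.isOpen_iff_image_isOpen)

theorem pt_eq_pt_iff {v w : Fin 2 → ℝ} (hv : v ≠ 0) (hw : w ≠ 0) :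
    pt v = pt w ↔ v 0 * w 1 = v 1 * w 0 := by
  rw [pt_eq_mk hv, pt_eq_mk hw, Projectivization.mk_eq_mk_iff']
  constructor
  · rintro ⟨a, rfl⟩
    simp; ring
  · intro h
    have hs := vsq_pos hw
    refine ⟨(v 0 * w 0 + v 1 * w 1) / vsq w, plane_ext ?_ ?_⟩
    · simp only [Pi.smul_apply, smul_eq_mul]
      field_simp
      unfold vsq
      linear_combination (-w 1) * h
    · simp only [Pi.smul_apply, smul_eq_mul]
      field_simp
      unfold vsq
      linear_combination (w 0) * h

theorem pt_smul {a : ℝ} (ha : a ≠ 0) (v : Fin 2 → ℝ) : pt (a • v) = pt v := by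
  by_cases hv : v = 0
  · simp [hv]
  · rw [pt_eq_pt_iff (smul_ne_zero ha hv) hv]
    simp; ring

theorem smul_ne_zero' (g : SL2R) {v : Fin 2 → ℝ} (hv : v ≠ 0) : g • v ≠ 0 :=
  (smul_ne_zero_iff_ne g).mpr hv

theorem smul_pt (g : SL2R) {v : Fin 2 → ℝ} (hv : v ≠ 0) : g • pt v = pt (g • v) := by
  rw [pt_eq_mk hv, pt_eq_mk (smul_ne_zero' g hv), Projectivization.smul_mk]

theorem continuous_smul_vec (g : SL2R) : Continuous (fun v : Fin 2 → ℝ => g • v) := by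
  refine continuous_pi fun i => ?_
  simp only [SL2R.smul_entry]
  fun_prop

instance : ContinuousConstSMul SL2R P1 where
  continuous_const_smul g := by
    rw [isQuotientMap_pt.continuous_iff]
    rw [continuous_iff_continuousAt]
    intro v
    have : ((fun q : P1 => g • q) ∘ fun v : {v : Fin 2 → ℝ // v ≠ 0} => pt v.1) =
        fun v : {v : Fin 2 → ℝ // v ≠ 0} => pt (g • v.1) := by
      ext w
      exact smul_pt g w.2
    rw [this]
    refine ContinuousAt.comp (g := pt) (f := fun v : {v : Fin 2 → ℝ // v ≠ 0} => g • v.1)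
      (continuousAt_pt (smul_ne_zero' g v.2)) ?_
    exact ((continuous_smul_vec g).comp continuous_subtype_val).continuousAt

theorem neg_smul (g : SL2R) (q : P1) : (-g) • q = g • q := by
  obtain ⟨v, hv, rfl⟩ := exists_pt q
  rw [smul_pt _ hv, smul_pt _ hv]
  have : (-g) • v = (-1 : ℝ) • (g • v) := by
    apply plane_ext <;>
    · simp only [SL2R.smul_entry, SL2R.neg_entry, Pi.smul_apply, smul_eq_mul]; ring
  rw [this, pt_smul (by norm_num)]

/-- The point of the unit circle such that `v vᵀ / |v|² = (1 - p) / 2`, where `p` stands for the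
symmetric matrix `!![p.1, p.2; p.2, -p.1]`. -/
noncomputable def dirVec (v : Fin 2 → ℝ) : ℝ × ℝ :=
  ((v 1 ^ 2 - v 0 ^ 2) / vsq v, -(2 * v 0 * v 1) / vsq v)

/-- The homeomorphism from the projective line onto the unit circle. -/
noncomputable def dir (q : P1) : ℝ × ℝ := dirVec q.rep

theorem dir_pt {v : Fin 2 → ℝ} (hv : v ≠ 0) : dir (pt v) = dirVec v := by
  unfold dir
  rw [pt_eq_mk hv]
  obtain ⟨a, ha⟩ := Projectivization.exists_smul_eq_mk_rep ℝ v hv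
  rw [← ha]
  have h0 : (a : ℝ) ≠ 0 := a.ne_zero
  have h1 := (vsq_pos hv).ne'
  have h2 : vsq (a • v) = (a : ℝ) ^ 2 * vsq v := vsq_smul (a : ℝ) v
  unfold dirVec
  rw [h2]
  simp only [Pi.smul_apply, Units.smul_def, smul_eq_mul]
  ext
  · simp only; field_simp
  · simp only; field_simp

theorem continuous_vsq : Continuous vsq := by
  unfold vsq; fun_prop

theorem continuous_dir : Continuous dir := by
  rw [isQuotientMap_pt.continuous_iff]
  have : (dir ∘ fun v : {v : Fin 2 → ℝ // v ≠ 0} => pt v.1) = fun v => dirVec v.1 := by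
    ext1 v
    exact dir_pt v.2
  rw [this]
  have hv : Continuous fun v : {v : Fin 2 → ℝ // v ≠ 0} => vsq v.1 :=
    continuous_vsq.comp continuous_subtype_val
  have h0 : ∀ v : {v : Fin 2 → ℝ // v ≠ 0}, vsq v.1 ≠ 0 := fun v => (vsq_pos v.2).ne'
  have hc : ∀ i, Continuous fun v : {v : Fin 2 → ℝ // v ≠ 0} => v.1 i := fun i =>
    (continuous_apply i).comp continuous_subtype_val
  unfold dirVec
  refine Continuous.prodMk (Continuous.div ?_ hv h0) (Continuous.div ?_ hv h0)
  · exact ((hc 1).pow 2).sub ((hc 0).pow 2)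
  · exact ((continuous_const.mul (hc 0)).mul (hc 1)).neg

theorem dir_injective : Function.Injective dir := by
  intro q r h
  obtain ⟨v, hv, rfl⟩ := exists_pt q
  obtain ⟨w, hw, rfl⟩ := exists_pt r
  rw [dir_pt hv, dir_pt hw] at h
  rw [pt_eq_pt_iff hv hw]
  have h1 := congrArg Prod.fst h
  have h2 := congrArg Prod.snd h
  have hv' := vsq_pos hv
  have hw' := vsq_pos hw
  simp only [dirVec] at h1 h2
  rw [div_eq_div_iff hv'.ne' hw'.ne'] at h1 h2
  unfold vsq at h1 h2 hv' hw'
  have e : (v 0 * w 1 - v 1 * w 0) ^ 2 * ((v 0 ^ 2 + v 1 ^ 2) * (w 0 ^ 2 + w 1 ^ 2)) = 0 := by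
    linear_combination (-(v 0 * w 1 - v 1 * w 0) * (v 0 * w 1 + v 1 * w 0) / 2) * h1 +
      ((v 0 * w 1 - v 1 * w 0) * (v 0 * w 0 - v 1 * w 1) / 2) * h2
  have h3 := mul_pos hv' hw'
  have h4 := (mul_eq_zero.mp e).resolve_right h3.ne'
  have h5 := pow_eq_zero_iff (two_ne_zero) |>.mp h4
  linarith

instance : CompactSpace P1 := by
  have hc : IsCompact (Metric.sphere (0 : Fin 2 → ℝ) 1) := isCompact_sphere 0 1
  have hne : ∀ v ∈ Metric.sphere (0 : Fin 2 → ℝ) 1, v ≠ 0 := by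
    rintro v hv rfl
    simp at hv
  have himg : pt '' Metric.sphere (0 : Fin 2 → ℝ) 1 = Set.univ := by
    rw [Set.eq_univ_iff_forall]
    intro q
    obtain ⟨v, hv, rfl⟩ := exists_pt q
    have hn : ‖v‖ ≠ 0 := norm_ne_zero_iff.mpr hv
    refine ⟨‖v‖⁻¹ • v, ?_, pt_smul (inv_ne_zero hn) v⟩
    simp [norm_smul, hn]
  refine ⟨himg ▸ hc.image_of_continuousOn ?_⟩
  intro v hv
  exact (continuousAt_pt (hne v hv)).continuousWithinAt

theorem isClosedEmbedding_dir : IsClosedEmbedding dir :=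
  continuous_dir.isClosedEmbedding dir_injective

instance : T2Space P1 := isClosedEmbedding_dir.isEmbedding.t2Space

theorem dirVec_sq {v : Fin 2 → ℝ} (hv : v ≠ 0) : (dirVec v).1 ^ 2 + (dirVec v).2 ^ 2 = 1 := by
  have := (vsq_pos hv).ne'
  simp only [dirVec]
  field_simp
  unfold vsq
  ring

theorem dir_sq (q : P1) : (dir q).1 ^ 2 + (dir q).2 ^ 2 = 1 := dirVec_sq q.rep_nonzero

theorem exists_dir_eq {p : ℝ × ℝ} (hp : p.1 ^ 2 + p.2 ^ 2 = 1) : ∃ q, dir q = p := by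
  -- The vector used as preimage in the general case vanishes at `(-1, 0)`, which is the image of
  -- the first coordinate axis.
  by_cases h : p.1 = -1
  · have h2 : p.2 = 0 := by
      have : p.2 ^ 2 = 0 := by rw [h] at hp; linarith
      exact pow_eq_zero_iff two_ne_zero |>.mp this
    refine ⟨pt ![1, 0], ?_⟩
    rw [dir_pt (by simp)]
    ext <;> simp [dirVec, vsq, h, h2]
  · have h1 : 1 + p.1 ≠ 0 := fun h' => h (by linarith)
    have hv : (![-p.2, 1 + p.1] : Fin 2 → ℝ) ≠ 0 := plane_ne_zero (Or.inr (by simpa using h1))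
    have hs : vsq ![-p.2, 1 + p.1] = 2 * (1 + p.1) := by
      simp [vsq]; linear_combination hp
    refine ⟨pt ![-p.2, 1 + p.1], ?_⟩
    rw [dir_pt hv]
    simp only [dirVec, hs]
    ext
    · simp only [Matrix.cons_val_zero, Matrix.cons_val_one]
      field_simp
      linear_combination (-1 : ℝ) * hp
    · simp only [Matrix.cons_val_zero, Matrix.cons_val_one]
      field_simp

end P1

/-! ### Exponential growth of products implies uniform hyperbolicity -/

namespace SL2R

/-- The point of the Klein disc given by `gᵀ g`. -/
noncomputable def klein (g : SL2R) : ℝ × ℝ :=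
  ((g 0 0 ^ 2 + g 1 0 ^ 2 - g 0 1 ^ 2 - g 1 1 ^ 2) / nsq g,
    2 * (g 0 0 * g 0 1 + g 1 0 * g 1 1) / nsq g)

/-- This is `det (gᵀ g) = 1` after dividing by the trace. It shows that the point approaches the
unit circle as the norm of `g` grows. -/
theorem klein_sq (g : SL2R) : (klein g).1 ^ 2 + (klein g).2 ^ 2 = 1 - 4 / nsq g ^ 2 := by
  have h0 := (nsq_pos g).ne'
  have hd := det_entries g
  simp only [klein]
  field_simp
  unfold nsq
  linear_combination (-4 * (g 0 0 * g 1 1 - g 0 1 * g 1 0) - 4) * hd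

/-- Up to normalization the left side is the polarized determinant of `gᵀ g` and `gᵀ bᵀ b g`. It is
invariant under `g`, so it can be computed from the identity and `bᵀ b`, which gives the trace of
`bᵀ b`. -/
theorem klein_inner (b g : SL2R) :
    1 - ((klein g).1 * (klein (b * g)).1 + (klein g).2 * (klein (b * g)).2) =
      2 * nsq b / (nsq g * nsq (b * g)) := by
  have h0 := (nsq_pos g).ne'
  have h1 := (nsq_pos (b * g)).ne'
  have hd := det_entries g
  simp only [klein]
  field_simp
  simp only [nsq, mul_entry]
  linear_combination (2 * (b 0 0 ^ 2 + b 0 1 ^ 2 + b 1 0 ^ 2 + b 1 1 ^ 2) *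
    ((g 0 0 * g 1 1 - g 0 1 * g 1 0) + 1)) * hd

/-- Both points lie in the disc, so their squared distance is at most `2 (1 - inner product)`. A
bounded factor on the left therefore moves the point by the inverse of the norm of `g`, and growing
products yield Cauchy sequences. -/
theorem dist_klein_mul_le (b g : SL2R) :
    dist (klein g) (klein (b * g)) ≤ 2 * nsq b / nsq g := by
  have hb := nsq_pos b
  have hg := nsq_pos g
  have hbg := nsq_pos (b * g)
  have e1 := klein_sq g
  have e2 := klein_sq (b * g)
  have e3 := klein_inner b g
  have p1 : 0 < 4 / nsq g ^ 2 := by positivity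
  have p2 : 0 < 4 / nsq (b * g) ^ 2 := by positivity
  have hle : nsq g ≤ nsq b * nsq (b * g) := by
    have := nsq_mul_le b⁻¹ (b * g)
    rwa [inv_mul_cancel_left, nsq_inv] at this
  have hk : 2 * (2 * nsq b / (nsq g * nsq (b * g))) ≤ (2 * nsq b / nsq g) ^ 2 := by
    rw [div_pow, mul_div_assoc', div_le_div_iff₀ (by positivity) (by positivity)]
    have : 0 < 4 * nsq b * nsq g := by positivity
    nlinarith
  have hsum : ((klein g).1 - (klein (b * g)).1) ^ 2 + ((klein g).2 - (klein (b * g)).2) ^ 2 ≤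
      (2 * nsq b / nsq g) ^ 2 := by nlinarith
  have hpos : 0 ≤ 2 * nsq b / nsq g := by positivity
  rw [Prod.dist_eq, Real.dist_eq, Real.dist_eq]
  apply max_le
  · apply abs_le_of_sq_le_sq _ hpos
    nlinarith [sq_nonneg ((klein g).2 - (klein (b * g)).2)]
  · apply abs_le_of_sq_le_sq _ hpos
    nlinarith [sq_nonneg ((klein g).1 - (klein (b * g)).1)]

/-- Evaluating `gᵀ g` at `v`: the contraction of `v` is governed by how close `dirVec v` is to the
disc point of `g`, so the limit on the circle is the contracted direction. -/
theorem vsq_smul_eq (g : SL2R) {v : Fin 2 → ℝ} (hv : v ≠ 0) :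
    vsq (g • v) = vsq v * nsq g *
      ((1 - ((klein g).1 * (P1.dirVec v).1 + (klein g).2 * (P1.dirVec v).2)) / 2) := by
  have h0 := (nsq_pos g).ne'
  have h1 := (vsq_pos hv).ne'
  simp only [klein, P1.dirVec]
  field_simp
  simp only [nsq, vsq, smul_entry]
  ring

theorem continuous_entry (i j : Fin 2) : Continuous (fun g : SL2R => g i j) := by
  fun_prop

theorem continuous_nsq : Continuous nsq := by
  unfold nsq
  have := continuous_entry
  fun_prop (disch := assumption)

theorem continuous_klein : Continuous klein := by
  have h := continuous_entry
  unfold klein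
  refine Continuous.prodMk (Continuous.div ?_ continuous_nsq fun g => (nsq_pos g).ne')
    (Continuous.div ?_ continuous_nsq fun g => (nsq_pos g).ne')
  · exact ((((h 0 0).pow 2).add ((h 1 0).pow 2)).sub ((h 0 1).pow 2)).sub ((h 1 1).pow 2)
  · exact continuous_const.mul (((h 0 0).mul (h 0 1)).add ((h 1 0).mul (h 1 1)))

end SL2R

theorem eq_of_inner_eq_one {p q : ℝ × ℝ} (hp : p.1 ^ 2 + p.2 ^ 2 = 1) (hq : q.1 ^ 2 + q.2 ^ 2 = 1)
    (h : p.1 * q.1 + p.2 * q.2 = 1) : p = q := by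
  have h1 : (p.1 - q.1) ^ 2 + (p.2 - q.2) ^ 2 = 0 := by linear_combination hp + hq - 2 * h
  have h2 : p.1 - q.1 = 0 := by nlinarith [sq_nonneg (p.1 - q.1), sq_nonneg (p.2 - q.2)]
  have h3 : p.2 - q.2 = 0 := by nlinarith [sq_nonneg (p.1 - q.1), sq_nonneg (p.2 - q.2)]
  ext <;> linarith

/-! ### Stable and unstable directions of a cocycle with growing products. -/

section Cocycle

variable {N : ℕ}

theorem forwardProd_succ' (A : Fin N → SL2R) (x : FullShift N) (n : ℕ) :
    forwardProd A x (n + 1) = forwardProd A (shiftMap x) n * A (x 0) := by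
  induction n with
  | zero => simp [forwardProd]
  | succ n ih =>
    rw [forwardProd, ih, ← mul_assoc, forwardProd]
    simp [shiftMap]

/-- The time reversal of the shift space. -/
def reverseShift (x : FullShift N) : FullShift N := fun k => x (-1 - k)

theorem reverseShift_reverseShift (x : FullShift N) : reverseShift (reverseShift x) = x := by
  ext k
  simp [reverseShift]

theorem continuous_reverseShift : Continuous (reverseShift (N := N)) :=
  continuous_pi fun k => continuous_apply (-1 - k)

theorem shiftMap_reverseShift_shiftMap (x : FullShift N) :
    shiftMap (reverseShift (shiftMap x)) = reverseShift x := by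
  ext k
  simp only [shiftMap, reverseShift]
  congr 2
  ring

theorem forwardProd_inv_reverseShift (A : Fin N → SL2R) (x : FullShift N) (n : ℕ) :
    forwardProd (fun i => (A i)⁻¹) (reverseShift x) n = backwardProd A x n := by
  induction n with
  | zero => rfl
  | succ n ih =>
    rw [forwardProd, backwardProd, ih]
    simp only [reverseShift]
    congr 4
    ring

theorem backwardProd_eq (A : Fin N → SL2R) (x : FullShift N) (n : ℕ) :
    backwardProd A x n = (forwardProd A (fun i => x (i - n)) n)⁻¹ := by
  induction n with
  | zero => simp [backwardProd, forwardProd]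
  | succ n ih =>
    rw [forwardProd_succ', backwardProd, ih, mul_inv_rev]
    have h1 : shiftMap (fun i => x (i - ((n + 1 : ℕ) : ℤ))) = fun i => x (i - n) := by
      ext i
      simp only [shiftMap]
      congr 2
      push_cast
      ring
    rw [h1]
    congr 3

theorem iterate_shiftMap_apply (x : FullShift N) (n : ℕ) (i : ℤ) :
    (shiftMap^[n] x) i = x (i + n) := by
  induction n generalizing x with
  | zero => simp
  | succ n ih =>
    rw [Function.iterate_succ_apply, ih]
    simp only [shiftMap]
    congr 1
    push_cast
    ring

theorem backwardProd_iterate_shiftMap (A : Fin N → SL2R) (x : FullShift N) (n : ℕ) :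
    backwardProd A (shiftMap^[n] x) n = (forwardProd A x n)⁻¹ := by
  rw [backwardProd_eq]
  congr 2
  ext i
  simp [iterate_shiftMap_apply]

theorem continuous_forwardProd (A : Fin N → SL2R) (n : ℕ) :
    Continuous fun x => forwardProd A x n := by
  induction n with
  | zero => exact continuous_const
  | succ n ih =>
    exact ((continuous_of_discreteTopology (f := A)).comp (continuous_apply (n : ℤ))).mul ih

theorem exists_nsq_bound (A : Fin N → SL2R) : ∃ L : ℝ, 1 ≤ L ∧ ∀ i, nsq (A i) ≤ L := by
  refine ⟨1 + ∑ i, nsq (A i), ?_, fun i => ?_⟩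
  · have := Finset.sum_nonneg fun i (_ : i ∈ Finset.univ) => (nsq_pos (A i)).le
    linarith
  · have := Finset.single_le_sum (fun i (_ : i ∈ Finset.univ) => (nsq_pos (A i)).le)
      (Finset.mem_univ i)
    linarith

theorem nsq_forwardProd_le {A : Fin N → SL2R} {L : ℝ} (hL : 1 ≤ L) (hA : ∀ i, nsq (A i) ≤ L)
    (x : FullShift N) (n : ℕ) : nsq (forwardProd A x n) ≤ 2 * L ^ n := by
  induction n with
  | zero => simp [forwardProd, nsq_one]
  | succ n ih =>
    rw [forwardProd]
    calc _ ≤ nsq (A (x n)) * nsq (forwardProd A x n) := nsq_mul_le _ _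
      _ ≤ L * (2 * L ^ n) := by
        gcongr
        · exact (nsq_pos _).le
        · exact hA _
      _ = 2 * L ^ (n + 1) := by ring

theorem dist_klein_succ_le {A : Fin N → SL2R} {L : ℝ} (hA : ∀ i, nsq (A i) ≤ L)
    {c ρ : ℝ} (hc : 0 < c) {x : FullShift N}
    (hx : ∀ n, c ≤ nsq (forwardProd A x n) * ρ ^ n) (n : ℕ) :
    dist (klein (forwardProd A x n)) (klein (forwardProd A x (n + 1))) ≤ 2 * L / c * ρ ^ n := by
  have h1 := dist_klein_mul_le (A (x n)) (forwardProd A x n)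
  have h2 := nsq_pos (forwardProd A x n)
  have h3 := nsq_pos (A (x n))
  have hL : 0 < L := lt_of_lt_of_le h3 (hA _)
  have h4 : 2 * nsq (A (x n)) / nsq (forwardProd A x n) ≤ 2 * L / c * ρ ^ n := by
    rw [div_mul_eq_mul_div, div_le_div_iff₀ h2 hc]
    calc 2 * nsq (A (x n)) * c ≤ 2 * L * (nsq (forwardProd A x n) * ρ ^ n) := by
          have := hA (x n)
          have := hx n
          gcongr
      _ = _ := by ring
  exact h1.trans h4

theorem dist_klein_le_of_tendsto {A : Fin N → SL2R} {L : ℝ} (hA : ∀ i, nsq (A i) ≤ L)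
    {c ρ : ℝ} (hc : 0 < c) (hρ : ρ < 1) {x : FullShift N}
    (hx : ∀ n, c ≤ nsq (forwardProd A x n) * ρ ^ n) {p : ℝ × ℝ}
    (hp : Tendsto (fun n => klein (forwardProd A x n)) atTop (𝓝 p)) (n : ℕ) :
    dist (klein (forwardProd A x n)) p ≤ 2 * L / c / (1 - ρ) * ρ ^ n := by
  have := dist_le_of_le_geometric_of_tendsto ρ (2 * L / c) hρ (dist_klein_succ_le hA hc hx) hp n
  rwa [mul_div_right_comm] at this

/-- `s` is the field of stable directions of the cocycle `A`. -/
structure IsStableField (A : Fin N → SL2R) (s : FullShift N → P1) : Prop where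
  continuous : Continuous s
  equivariant : ∀ x, A (x 0) • s x = s (shiftMap x)
  tendsto : ∀ x, Tendsto (fun n => klein (forwardProd A x n)) atTop (𝓝 (P1.dir (s x)))

/-- Growth makes the disc points of the forward products uniformly Cauchy, and `klein_sq` puts the
limit on the circle, that is, on the projective line. Continuity comes from uniform convergence. -/
theorem exists_isStableField {A : Fin N → SL2R} {c ρ : ℝ} (hc : 0 < c) (hρ0 : 0 < ρ) (hρ : ρ < 1)
    (hG : ∀ x n, c ≤ nsq (forwardProd A x n) * ρ ^ n) : ∃ s, IsStableField A s := by
  obtain ⟨L, hL1, hA⟩ := exists_nsq_bound A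
  have hlim : ∀ x, ∃ p, Tendsto (fun n => klein (forwardProd A x n)) atTop (𝓝 p) := fun x =>
    cauchySeq_tendsto_of_complete
      (cauchySeq_of_le_geometric ρ (2 * L / c) hρ (dist_klein_succ_le hA hc (hG x)))
  choose p hp using hlim
  have hpow : Tendsto (fun n : ℕ => ρ ^ n) atTop (𝓝 0) :=
    tendsto_pow_atTop_nhds_zero_of_lt_one hρ0.le hρ
  have hcirc : ∀ x, (p x).1 ^ 2 + (p x).2 ^ 2 = 1 := by
    intro x
    have h1 : Tendsto (fun n => (klein (forwardProd A x n)).1 ^ 2 +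
        (klein (forwardProd A x n)).2 ^ 2) atTop (𝓝 ((p x).1 ^ 2 + (p x).2 ^ 2)) := by
      have hcont : Continuous fun q : ℝ × ℝ => q.1 ^ 2 + q.2 ^ 2 := by fun_prop
      exact (hcont.tendsto _).comp (hp x)
    have h2 : Tendsto (fun n => (klein (forwardProd A x n)).1 ^ 2 +
        (klein (forwardProd A x n)).2 ^ 2) atTop (𝓝 1) := by
      have hz : Tendsto (fun n => 4 / nsq (forwardProd A x n) ^ 2) atTop (𝓝 0) := by
        refine squeeze_zero (fun n => by positivity) (g := fun n => 4 / c ^ 2 * (ρ ^ n * ρ ^ n))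
          (fun n => ?_) ?_
        · have h3 := nsq_pos (forwardProd A x n)
          rw [div_mul_eq_mul_div, div_le_div_iff₀ (by positivity) (by positivity)]
          have := mul_self_le_mul_self hc.le (hG x n)
          nlinarith
        · simpa using (hpow.mul hpow).const_mul (4 / c ^ 2)
      simp only [klein_sq]
      simpa using hz.const_sub 1
    exact tendsto_nhds_unique h1 h2
  have hs : ∀ x, ∃ q, P1.dir q = p x := fun x => P1.exists_dir_eq (hcirc x)
  choose s hs using hs
  refine ⟨s, ?_, ?_, ?_⟩
  · rw [P1.isClosedEmbedding_dir.isEmbedding.continuous_iff]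
    have : P1.dir ∘ s = p := funext hs
    rw [this]
    have hu : TendstoUniformly (fun n x => klein (forwardProd A x n)) p atTop := by
      rw [Metric.tendstoUniformly_iff]
      intro ε hε
      have h0 : Tendsto (fun n : ℕ => 2 * L / c / (1 - ρ) * ρ ^ n) atTop (𝓝 0) := by
        simpa using hpow.const_mul (2 * L / c / (1 - ρ))
      filter_upwards [h0.eventually_lt_const hε] with n hn x
      rw [dist_comm]
      exact lt_of_le_of_lt (dist_klein_le_of_tendsto hA hc hρ (hG x) (hp x) n) hn
    exact hu.continuous (Frequently.of_forall fun n =>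
      continuous_klein.comp (continuous_forwardProd A n))
  · intro x
    obtain ⟨v, hv, hvs⟩ := P1.exists_pt (s x)
    have hw := P1.smul_ne_zero' (A (x 0)) hv
    apply P1.dir_injective
    apply eq_of_inner_eq_one (P1.dir_sq _) (P1.dir_sq _)
    rw [← hvs, P1.smul_pt _ hv, P1.dir_pt hw, hs]
    have hdv : P1.dirVec v = p x := by rw [← P1.dir_pt hv, hvs, hs]
    have hdot : ∀ (y : FullShift N) (q : ℝ × ℝ), Tendsto (fun n =>
        (1 - ((klein (forwardProd A y n)).1 * q.1 + (klein (forwardProd A y n)).2 * q.2)) / 2)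
        atTop (𝓝 ((1 - ((p y).1 * q.1 + (p y).2 * q.2)) / 2)) := by
      intro y q
      have hcont : Continuous fun r : ℝ × ℝ => (1 - (r.1 * q.1 + r.2 * q.2)) / 2 := by fun_prop
      exact (hcont.tendsto _).comp (hp y)
    -- Equivariance: the stable line consists of the vectors for which `vsq (g • v) / nsq g` tends
    -- to zero along the forward products `g`. This property is passed to the shifted point, at the
    -- cost of the bounded factor `L`.
    have h1 : Tendsto (fun n => vsq (forwardProd A x (n + 1) • v) / nsq (forwardProd A x (n + 1)))
        atTop (𝓝 0) := by
      have h2 := ((hdot x (P1.dirVec v)).const_mul (vsq v)).comp (tendsto_add_atTop_nat 1)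
      have h3 : (1 - ((p x).1 * (P1.dirVec v).1 + (p x).2 * (P1.dirVec v).2)) / 2 = 0 := by
        rw [hdv]
        linear_combination (-1 / 2) * hcirc x
      rw [h3, mul_zero] at h2
      refine h2.congr fun n => ?_
      simp only [Function.comp]
      rw [vsq_smul_eq _ hv]
      have := (nsq_pos (forwardProd A x (n + 1))).ne'
      field_simp
    have h4 : Tendsto (fun n => vsq (forwardProd A (shiftMap x) n • (A (x 0) • v)) /
        nsq (forwardProd A (shiftMap x) n)) atTop (𝓝 0) := by
      refine squeeze_zero (g := fun n => L *
        (vsq (forwardProd A x (n + 1) • v) / nsq (forwardProd A x (n + 1))))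
        (fun n => div_nonneg (vsq_nonneg _) (nsq_pos _).le) (fun n => ?_) ?_
      · rw [smul_smul, ← forwardProd_succ']
        have h5 : nsq (forwardProd A x (n + 1)) ≤ nsq (forwardProd A (shiftMap x) n) * L := by
          rw [forwardProd_succ']
          refine (nsq_mul_le _ _).trans ?_
          gcongr
          · exact (nsq_pos _).le
          · exact hA _
        have h6 := nsq_pos (forwardProd A x (n + 1))
        have h7 := nsq_pos (forwardProd A (shiftMap x) n)
        have h8 := vsq_nonneg (forwardProd A x (n + 1) • v)
        rw [mul_div_assoc', div_le_div_iff₀ h7 h6]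
        nlinarith
      · simpa using h1.const_mul L
    have h9 := ((hdot (shiftMap x) (P1.dirVec (A (x 0) • v))).const_mul (vsq (A (x 0) • v)))
    have h10 : Tendsto (fun n => vsq (forwardProd A (shiftMap x) n • (A (x 0) • v)) /
        nsq (forwardProd A (shiftMap x) n)) atTop (𝓝 (vsq (A (x 0) • v) *
        ((1 - ((p (shiftMap x)).1 * (P1.dirVec (A (x 0) • v)).1 +
          (p (shiftMap x)).2 * (P1.dirVec (A (x 0) • v)).2)) / 2))) := by
      refine h9.congr fun n => ?_
      rw [vsq_smul_eq _ hw]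
      have := (nsq_pos (forwardProd A (shiftMap x) n)).ne'
      field_simp
    have h11 := tendsto_nhds_unique h4 h10
    have h12 := vsq_pos hw
    have h13 := (mul_eq_zero.mp h11.symm).resolve_left h12.ne'
    linarith
  · intro x
    rw [hs]
    exact hp x

theorem IsStableField.iterate {A : Fin N → SL2R} {s : FullShift N → P1} (hs : IsStableField A s)
    (x : FullShift N) (n : ℕ) : forwardProd A x n • s x = s (shiftMap^[n] x) := by
  induction n generalizing x with
  | zero => simp [forwardProd]
  | succ n ih =>
    rw [forwardProd_succ', mul_smul, hs.equivariant, ih, Function.iterate_succ_apply]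

theorem IsStableField.reverse {A : Fin N → SL2R} {s : FullShift N → P1}
    (hs : IsStableField (fun i => (A i)⁻¹) s) (x : FullShift N) :
    A (x 0) • s (reverseShift x) = s (reverseShift (shiftMap x)) := by
  have h := hs.equivariant (reverseShift (shiftMap x))
  rw [shiftMap_reverseShift_shiftMap] at h
  rw [← h]
  simp [reverseShift, shiftMap]

theorem IsStableField.reverse_iterate {A : Fin N → SL2R} {s : FullShift N → P1}
    (hs : IsStableField (fun i => (A i)⁻¹) s) (x : FullShift N) (n : ℕ) :
    forwardProd A x n • s (reverseShift x) = s (reverseShift (shiftMap^[n] x)) := by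
  induction n generalizing x with
  | zero => simp [forwardProd]
  | succ n ih =>
    rw [forwardProd_succ', mul_smul, hs.reverse, ih, Function.iterate_succ_apply]

theorem growth_inv {A : Fin N → SL2R} {c ρ : ℝ}
    (hG : ∀ x n, c ≤ nsq (forwardProd A x n) * ρ ^ n) (x : FullShift N) (n : ℕ) :
    c ≤ nsq (forwardProd (fun i => (A i)⁻¹) x n) * ρ ^ n := by
  rw [← reverseShift_reverseShift x, forwardProd_inv_reverseShift, backwardProd_eq, nsq_inv]
  exact hG _ _

/-- If the stable and the unstable directions agree along an orbit, then the exponential growth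
rate of the products along the orbit may be doubled. -/
theorem growth_doubling {A : Fin N → SL2R} {s u : FullShift N → P1} (hs : IsStableField A s)
    (hu : IsStableField (fun i => (A i)⁻¹) u) {K : Set (FullShift N)}
    (hK : ∀ x ∈ K, s x = u (reverseShift x))
    (hK1 : ∀ x ∈ K, ∀ n : ℕ, shiftMap^[n] x ∈ K) (hK2 : ∀ x ∈ K, ∀ n : ℕ, (fun i => x (i - n)) ∈ K)
    {c ρ : ℝ} (hc : 0 < c) (hρ0 : 0 < ρ) (hρ : ρ < 1)
    (hG : ∀ x ∈ K, ∀ n, c ≤ nsq (forwardProd A x n) * ρ ^ n) :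
    ∃ c', 0 < c' ∧ ∀ x ∈ K, ∀ n, c' ≤ nsq (forwardProd A x n) * (ρ ^ 2) ^ n := by
  obtain ⟨L, hL1, hA⟩ := exists_nsq_bound A
  have hA' : ∀ i, nsq ((A i)⁻¹) ≤ L := fun i => by rw [nsq_inv]; exact hA i
  set C := 2 * L / c / (1 - ρ) with hC
  have hCpos : 0 < C := by
    have : 0 < 1 - ρ := by linarith
    positivity
  refine ⟨1 / C ^ 2, by positivity, fun x hx n => ?_⟩
  set g := forwardProd A x n with hg
  set y := shiftMap^[n] x with hy
  have hyK : y ∈ K := hK1 x hx n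
  have hG' : ∀ m, c ≤ nsq (forwardProd (fun i => (A i)⁻¹) (reverseShift y) m) * ρ ^ m := by
    intro m
    rw [forwardProd_inv_reverseShift, backwardProd_eq, nsq_inv]
    exact hG _ (hK2 y hyK m) m
  have d1 := dist_klein_le_of_tendsto hA hc hρ (hG x hx) (hs.tendsto x) n
  have d2 := dist_klein_le_of_tendsto hA' hc hρ hG' (hu.tendsto (reverseShift y)) n
  rw [forwardProd_inv_reverseShift, hy, backwardProd_iterate_shiftMap, ← hy, ← hg,
    ← hK y hyK] at d2
  rw [← hg] at d1
  obtain ⟨v, hv, hvs⟩ := P1.exists_pt (s x)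
  have hw := P1.smul_ne_zero' g hv
  have hws : P1.pt (g • v) = s y := by
    rw [← P1.smul_pt g hv, hvs, hs.iterate]
  rw [← hvs, P1.dir_pt hv] at d1
  rw [← hws, P1.dir_pt hw] at d2
  have e1 := vsq_smul_eq g hv
  have e2 := vsq_smul_eq g⁻¹ hw
  rw [inv_smul_smul, nsq_inv] at e2
  have hN := two_le_nsq g
  have hNpos := nsq_pos g
  -- For `p` in the disc with `|p|² = 1 - 4 / nsq² ` and `q` on the circle, `1 - ⟨p, q⟩ = |p - q|² /
  -- 2 + 2 / nsq²`. The sup distance loses a factor 2 in `|p - q|²`.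
  have key : ∀ (h : SL2R) (w : Fin 2 → ℝ), w ≠ 0 → nsq h = nsq g →
      dist (klein h) (P1.dirVec w) ≤ C * ρ ^ n →
      (1 - ((klein h).1 * (P1.dirVec w).1 + (klein h).2 * (P1.dirVec w).2)) / 2 ≤
        (C * ρ ^ n) ^ 2 / 2 + 1 / nsq g ^ 2 := by
    intro h w hw hh hd
    have k1 := klein_sq h
    rw [hh] at k1
    have k2 := P1.dirVec_sq hw
    rw [Prod.dist_eq, Real.dist_eq, Real.dist_eq] at hd
    have k3 := (le_max_left _ _).trans hd
    have k4 := (le_max_right _ _).trans hd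
    have k5 := sq_le_sq' (neg_le_of_abs_le k3) (le_of_abs_le k3)
    have k6 := sq_le_sq' (neg_le_of_abs_le k4) (le_of_abs_le k4)
    have k7 : 4 / nsq g ^ 2 = 4 * (1 / nsq g ^ 2) := by ring
    nlinarith
  have t1 := key g v hv rfl d1
  have t2 := key g⁻¹ (g • v) hw (nsq_inv g) d2
  set Θ := (C * ρ ^ n) ^ 2 / 2 + 1 / nsq g ^ 2 with hΘ
  have hv' := vsq_pos hv
  have hw' := vsq_pos hw
  -- The stable vector is almost maximally contracted by `g`, and by the coincidence of directions
  -- its image is almost maximally contracted by `g⁻¹`. Composing the two estimates returns `v`, so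
  -- `nsq g * Θ ≥ 1`; as `nsq g ≥ 2`, the term `1 / nsq g` takes at most half of this.
  have f1 : vsq (g • v) ≤ vsq v * (nsq g * Θ) := by
    rw [e1, mul_assoc]
    gcongr
  have f2 : vsq v ≤ vsq (g • v) * (nsq g * Θ) := by
    calc vsq v = _ := e2
      _ ≤ _ := by rw [mul_assoc]; gcongr
  have f3 : 1 ≤ nsq g * Θ := by
    by_contra hlt
    push Not at hlt
    have hnn : 0 ≤ nsq g * Θ := by positivity
    nlinarith
  have f4 : nsq g * Θ = nsq g * (ρ ^ 2) ^ n * C ^ 2 / 2 + 1 / nsq g := by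
    rw [hΘ]
    field_simp
    ring
  have f5 : 1 / nsq g ≤ 1 / 2 := one_div_le_one_div_of_le two_pos hN
  rw [div_le_iff₀ (by positivity)]
  linarith

/-- The points where the two directions coincide form a shift-invariant set. If it were nonempty,
repeated doubling of the growth rate on it would beat the trivial bound `2 * L ^ n` on the products.
-/
theorem stable_ne_unstable {A : Fin N → SL2R} {s u : FullShift N → P1} (hs : IsStableField A s)
    (hu : IsStableField (fun i => (A i)⁻¹) u) {c ρ : ℝ} (hc : 0 < c) (hρ0 : 0 < ρ) (hρ : ρ < 1)
    (hG : ∀ x n, c ≤ nsq (forwardProd A x n) * ρ ^ n) (x : FullShift N) :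
    s x ≠ u (reverseShift x) := by
  intro hx
  set K : Set (FullShift N) := {x | s x = u (reverseShift x)} with hKdef
  have hK1 : ∀ x ∈ K, ∀ n : ℕ, shiftMap^[n] x ∈ K := by
    intro x hx n
    show s _ = u _
    rw [← hs.iterate, ← hu.reverse_iterate, hx]
  have hK2 : ∀ x ∈ K, ∀ n : ℕ, (fun i => x (i - n)) ∈ K := by
    intro x hx n
    have e : shiftMap^[n] (fun i => x (i - n)) = x := by
      ext i
      simp [iterate_shiftMap_apply]
    have h1 := hs.iterate (fun i => x (i - n)) n
    have h2 := hu.reverse_iterate (fun i => x (i - n)) n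
    rw [e] at h1 h2
    have hx' : s x = u (reverseShift x) := hx
    rw [hx', ← h2] at h1
    exact MulAction.injective _ h1
  have hall : ∀ k : ℕ, ∃ c', 0 < c' ∧ ∀ x ∈ K, ∀ n,
      c' ≤ nsq (forwardProd A x n) * (ρ ^ 2 ^ k) ^ n := by
    intro k
    induction k with
    | zero => exact ⟨c, hc, fun x _ n => by simpa using hG x n⟩
    | succ k ih =>
      obtain ⟨c', hc', h⟩ := ih
      obtain ⟨c'', hc'', h'⟩ := growth_doubling hs hu (fun x hx => hx) hK1 hK2 hc'
        (by positivity) (pow_lt_one₀ hρ0.le hρ (by positivity)) h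
      refine ⟨c'', hc'', fun x hx n => ?_⟩
      rw [pow_succ, pow_mul]
      exact h' x hx n
  obtain ⟨L, hL1, hA⟩ := exists_nsq_bound A
  have hpow : Tendsto (fun k : ℕ => L * ρ ^ 2 ^ k) atTop (𝓝 0) := by
    have h1 : Tendsto (fun k : ℕ => ρ ^ 2 ^ k) atTop (𝓝 0) :=
      (tendsto_pow_atTop_nhds_zero_of_lt_one hρ0.le hρ).comp
        (tendsto_pow_atTop_atTop_of_one_lt one_lt_two)
    simpa using h1.const_mul L
  obtain ⟨k, hk⟩ := (hpow.eventually_lt_const (show (0 : ℝ) < 1 / 2 by norm_num)).exists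
  obtain ⟨c', hc', h⟩ := hall k
  have hz : Tendsto (fun n : ℕ => 2 * (1 / 2 : ℝ) ^ n) atTop (𝓝 0) := by
    simpa using (tendsto_pow_atTop_nhds_zero_of_lt_one (r := (1 / 2 : ℝ)) (by norm_num)
      (by norm_num)).const_mul 2
  obtain ⟨n, hn⟩ := (hz.eventually_lt_const hc').exists
  have h1 := h x hx n
  have h2 := nsq_forwardProd_le hL1 hA x n
  have h3 : nsq (forwardProd A x n) * (ρ ^ 2 ^ k) ^ n ≤ 2 * (1 / 2) ^ n := by
    calc _ ≤ 2 * L ^ n * (ρ ^ 2 ^ k) ^ n := by gcongr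
      _ = 2 * (L * ρ ^ 2 ^ k) ^ n := by rw [mul_pow]; ring
      _ ≤ _ := by gcongr
  linarith

/-- By compactness the stable and unstable directions are uniformly apart. The disc point of the
inverse product is close to the unstable direction at the endpoint of the orbit, hence far from the
stable one, so the inverse product expands stable vectors almost as much as its norm. -/
theorem stable_contraction {A : Fin N → SL2R} {s u : FullShift N → P1} (hs : IsStableField A s)
    (hu : IsStableField (fun i => (A i)⁻¹) u) {c ρ : ℝ} (hc : 0 < c) (hρ0 : 0 < ρ) (hρ : ρ < 1)
    (hG : ∀ x n, c ≤ nsq (forwardProd A x n) * ρ ^ n) (hne : ∀ x, s x ≠ u (reverseShift x)) :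
    ∃ C, 0 < C ∧ ∀ x n, ∀ v ∈ (s x).submodule,
      vsq (forwardProd A x n • v) ≤ C * ρ ^ n * vsq v := by
  rcases isEmpty_or_nonempty (FullShift N) with hE | hE
  · exact ⟨1, one_pos, fun x => (hE.false x).elim⟩
  obtain ⟨L, hL1, hA⟩ := exists_nsq_bound A
  have hA' : ∀ i, nsq ((A i)⁻¹) ≤ L := fun i => by rw [nsq_inv]; exact hA i
  set f : FullShift N → ℝ := fun x => 1 - ((P1.dir (u (reverseShift x))).1 * (P1.dir (s x)).1 +
    (P1.dir (u (reverseShift x))).2 * (P1.dir (s x)).2) with hf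
  have hfc : Continuous f := by
    have h1 : Continuous fun x => P1.dir (u (reverseShift x)) :=
      P1.continuous_dir.comp (hu.continuous.comp continuous_reverseShift)
    have h2 : Continuous fun x => P1.dir (s x) := P1.continuous_dir.comp hs.continuous
    exact continuous_const.sub ((h1.fst.mul h2.fst).add (h1.snd.mul h2.snd))
  obtain ⟨x₀, -, hmin⟩ := isCompact_univ.exists_isMinOn Set.univ_nonempty hfc.continuousOn
  have hpos : 0 < f x₀ := by
    have hle : 0 ≤ f x₀ := by
      have h1 := P1.dir_sq (u (reverseShift x₀))
      have h2 := P1.dir_sq (s x₀)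
      simp only [hf]
      nlinarith [sq_nonneg ((P1.dir (u (reverseShift x₀))).1 - (P1.dir (s x₀)).1),
        sq_nonneg ((P1.dir (u (reverseShift x₀))).2 - (P1.dir (s x₀)).2)]
    refine lt_of_le_of_ne hle fun h0 => hne x₀ ?_
    apply P1.dir_injective
    symm
    apply eq_of_inner_eq_one (P1.dir_sq _) (P1.dir_sq _)
    simp only [hf] at h0
    linarith
  set δ := f x₀ with hδ
  have hfδ : ∀ x, δ ≤ f x := fun x => hmin (Set.mem_univ x)
  set C := 2 * L / c / (1 - ρ) with hC
  have hz : Tendsto (fun n : ℕ => 2 * (C * ρ ^ n)) atTop (𝓝 0) := by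
    simpa using ((tendsto_pow_atTop_nhds_zero_of_lt_one hρ0.le hρ).const_mul C).const_mul 2
  obtain ⟨n₀, hn₀⟩ := eventually_atTop.mp (hz.eventually_lt_const (half_pos hpos))
  have hL0 : 0 < L := by linarith
  -- The first term serves for `n ≥ n₀`, the second covers the finitely many smaller `n` by the
  -- trivial bound.
  refine ⟨4 / (δ * c) + 2 * L ^ n₀ / ρ ^ n₀, by positivity, fun x n v hvs => ?_⟩
  by_cases hv : v = 0
  · simp [hv, vsq]
  have hvpt : P1.pt v = s x := by
    obtain ⟨r, hr, hrs⟩ := P1.exists_pt (s x)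
    rw [← hrs, P1.pt_eq_mk hr, Projectivization.submodule_mk, Submodule.mem_span_singleton] at hvs
    obtain ⟨a, rfl⟩ := hvs
    have ha : a ≠ 0 := by
      rintro rfl
      simp at hv
    rw [P1.pt_smul ha, hrs]
  have hv' := vsq_pos hv
  have hρn : 0 < ρ ^ n := by positivity
  set g := forwardProd A x n with hg
  rcases lt_or_ge n n₀ with hn | hn
  · have h1 := vsq_smul_le g v
    have h2 := nsq_forwardProd_le hL1 hA x n
    have h3 : (2 : ℝ) * L ^ n ≤ 2 * L ^ n₀ / ρ ^ n₀ * ρ ^ n := by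
      have h4 : L ^ n ≤ L ^ n₀ := pow_le_pow_right₀ hL1 hn.le
      have h5 : ρ ^ n₀ ≤ ρ ^ n := pow_le_pow_of_le_one hρ0.le hρ.le hn.le
      rw [div_mul_eq_mul_div, le_div_iff₀ (by positivity)]
      gcongr
    have h6 : 0 < 4 / (δ * c) * ρ ^ n := by positivity
    refine h1.trans ?_
    rw [← hg] at h2
    gcongr
    rw [add_mul]
    linarith
  · set y := shiftMap^[n] x with hy
    have hw := P1.smul_ne_zero' g hv
    have hws : P1.pt (g • v) = s y := by
      rw [← P1.smul_pt g hv, hvpt, hs.iterate]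
    have d2 := dist_klein_le_of_tendsto hA' hc hρ (growth_inv hG _)
      (hu.tendsto (reverseShift y)) n
    rw [forwardProd_inv_reverseShift, hy, backwardProd_iterate_shiftMap, ← hy, ← hg] at d2
    have e2 := vsq_smul_eq g⁻¹ hw
    rw [inv_smul_smul, nsq_inv, ← P1.dir_pt hw, hws] at e2
    have k0 := hfδ y
    have k1 := hn₀ n hn
    rw [Prod.dist_eq, Real.dist_eq, Real.dist_eq] at d2
    have k3 := (le_max_left _ _).trans d2
    have k4 := (le_max_right _ _).trans d2
    have k5 := P1.dir_sq (s y)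
    have habs1 : |(P1.dir (s y)).1| ≤ 1 := by
      apply abs_le_of_sq_le_sq _ zero_le_one
      nlinarith [sq_nonneg (P1.dir (s y)).2]
    have habs2 : |(P1.dir (s y)).2| ≤ 1 := by
      apply abs_le_of_sq_le_sq _ zero_le_one
      nlinarith [sq_nonneg (P1.dir (s y)).1]
    have m1 := mul_le_mul k3 habs1 (abs_nonneg _) ((abs_nonneg _).trans k3)
    have m2 := mul_le_mul k4 habs2 (abs_nonneg _) ((abs_nonneg _).trans k4)
    rw [← abs_mul] at m1 m2
    have m1' := le_of_abs_le m1
    have m2' := le_of_abs_le m2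
    have hlow : δ / 4 ≤ (1 - ((klein g⁻¹).1 * (P1.dir (s y)).1 +
        (klein g⁻¹).2 * (P1.dir (s y)).2)) / 2 := by
      simp only [hf] at k0
      rw [← hC] at m1' m2'
      nlinarith
    have hN := hG x n
    rw [← hg] at hN
    have hNpos := nsq_pos g
    have hw' := vsq_pos hw
    have f1 : vsq (g • v) * (nsq g * (δ / 4)) ≤ vsq v := by
      calc _ ≤ _ := by
            rw [← mul_assoc]
            gcongr
        _ = vsq v := e2.symm
    have f2 : vsq (g • v) ≤ 4 / (δ * c) * ρ ^ n * vsq v := by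
      rw [div_mul_eq_mul_div, div_mul_eq_mul_div, le_div_iff₀ (by positivity)]
      calc vsq (g • v) * (δ * c) ≤ vsq (g • v) * (δ * (nsq g * ρ ^ n)) := by gcongr
        _ = 4 * ρ ^ n * (vsq (g • v) * (nsq g * (δ / 4))) := by ring
        _ ≤ 4 * ρ ^ n * vsq v := by gcongr
    have f3 : 0 < 2 * L ^ n₀ / ρ ^ n₀ * ρ ^ n * vsq v := by positivity
    calc _ ≤ _ := f2
      _ ≤ _ := by rw [add_mul, add_mul]; linarith

theorem norm_le_of_vsq_le {v w : Fin 2 → ℝ} {C ρ : ℝ} (hC : 0 ≤ C) (hρ : 0 ≤ ρ) {n : ℕ}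
    (h : vsq w ≤ C * ρ ^ n * vsq v) : ‖w‖ ≤ Real.sqrt (2 * C) * Real.sqrt ρ ^ n * ‖v‖ := by
  refine le_of_sq_le_sq ?_ (by positivity)
  rw [mul_pow, mul_pow, Real.sq_sqrt (by positivity), ← pow_mul, mul_comm n 2, pow_mul,
    Real.sq_sqrt hρ]
  have h1 := sq_norm_le_vsq w
  have h2 := vsq_le_sq_norm v
  calc ‖w‖ ^ 2 ≤ C * ρ ^ n * vsq v := h1.trans h
    _ ≤ C * ρ ^ n * (2 * ‖v‖ ^ 2) := by gcongr
    _ = _ := by ring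

/-- Uniform exponential growth of all products implies uniform hyperbolicity. -/
theorem isUniformlyHyperbolic_of_growth {A : Fin N → SL2R} {c ρ : ℝ} (hc : 0 < c) (hρ0 : 0 < ρ)
    (hρ : ρ < 1) (hG : ∀ x n, c ≤ nsq (forwardProd A x n) * ρ ^ n) :
    IsUniformlyHyperbolic A := by
  obtain ⟨s, hs⟩ := exists_isStableField hc hρ0 hρ hG
  obtain ⟨u, hu⟩ := exists_isStableField hc hρ0 hρ (growth_inv hG)
  have hne := stable_ne_unstable hs hu hc hρ0 hρ hG
  have hs' : IsStableField (fun i => ((A i)⁻¹)⁻¹) s := by simpa using hs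
  have hne' : ∀ x, u x ≠ s (reverseShift x) := fun x h =>
    hne (reverseShift x) (by rw [reverseShift_reverseShift]; exact h.symm)
  obtain ⟨C₁, hC₁, h₁⟩ := stable_contraction hs hu hc hρ0 hρ hG hne
  obtain ⟨C₂, hC₂, h₂⟩ := stable_contraction hu hs' hc hρ0 hρ (growth_inv hG) hne'
  refine ⟨s, fun x => u (reverseShift x), hs.continuous,
    hu.continuous.comp continuous_reverseShift, hne, hs.equivariant, hu.reverse,
    Real.sqrt (2 * (C₁ + C₂)), by positivity, Real.sqrt ρ, by positivity, ?_, fun x n => ⟨?_, ?_⟩⟩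
  · rw [Real.sqrt_lt' one_pos]
    simpa using hρ
  · intro v hv
    apply norm_le_of_vsq_le (by positivity) hρ0.le
    refine (h₁ x n v hv).trans ?_
    have := vsq_nonneg v
    gcongr
    linarith
  · intro v hv
    apply norm_le_of_vsq_le (by positivity) hρ0.le
    have h3 := h₂ (reverseShift x) n v hv
    rw [forwardProd_inv_reverseShift] at h3
    refine h3.trans ?_
    have := vsq_nonneg v
    gcongr
    linarith

end Cocycle

/-! ### Uniform hyperbolicity bounds the traces of words from below -/

section Words

variable {N : ℕ}

theorem forwardProd_congr (A : Fin N → SL2R) {x y : FullShift N} {n : ℕ}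
    (h : ∀ i : ℕ, i < n → x i = y i) : forwardProd A x n = forwardProd A y n := by
  induction n with
  | zero => rfl
  | succ n ih =>
    rw [forwardProd, forwardProd, ih fun i hi => h i (by omega), h n (by omega)]

theorem forwardProd_add (A : Fin N → SL2R) (x : FullShift N) (m n : ℕ) :
    forwardProd A x (m + n) = forwardProd A (fun i => x (i + m)) n * forwardProd A x m := by
  induction n with
  | zero => simp [forwardProd]
  | succ n ih =>
    rw [← add_assoc, forwardProd, ih, forwardProd, mul_assoc]
    congr 3
    push_cast
    ring

theorem exists_forwardProd_of_mem_closure {A B g : SL2R}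
    (hg : g ∈ Subsemigroup.closure {A, B}) :
    ∃ n : ℕ, 0 < n ∧ ∃ x : FullShift 2, forwardProd ![A, B] x n = g := by
  induction hg using Subsemigroup.closure_induction with
  | mem g hg =>
    rcases hg with rfl | rfl
    · exact ⟨1, one_pos, fun _ => 0, by simp [forwardProd]⟩
    · exact ⟨1, one_pos, fun _ => 1, by simp [forwardProd]⟩
  | mul g h _ _ ihg ihh =>
    obtain ⟨n, hn, x, rfl⟩ := ihg
    obtain ⟨m, hm, y, rfl⟩ := ihh
    refine ⟨m + n, by omega, fun i => if i < m then y i else x (i - m), ?_⟩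
    rw [forwardProd_add]
    congr 1
    · apply forwardProd_congr
      intro i _
      simp
    · apply forwardProd_congr
      intro i hi
      simp [hi]

theorem forwardProd_smul_of_equivariant {A : Fin N → SL2R} {s : FullShift N → P1}
    (hs : ∀ x, A (x 0) • s x = s (shiftMap x)) (x : FullShift N) (n : ℕ) :
    forwardProd A x n • s x = s (shiftMap^[n] x) := by
  induction n generalizing x with
  | zero => simp [forwardProd]
  | succ n ih =>
    rw [forwardProd_succ', mul_smul, hs, ih, Function.iterate_succ_apply]

theorem forwardProd_mul_of_periodic {A : Fin N → SL2R} {x : FullShift N} {n : ℕ}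
    (hx : ∀ i, x (i + n) = x i) (k : ℕ) : forwardProd A x (k * n) = forwardProd A x n ^ k := by
  induction k with
  | zero => simp [forwardProd]
  | succ k ih =>
    have : (k + 1) * n = n + k * n := by ring
    rw [this, forwardProd_add, pow_succ]
    have hx' : (fun i => x (i + n)) = x := funext hx
    rw [hx', ih]

theorem eigenvalue_equation {g : SL2R} {v : Fin 2 → ℝ} (hv : v ≠ 0) {μ : ℝ}
    (h : g • v = μ • v) : μ ^ 2 - tr g * μ + 1 = 0 := by
  have h0 := congrFun h 0
  have h1 := congrFun h 1
  simp only [smul_entry, Pi.smul_apply, smul_eq_mul] at h0 h1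
  have hd := det_entries g
  have e0 : (μ ^ 2 - tr g * μ + 1) * v 0 = 0 := by
    unfold tr
    linear_combination (g 1 1 - μ) * h0 - (g 0 1) * h1 - v 0 * hd
  have e1 : (μ ^ 2 - tr g * μ + 1) * v 1 = 0 := by
    unfold tr
    linear_combination (g 0 0 - μ) * h1 - (g 1 0) * h0 - v 1 * hd
  by_contra hne
  exact hv (plane_ext ((mul_eq_zero.mp e0).resolve_left hne)
    ((mul_eq_zero.mp e1).resolve_left hne))

theorem exists_eigenvalue_of_smul_pt {g : SL2R} {v : Fin 2 → ℝ} (hv : v ≠ 0)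
    (h : g • P1.pt v = P1.pt v) : ∃ μ : ℝ, g • v = μ • v := by
  rw [P1.smul_pt g hv, P1.pt_eq_mk hv, P1.pt_eq_mk (P1.smul_ne_zero' g hv),
    Projectivization.mk_eq_mk_iff'] at h
  obtain ⟨a, ha⟩ := h
  exact ⟨a, ha.symm⟩

theorem pow_smul_of_eigenvector {g : SL2R} {v : Fin 2 → ℝ} {μ : ℝ} (h : g • v = μ • v) (k : ℕ) :
    g ^ k • v = μ ^ k • v := by
  induction k with
  | zero => simp
  | succ k ih => rw [pow_succ, mul_smul, h, smul_comm, ih, smul_smul, ← pow_succ']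

theorem le_of_forall_pow_le_mul_pow {a r C : ℝ} (hr : 0 < r)
    (h : ∀ k : ℕ, a ^ k ≤ C * r ^ k) : a ≤ r := by
  by_contra hlt
  push Not at hlt
  have h1 : 1 < a / r := by rwa [one_lt_div hr]
  obtain ⟨k, hk⟩ := pow_unbounded_of_one_lt C h1
  have h2 := h k
  rw [div_pow, lt_div_iff₀ (by positivity)] at hk
  linarith

/-- On the periodic point that repeats a given word, the stable line is an eigenline of the word
with eigenvalue `μ`, `|μ| ≤ r`. Hence `|tr| = |μ| + |μ|⁻¹ ≥ r + r⁻¹ = 2 + (1 - r)² / r`,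
independently of the word. -/
theorem exists_trace_bound {A B : SL2R} (h : IsUniformlyHyperbolic ![A, B]) :
    ∃ η : ℝ, 0 < η ∧ ∀ g ∈ Subsemigroup.closure {A, B}, 2 + η ≤ |tr g| := by
  obtain ⟨Es, _, -, -, -, hEs, -, C, hC, r, hr0, hr1, hcon⟩ := h
  refine ⟨(1 - r) ^ 2 / r, div_pos (pow_pos (by linarith) 2) hr0, fun g hg => ?_⟩
  obtain ⟨n, hn, x, rfl⟩ := exists_forwardProd_of_mem_closure hg
  set y : FullShift 2 := fun i => x (i % n) with hy
  have hyx : forwardProd ![A, B] y n = forwardProd ![A, B] x n := by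
    apply forwardProd_congr
    intro i hi
    simp only [hy]
    rw [Int.emod_eq_of_lt (by positivity) (by exact_mod_cast hi)]
  have hper : ∀ i, y (i + n) = y i := fun i => by simp [hy]
  have hfix : forwardProd ![A, B] y n • Es y = Es y := by
    rw [forwardProd_smul_of_equivariant hEs]
    congr 1
    ext i
    rw [iterate_shiftMap_apply, hper]
  rw [← hyx]
  set g := forwardProd ![A, B] y n
  obtain ⟨v, hv, hvs⟩ := P1.exists_pt (Es y)
  rw [← hvs] at hfix
  obtain ⟨μ, hμ⟩ := exists_eigenvalue_of_smul_pt hv hfix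
  have hvmem : v ∈ (Es y).submodule := by
    rw [← hvs, P1.pt_eq_mk hv, Projectivization.submodule_mk]
    exact Submodule.mem_span_singleton_self v
  have hvn : 0 < ‖v‖ := norm_pos_iff.mpr hv
  -- Applying the contraction estimate to all powers of the word removes the constant `C`.
  have hle : |μ| ≤ r ^ n := by
    refine le_of_forall_pow_le_mul_pow (C := C) (by positivity) fun k => ?_
    have h1 := (hcon y (k * n)).1 v hvmem
    rw [forwardProd_mul_of_periodic hper, pow_smul_of_eigenvector hμ, norm_smul, norm_pow,
      Real.norm_eq_abs] at h1
    have h2 := le_of_mul_le_mul_right h1 hvn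
    rwa [mul_comm k n, pow_mul] at h2
  have hle' : |μ| ≤ r := hle.trans (pow_le_of_le_one hr0.le hr1.le hn.ne')
  have heq := eigenvalue_equation hv hμ
  have habs : |tr g| * |μ| = |μ| ^ 2 + 1 := by
    rw [← abs_mul, sq_abs]
    have : tr g * μ = μ ^ 2 + 1 := by linarith
    rw [this, abs_of_pos (by positivity)]
  have hμ0 : 0 < |μ| := by
    rcases (abs_nonneg μ).lt_or_eq with h0 | h0
    · exact h0
    · rw [← h0] at habs
      norm_num at habs
  have e1 : 2 + (1 - r) ^ 2 / r = (r ^ 2 + 1) / r := by field_simp; ring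
  have e2 : |tr g| = (|μ| ^ 2 + 1) / |μ| := by rw [eq_div_iff hμ0.ne']; exact habs
  rw [e1, e2, div_le_div_iff₀ hr0 hμ0]
  nlinarith [mul_nonneg (sub_nonneg.mpr hle') (show 0 ≤ 1 - r * |μ| by nlinarith)]

end Words

/-! ### Traces of pairs and the action of the monoid generated by `Fplus` and `Fminus` -/

/-- Pairs with hyperbolic `A`, `B`, `AB` whose traces have negative product. -/
def freeSet : Set (SL2R × SL2R) :=
  {p | 2 < |tr p.1| ∧ 2 < |tr p.2| ∧ 2 < |tr (p.1 * p.2)| ∧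
    tr p.1 * tr p.2 * tr (p.1 * p.2) < 0}

/-- Two plus the trace of the commutator of a pair. -/
def fricke (p : SL2R × SL2R) : ℝ :=
  tr p.1 ^ 2 + tr p.2 ^ 2 + tr (p.1 * p.2) ^ 2 - tr p.1 * tr p.2 * tr (p.1 * p.2)

/-- Pairs of hyperbolic elements whose fixed points are arranged in the cyclic order
`u_A, s_A, u_B, s_B`, expressed by traces. -/
def twistedSet : Set (SL2R × SL2R) :=
  {p | 2 < |tr p.1| ∧ 2 < |tr p.2| ∧ 4 < fricke p ∧
    2 * (tr p.1 * tr p.2 * tr (p.1 * p.2)) < tr p.1 ^ 2 * tr p.2 ^ 2}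

/-- The degenerate version of `twistedSet`, where fixed points may coincide. -/
def weaklyTwistedSet : Set (SL2R × SL2R) :=
  {p | 2 < |tr p.1| ∧ 2 < |tr p.2| ∧ 4 ≤ fricke p ∧
    2 * (tr p.1 * tr p.2 * tr (p.1 * p.2)) ≤ tr p.1 ^ 2 * tr p.2 ^ 2}

/-- Cayley–Hamilton. On traces, `Fplus` is thus `(x, y, z) ↦ (x, z, xz - y)`, a move preserving the
polynomial `fricke`. -/
theorem tr_mul_mul_left (A B : SL2R) : tr (A * (A * B)) = tr A * tr (A * B) - tr B := by
  have := det_entries A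
  simp only [tr, mul_entry]
  linear_combination (-(B 0 0 + B 1 1)) * this

theorem tr_mul_mul_right (A B : SL2R) : tr (B * A * B) = tr (A * B) * tr B - tr A := by
  have := det_entries B
  simp only [tr, mul_entry]
  linear_combination (-(A 0 0 + A 1 1)) * this

theorem fricke_Fplus (p : SL2R × SL2R) : fricke (Fplus p) = fricke p := by
  simp only [fricke, Fplus, tr_mul_mul_left]; ring

theorem fricke_Fminus (p : SL2R × SL2R) : fricke (Fminus p) = fricke p := by
  simp only [fricke, Fminus, tr_mul_mul_right, tr_mul_comm p.2 p.1]; ring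

theorem freeSet_subset_twistedSet : freeSet ⊆ twistedSet := by
  rintro p ⟨hx, hy, hz, h⟩
  have hx' : 4 < tr p.1 ^ 2 := by rw [← sq_abs]; nlinarith
  have hy' : 4 < tr p.2 ^ 2 := by rw [← sq_abs]; nlinarith
  have hz' : 4 < tr (p.1 * p.2) ^ 2 := by rw [← sq_abs]; nlinarith
  refine ⟨hx, hy, ?_, ?_⟩
  · unfold fricke; linarith
  · have : 0 < tr p.1 ^ 2 * tr p.2 ^ 2 := by positivity
    linarith

theorem twistedSet_subset_weaklyTwistedSet : twistedSet ⊆ weaklyTwistedSet :=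
  fun _ ⟨hx, hy, h, h'⟩ => ⟨hx, hy, h.le, h'.le⟩

theorem abs_mul_mul_of_pos {x y z : ℝ} (h : 0 < x * y * z) : x * y * z = |x| * |y| * |z| := by
  rw [← abs_mul, ← abs_mul, abs_of_pos h]

/-- The hypothesis is the last twisted inequality for traces `(x, z, xz - y)`, the image of `(x, y,
z)` under a move. It amounts to `x² z² < 2 x y z`, so `y` is the larger root of the quadratic that
the move exchanges with `xz - y`. -/
theorem twisted_step {x y z : ℝ} (hx : 2 < |x|) (hz : 2 < |z|)
    (h : 2 * (x * z * (x * z - y)) < x ^ 2 * z ^ 2) :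
    0 < x * y * z ∧ |x| * |z| < 2 * |y| ∧ 2 < |y| ∧ 2 * (x * y * z) < x ^ 2 * y ^ 2 := by
  have h0 : 0 < x * y * z := by nlinarith [sq_nonneg (x * z)]
  have h1 := abs_mul_mul_of_pos h0
  have hlt : |x| * |z| < 2 * |y| := by
    by_contra hge
    push Not at hge
    have : (|x| * |z|) * (2 * |y|) ≤ (|x| * |z|) * (|x| * |z|) := by gcongr
    have e : (|x| * |z|) * (|x| * |z|) = x ^ 2 * z ^ 2 := by
      rw [← sq_abs x, ← sq_abs z]; ring
    nlinarith
  have hzy : |z| < |y| := by nlinarith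
  refine ⟨h0, hlt, by linarith, ?_⟩
  rw [h1, ← sq_abs x, ← sq_abs y]
  have : 2 * |z| < |x| * |y| := by nlinarith
  have hxy : 0 < |x| * |y| := mul_pos (by linarith) (by linarith)
  nlinarith

theorem of_Fplus_mem_twistedSet {p : SL2R × SL2R} (h : Fplus p ∈ twistedSet) :
    p ∈ twistedSet ∧ 0 < tr p.1 * tr p.2 * tr (p.1 * p.2) ∧
      |tr p.1| * |tr (p.1 * p.2)| < 2 * |tr p.2| := by
  obtain ⟨h1, h2, h3, h4⟩ := h
  rw [fricke_Fplus] at h3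
  simp only [Fplus, tr_mul_mul_left] at h1 h2 h4
  obtain ⟨k1, k2, k3, k4⟩ := twisted_step h1 h2 h4
  exact ⟨⟨h1, k3, h3, k4⟩, k1, k2⟩

theorem of_Fminus_mem_twistedSet {p : SL2R × SL2R} (h : Fminus p ∈ twistedSet) :
    p ∈ twistedSet ∧ 0 < tr p.1 * tr p.2 * tr (p.1 * p.2) ∧
      |tr p.2| * |tr (p.1 * p.2)| < 2 * |tr p.1| := by
  obtain ⟨h1, h2, h3, h4⟩ := h
  rw [fricke_Fminus] at h3
  simp only [Fminus, tr_mul_mul_right, tr_mul_comm p.2 p.1] at h1 h2 h4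
  obtain ⟨k1, k2, k3, k4⟩ := twisted_step (y := tr p.1) h2 h1 (by linarith)
  exact ⟨⟨k3, h2, h3, by linarith⟩, by linarith, k2⟩

/-- The element of the monoid given by a word: `true` stands for `Fplus`, `false` for `Fminus`,
and the first letter is applied first. -/
def wordMap : List Bool → Function.End (SL2R × SL2R)
  | [] => 1
  | b :: l => wordMap l * (if b then Fplus else Fminus)

theorem wordMap_append (l l' : List Bool) : wordMap (l ++ l') = wordMap l' * wordMap l := by
  induction l with
  | nil => simp [wordMap]
  | cons b l ih => rw [List.cons_append, wordMap, ih, wordMap, mul_assoc]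

theorem wordMap_mem (l : List Bool) : wordMap l ∈ monoidFpm := by
  induction l with
  | nil => exact one_mem _
  | cons b l ih =>
    refine mul_mem ih (Submonoid.subset_closure ?_)
    cases b <;> simp

theorem exists_wordMap {F : Function.End (SL2R × SL2R)} (hF : F ∈ monoidFpm) :
    ∃ l, wordMap l = F := by
  induction hF using Submonoid.closure_induction with
  | mem F hF =>
    rcases hF with rfl | rfl
    · exact ⟨[true], by simp [wordMap]⟩
    · exact ⟨[false], by simp [wordMap]⟩
  | one => exact ⟨[], rfl⟩
  | mul F G _ _ hF hG =>
    obtain ⟨l, rfl⟩ := hF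
    obtain ⟨l', rfl⟩ := hG
    exact ⟨l' ++ l, wordMap_append _ _⟩

theorem mem_twistedSet_of_wordMap {l : List Bool} {p : SL2R × SL2R} (h : wordMap l p ∈ freeSet) :
    p ∈ twistedSet := by
  induction l generalizing p with
  | nil => exact freeSet_subset_twistedSet h
  | cons b l ih =>
    cases b
    · exact (of_Fminus_mem_twistedSet (ih (p := Fminus p) h)).1
    · exact (of_Fplus_mem_twistedSet (ih (p := Fplus p) h)).1

theorem pos_of_wordMap_cons {b : Bool} {l : List Bool} {p : SL2R × SL2R}
    (h : wordMap (b :: l) p ∈ freeSet) : 0 < tr p.1 * tr p.2 * tr (p.1 * p.2) := by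
  cases b
  · exact (of_Fminus_mem_twistedSet (mem_twistedSet_of_wordMap (p := Fminus p) (l := l) h)).2.1
  · exact (of_Fplus_mem_twistedSet (mem_twistedSet_of_wordMap (p := Fplus p) (l := l) h)).2.1

/-- The two conclusions would be `|x| |z| < 2 |y|` and `|y| |z| < 2 |x|`; with `|z| > 2` they give
`|x| < |y| < |x|`. -/
theorem not_both_twisted {p : SL2R × SL2R} (h : Fplus p ∈ twistedSet) :
    Fminus p ∉ twistedSet := by
  intro h'
  obtain ⟨_, _, h1⟩ := of_Fplus_mem_twistedSet h
  obtain ⟨_, _, h2⟩ := of_Fminus_mem_twistedSet h'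
  have hx := h.1
  have hz := h.2.1
  have hy := h'.2.1
  simp only [Fplus, Fminus] at hx hy hz
  nlinarith

/-- The sets `F⁻¹(freeSet)` are pairwise disjoint. -/
theorem word_unique {l l' : List Bool} {p : SL2R × SL2R} (h : wordMap l p ∈ freeSet)
    (h' : wordMap l' p ∈ freeSet) : l = l' := by
  induction l generalizing l' p with
  | nil =>
    cases l' with
    | nil => rfl
    | cons b l' =>
      -- The sign of the product of the traces distinguishes the empty word from nonempty ones.
      have h1 := pos_of_wordMap_cons h'
      have h2 : tr p.1 * tr p.2 * tr (p.1 * p.2) < 0 := h.2.2.2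
      linarith
  | cons b l ih =>
    cases l' with
    | nil =>
      have h1 := pos_of_wordMap_cons h
      have h2 : tr p.1 * tr p.2 * tr (p.1 * p.2) < 0 := h'.2.2.2
      linarith
    | cons b' l' =>
      cases b <;> cases b'
      · rw [ih (p := Fminus p) h h']
      · exact absurd (mem_twistedSet_of_wordMap (p := Fminus p) (l := l) h)
          (not_both_twisted (mem_twistedSet_of_wordMap (p := Fplus p) (l := l') h'))
      · exact absurd (mem_twistedSet_of_wordMap (p := Fminus p) (l := l') h')
          (not_both_twisted (mem_twistedSet_of_wordMap (p := Fplus p) (l := l) h))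
      · rw [ih (p := Fplus p) h h']

/-- If both alternatives failed, each of `x`, `y`, `z` would be less than half the product of the
other two. A triple above 2 with this property, seen from its largest member, violates the lower
bound for the cubic. -/
theorem descent_of_le {x y z : ℝ} (hx : 2 < x) (hy : 2 < y) (hz : 2 < z)
    (hle : 2 * z ≤ x * y) (hk : 4 ≤ x ^ 2 + y ^ 2 + z ^ 2 - x * y * z) :
    y * z ≤ 2 * x ∨ x * z ≤ 2 * y := by
  by_contra hcon
  push Not at hcon
  obtain ⟨h1, h2⟩ := hcon
  -- Completing the square gives `(b² - 4)(c² - 4) ≤ (bc - 2a)²`. As `a ≥ b, c`, the right side is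
  -- at most `b² (c - 2)²` and `c² (b - 2)²`. This yields `b² ≤ c + 2` and `c² ≤ b + 2`, impossible
  -- for `b, c > 2`.
  have key : ∀ a b c : ℝ, 2 < b → 2 < c → b ≤ a → c ≤ a → 2 * a < b * c →
      4 ≤ a ^ 2 + b ^ 2 + c ^ 2 - a * b * c → False := by
    intro a b c hb hc hba hca h hk
    have hk' : (b ^ 2 - 4) * (c ^ 2 - 4) ≤ (b * c - 2 * a) ^ 2 := by nlinarith
    have hb' : (b * c - 2 * a) ^ 2 ≤ (b * (c - 2)) ^ 2 :=
      pow_le_pow_left₀ (by linarith) (by nlinarith) 2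
    have hc' : (b * c - 2 * a) ^ 2 ≤ (c * (b - 2)) ^ 2 :=
      pow_le_pow_left₀ (by linarith) (by nlinarith) 2
    have e1 : (b ^ 2 - 4) * (c + 2) ≤ b ^ 2 * (c - 2) := by
      have : (c - 2) * ((b ^ 2 - 4) * (c + 2)) ≤ (c - 2) * (b ^ 2 * (c - 2)) := by nlinarith
      exact le_of_mul_le_mul_left this (by linarith)
    have e2 : (c ^ 2 - 4) * (b + 2) ≤ c ^ 2 * (b - 2) := by
      have : (b - 2) * ((c ^ 2 - 4) * (b + 2)) ≤ (b - 2) * (c ^ 2 * (b - 2)) := by nlinarith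
      exact le_of_mul_le_mul_left this (by linarith)
    nlinarith
  -- At equality the cubic minus 4 is `-(x² - 4)(y² - 4) / 4`, which is negative.
  have h3 : 2 * z < x * y := by
    rcases hle.lt_or_eq with h | h
    · exact h
    · have hx' : 0 < x ^ 2 - 4 := by nlinarith
      have hy' : 0 < y ^ 2 - 4 := by nlinarith
      have := mul_pos hx' hy'
      nlinarith
  rcases le_total x y with hxy | hxy
  · rcases le_total y z with hyz | hyz
    · exact key z x y hx hy (by linarith) hyz h3 (by linarith)
    · exact key y x z hx hz hxy hyz h2 (by linarith)
  · rcases le_total x z with hxz | hxz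
    · exact key z x y hx hy hxz (by linarith) h3 (by linarith)
    · exact key x y z hy hz hxy hxz h1 hk

theorem fricke_eq_abs {p : SL2R × SL2R} (h0 : 0 < tr p.1 * tr p.2 * tr (p.1 * p.2)) :
    fricke p = |tr p.1| ^ 2 + |tr p.2| ^ 2 + |tr (p.1 * p.2)| ^ 2 -
      |tr p.1| * |tr p.2| * |tr (p.1 * p.2)| := by
  rw [← abs_mul_mul_of_pos h0, sq_abs, sq_abs, sq_abs, fricke]

theorem weaklyTwisted_descent {p : SL2R × SL2R} (h : p ∈ weaklyTwistedSet)
    (hz : 2 < |tr (p.1 * p.2)|) (h0 : 0 < tr p.1 * tr p.2 * tr (p.1 * p.2)) :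
    (Fminus p ∈ weaklyTwistedSet ∧ |tr p.2| * |tr (p.1 * p.2)| ≤ 2 * |tr p.1|) ∨
      (Fplus p ∈ weaklyTwistedSet ∧ |tr p.1| * |tr (p.1 * p.2)| ≤ 2 * |tr p.2|) := by
  obtain ⟨hx, hy, hk, hle⟩ := h
  have hk' := hk
  rw [fricke_eq_abs h0] at hk'
  have h1 := abs_mul_mul_of_pos h0
  have hle' : 2 * |tr (p.1 * p.2)| ≤ |tr p.1| * |tr p.2| := by
    rw [h1, ← sq_abs (tr p.1), ← sq_abs (tr p.2)] at hle
    have hpos : 0 < |tr p.1| * |tr p.2| := by positivity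
    refine le_of_mul_le_mul_left ?_ hpos
    linarith
  rcases descent_of_le hx hy hz hle' hk' with h2 | h2
  · left
    refine ⟨⟨?_, hy, ?_, ?_⟩, h2⟩
    · simpa only [Fminus, tr_mul_comm p.2 p.1] using hz
    · rwa [fricke_Fminus]
    · simp only [Fminus, tr_mul_mul_right, tr_mul_comm p.2 p.1]
      have h3 : (|tr p.2| * |tr (p.1 * p.2)|) * (|tr p.2| * |tr (p.1 * p.2)|) ≤
          (|tr p.2| * |tr (p.1 * p.2)|) * (2 * |tr p.1|) := by gcongr
      have e : (|tr p.2| * |tr (p.1 * p.2)|) * (|tr p.2| * |tr (p.1 * p.2)|) =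
          tr p.2 ^ 2 * tr (p.1 * p.2) ^ 2 := by
        rw [← sq_abs (tr p.2), ← sq_abs (tr (p.1 * p.2))]; ring
      linarith
  · right
    refine ⟨⟨hx, hz, ?_, ?_⟩, h2⟩
    · rwa [fricke_Fplus]
    · simp only [Fplus, tr_mul_mul_left]
      have h3 : (|tr p.1| * |tr (p.1 * p.2)|) * (|tr p.1| * |tr (p.1 * p.2)|) ≤
          (|tr p.1| * |tr (p.1 * p.2)|) * (2 * |tr p.2|) := by gcongr
      have e : (|tr p.1| * |tr (p.1 * p.2)|) * (|tr p.1| * |tr (p.1 * p.2)|) =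
          tr p.1 ^ 2 * tr (p.1 * p.2) ^ 2 := by
        rw [← sq_abs (tr p.1), ← sq_abs (tr (p.1 * p.2))]; ring
      linarith

/-- A weakly twisted pair whose words have traces bounded away from `[-2, 2]` is sent to
`freeSet` by an element of the monoid. -/
theorem exists_wordMap_mem_freeSet {η : ℝ} (hη : 0 < η) {p : SL2R × SL2R}
    (hp : p ∈ weaklyTwistedSet) (htr : ∀ g ∈ Subsemigroup.closure {p.1, p.2}, 2 + η ≤ |tr g|) :
    ∃ l, wordMap l p ∈ freeSet := by
  -- Every descent step replaces one of `tr A`, `tr B` by `tr AB`, smaller in absolute value by the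
  -- factor `1 + η / 2`. Since `|tr A| |tr B|` always exceeds 4, only finitely many steps are
  -- possible.
  have main : ∀ (k : ℕ) (p : SL2R × SL2R), p ∈ weaklyTwistedSet →
      (∀ g ∈ Subsemigroup.closure {p.1, p.2}, 2 + η ≤ |tr g|) →
      |tr p.1| * |tr p.2| ≤ 4 * (1 + η / 2) ^ k → ∃ l, wordMap l p ∈ freeSet := by
    intro k
    induction k with
    | zero =>
      intro p hp _ hle
      have h1 := hp.1
      have h2 := hp.2.1
      simp only [pow_zero, mul_one] at hle
      nlinarith
    | succ k ih =>
      intro p hp htr hle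
      have m1 : p.1 ∈ Subsemigroup.closure {p.1, p.2} := Subsemigroup.subset_closure (by simp)
      have m2 : p.2 ∈ Subsemigroup.closure {p.1, p.2} := Subsemigroup.subset_closure (by simp)
      have hx := htr _ m1
      have hy := htr _ m2
      have hz := htr _ (mul_mem m1 m2)
      rcases lt_trichotomy (tr p.1 * tr p.2 * tr (p.1 * p.2)) 0 with h0 | h0 | h0
      · exact ⟨[], show p ∈ freeSet from ⟨hp.1, hp.2.1, by linarith, h0⟩⟩
      · have h1 : |tr p.1 * tr p.2 * tr (p.1 * p.2)| = 0 := by rw [h0, abs_zero]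
        rw [abs_mul, abs_mul] at h1
        have : 0 < |tr p.1| * |tr p.2| * |tr (p.1 * p.2)| := by
          have := hp.1
          have := hp.2.1
          have : 0 < |tr (p.1 * p.2)| := by linarith
          positivity
        linarith
      · rw [pow_succ] at hle
        rcases weaklyTwisted_descent hp (by linarith) h0 with ⟨h1, h2⟩ | ⟨h1, h2⟩
        · have hcl : ∀ g ∈ Subsemigroup.closure {(Fminus p).1, (Fminus p).2}, 2 + η ≤ |tr g| := by
            intro g hg
            refine htr g (Subsemigroup.closure_le.mpr ?_ hg)
            rintro g (rfl | rfl)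
            · exact mul_mem m2 m1
            · exact m2
          have hprod : |tr (Fminus p).1| * |tr (Fminus p).2| ≤ 4 * (1 + η / 2) ^ k := by
            simp only [Fminus, tr_mul_comm p.2 p.1]
            have h3 : |tr (p.1 * p.2)| * (1 + η / 2) ≤ |tr p.1| := by
              nlinarith [abs_nonneg (tr (p.1 * p.2))]
            refine le_of_mul_le_mul_right ?_ (show 0 < 1 + η / 2 by linarith)
            nlinarith [abs_nonneg (tr p.2)]
          obtain ⟨l, hl⟩ := ih (Fminus p) h1 hcl hprod
          exact ⟨false :: l, hl⟩
        · have hcl : ∀ g ∈ Subsemigroup.closure {(Fplus p).1, (Fplus p).2}, 2 + η ≤ |tr g| := by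
            intro g hg
            refine htr g (Subsemigroup.closure_le.mpr ?_ hg)
            rintro g (rfl | rfl)
            · exact m1
            · exact mul_mem m1 m2
          have hprod : |tr (Fplus p).1| * |tr (Fplus p).2| ≤ 4 * (1 + η / 2) ^ k := by
            simp only [Fplus]
            have h3 : |tr (p.1 * p.2)| * (1 + η / 2) ≤ |tr p.2| := by
              nlinarith [abs_nonneg (tr (p.1 * p.2))]
            refine le_of_mul_le_mul_right ?_ (show 0 < 1 + η / 2 by linarith)
            nlinarith [abs_nonneg (tr p.1)]
          obtain ⟨l, hl⟩ := ih (Fplus p) h1 hcl hprod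
          exact ⟨true :: l, hl⟩
  obtain ⟨k, hk⟩ := pow_unbounded_of_one_lt (|tr p.1| * |tr p.2|) (show 1 < 1 + η / 2 by linarith)
  exact main k p hp htr (by have : 0 < (1 + η / 2) ^ k := by positivity
                            linarith)

/-! ### Normal forms of pairs of hyperbolic elements -/

/-- The area of the parallelogram spanned by two plane vectors. -/
def area (u v : Fin 2 → ℝ) : ℝ := u 0 * v 1 - u 1 * v 0

/-- The element of `SL(2,ℝ)` whose columns are proportional to two given vectors. -/
noncomputable def basisMat (u v : Fin 2 → ℝ) (h : 0 < area u v) : SL2R :=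
  SL2R.mk (u 0 / √(area u v)) (v 0 / √(area u v)) (u 1 / √(area u v)) (v 1 / √(area u v)) (by
    have h1 : √(area u v) ≠ 0 := (Real.sqrt_pos.mpr h).ne'
    have h2 : √(area u v) ^ 2 = area u v := Real.sq_sqrt h.le
    field_simp
    rw [h2, area]
    ring)

section Conj

variable {u v : Fin 2 → ℝ} (h : 0 < area u v) (A : SL2R)

theorem conj_entry (g : SL2R) : (g⁻¹ * A * g) 0 0 =
      g 1 1 * (A 0 0 * g 0 0 + A 0 1 * g 1 0) - g 0 1 * (A 1 0 * g 0 0 + A 1 1 * g 1 0) ∧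
    (g⁻¹ * A * g) 0 1 =
      g 1 1 * (A 0 0 * g 0 1 + A 0 1 * g 1 1) - g 0 1 * (A 1 0 * g 0 1 + A 1 1 * g 1 1) ∧
    (g⁻¹ * A * g) 1 0 =
      g 0 0 * (A 1 0 * g 0 0 + A 1 1 * g 1 0) - g 1 0 * (A 0 0 * g 0 0 + A 0 1 * g 1 0) ∧
    (g⁻¹ * A * g) 1 1 =
      g 0 0 * (A 1 0 * g 0 1 + A 1 1 * g 1 1) - g 1 0 * (A 0 0 * g 0 1 + A 0 1 * g 1 1) := by
  simp only [mul_entry, inv_entry00, inv_entry01, inv_entry10, inv_entry11]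
  refine ⟨?_, ?_, ?_, ?_⟩ <;> ring

theorem conj_basisMat : ((basisMat u v h)⁻¹ * A * basisMat u v h) 0 0 =
      area (A • u) v / area u v ∧
    ((basisMat u v h)⁻¹ * A * basisMat u v h) 0 1 = area (A • v) v / area u v ∧
    ((basisMat u v h)⁻¹ * A * basisMat u v h) 1 0 = area u (A • u) / area u v ∧
    ((basisMat u v h)⁻¹ * A * basisMat u v h) 1 1 = area u (A • v) / area u v := by
  have h1 : √(area u v) ≠ 0 := (Real.sqrt_pos.mpr h).ne'
  have h2 : √(area u v) ^ 2 = area u v := Real.sq_sqrt h.le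
  obtain ⟨e1, e2, e3, e4⟩ := conj_entry A (basisMat u v h)
  rw [e1, e2, e3, e4]
  rw [← h2]
  simp only [basisMat, mk_00, mk_01, mk_10, mk_11]
  refine ⟨?_, ?_, ?_, ?_⟩
  · rw [show area (A • u) v = (A 0 0 * u 0 + A 0 1 * u 1) * v 1 -
      (A 1 0 * u 0 + A 1 1 * u 1) * v 0 by simp only [area, smul_entry]]
    field_simp
  · rw [show area (A • v) v = (A 0 0 * v 0 + A 0 1 * v 1) * v 1 -
      (A 1 0 * v 0 + A 1 1 * v 1) * v 0 by simp only [area, smul_entry]]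
    field_simp
  · rw [show area u (A • u) = u 0 * (A 1 0 * u 0 + A 1 1 * u 1) -
      u 1 * (A 0 0 * u 0 + A 0 1 * u 1) by simp only [area, smul_entry]]
    field_simp
  · rw [show area u (A • v) = u 0 * (A 1 0 * v 0 + A 1 1 * v 1) -
      u 1 * (A 0 0 * v 0 + A 0 1 * v 1) by simp only [area, smul_entry]]
    field_simp

end Conj

theorem tr_conj_inv (g A : SL2R) : tr (g⁻¹ * A * g) = tr A := by
  rw [tr_mul_comm, ← mul_assoc, mul_inv_cancel, one_mul]

theorem conj_inv_mul (g A B : SL2R) : (g⁻¹ * A * g) * (g⁻¹ * B * g) = g⁻¹ * (A * B) * g := by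
  group

theorem exists_expanding_eigenvector {A : SL2R} (hA : 2 < tr A) :
    ∃ μ : ℝ, 1 < μ ∧ ∃ u : Fin 2 → ℝ, u ≠ 0 ∧ A • u = μ • u := by
  set D := √(tr A ^ 2 - 4) with hD
  have hpos : 0 < tr A ^ 2 - 4 := by nlinarith
  have hD0 : 0 < D := Real.sqrt_pos.mpr hpos
  have hD2 : D ^ 2 = tr A ^ 2 - 4 := Real.sq_sqrt hpos.le
  set μ := (tr A + D) / 2 with hμ
  have hμ1 : 1 < μ := by rw [hμ]; linarith
  have hchar : μ ^ 2 - tr A * μ + 1 = 0 := by rw [hμ]; linear_combination hD2 / 4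
  have hdet := det_entries A
  have htr : tr A = A 0 0 + A 1 1 := rfl
  rw [htr] at hchar
  refine ⟨μ, hμ1, ?_⟩
  -- `![A 0 1, μ - A 0 0]` is an eigenvector unless it is zero; in that case the second row of `A -
  -- μ` supplies one.
  by_cases hz : A 0 1 = 0 ∧ μ - A 0 0 = 0
  · refine ⟨![μ - A 1 1, A 1 0], plane_ne_zero (Or.inl ?_), plane_ext ?_ ?_⟩
    · simp only [Matrix.cons_val_zero]
      intro h
      have h1 : μ ^ 2 = 1 := by
        rw [hz.1] at hdet
        have : A 0 0 = μ := by linarith [hz.2]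
        have : A 1 1 = μ := by linarith
        nlinarith
      nlinarith
    · simp only [smul_entry, Matrix.cons_val_zero, Matrix.cons_val_one, Pi.smul_apply, smul_eq_mul]
      linear_combination (-1 : ℝ) * hchar - hdet
    · simp only [smul_entry, Matrix.cons_val_zero, Matrix.cons_val_one, Pi.smul_apply, smul_eq_mul]
      ring
  · refine ⟨![A 0 1, μ - A 0 0], plane_ne_zero ?_, plane_ext ?_ ?_⟩
    · simp only [Matrix.cons_val_zero, Matrix.cons_val_one]
      by_contra hcon
      push Not at hcon
      exact hz hcon
    · simp only [smul_entry, Matrix.cons_val_zero, Matrix.cons_val_one, Pi.smul_apply, smul_eq_mul]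
      ring
    · simp only [smul_entry, Matrix.cons_val_zero, Matrix.cons_val_one, Pi.smul_apply, smul_eq_mul]
      linear_combination (-1 : ℝ) * hchar - hdet

/-- The set of matrices with positive entries. -/
def posMat : Set SL2R := {g | 0 < g 0 0 ∧ 0 < g 0 1 ∧ 0 < g 1 0 ∧ 0 < g 1 1}

/-- Pairs that are simultaneously conjugate to matrices with positive entries. -/
def posPairs : Set (SL2R × SL2R) :=
  {p | ∃ g : SL2R, g⁻¹ * p.1 * g ∈ posMat ∧ g⁻¹ * p.2 * g ∈ posMat}

theorem posPairs_of_conj {A B : SL2R} (g : SL2R) (h : (g⁻¹ * A * g, g⁻¹ * B * g) ∈ posPairs) :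
    (A, B) ∈ posPairs := by
  obtain ⟨k, h1, h2⟩ := h
  refine ⟨g * k, ?_, ?_⟩
  · simpa only [mul_inv_rev, mul_assoc] using h1
  · simpa only [mul_inv_rev, mul_assoc] using h2

theorem posPairs_swap {A B : SL2R} (h : (A, B) ∈ posPairs) : (B, A) ∈ posPairs := by
  obtain ⟨k, h1, h2⟩ := h
  exact ⟨k, h2, h1⟩

theorem eventually_pos_of_continuous {f : ℝ → ℝ} (hf : Continuous f) (h0 : 0 < f 0) :
    ∀ᶠ t in 𝓝[>] (0 : ℝ), 0 < f t :=
  (hf.continuousAt.eventually (lt_mem_nhds h0)).filter_mono nhdsWithin_le_nhds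

theorem posMat_conj_iff {u v : Fin 2 → ℝ} (h : 0 < area u v) {A : SL2R}
    (h1 : 0 < area (A • u) v) (h2 : 0 < area (A • v) v) (h3 : 0 < area u (A • u))
    (h4 : 0 < area u (A • v)) : (basisMat u v h)⁻¹ * A * basisMat u v h ∈ posMat := by
  obtain ⟨e1, e2, e3, e4⟩ := conj_basisMat h A
  refine ⟨?_, ?_, ?_, ?_⟩
  · rw [e1]; positivity
  · rw [e2]; positivity
  · rw [e3]; positivity
  · rw [e4]; positivity

/-- The expanding directions are the coordinate axes, and both matrices map the closed first
quadrant into itself. Widening the quadrant slightly, to the cone spanned by `(1, -t)` and `(-t,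
1)`, makes the inclusion strict, which is positivity in the new basis. -/
theorem posPairs_of_triangular {A B : SL2R} (hA : A 1 0 = 0) (hA0 : 1 < A 0 0) (hA1 : 0 < A 0 1)
    (hB : B 0 1 = 0) (hB0 : 1 < B 1 1) (hB1 : 0 < B 1 0) : (A, B) ∈ posPairs := by
  have dA := det_entries A
  have dB := det_entries B
  rw [hA] at dA
  rw [hB] at dB
  have a11 : 0 < A 1 1 := by nlinarith
  have b00 : 0 < B 0 0 := by nlinarith
  have a11' : A 1 1 < A 0 0 := by nlinarith
  have b00' : B 0 0 < B 1 1 := by nlinarith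
  have ev : ∀ {f : ℝ → ℝ}, Continuous f → 0 < f 0 → ∀ᶠ t in 𝓝[>] (0 : ℝ), 0 < f t :=
    fun hf h0 => eventually_pos_of_continuous hf h0
  have h1 := ev (f := fun t => 1 - t ^ 2) (by fun_prop) (by simp)
  have h2 := ev (f := fun t => A 0 0 - t * A 0 1 - t ^ 2 * A 1 1) (by fun_prop) (by simp; linarith)
  have h3 := ev (f := fun t => A 0 1 - t * A 0 0 + t * A 1 1) (by fun_prop) (by simpa using hA1)
  have h4 := ev (f := fun t => A 0 0 - A 1 1 - t * A 0 1) (by fun_prop) (by simp; linarith)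
  have h5 := ev (f := fun t => A 1 1 + t * A 0 1 - t ^ 2 * A 0 0) (by fun_prop) (by simpa using a11)
  have k2 := ev (f := fun t => B 1 1 - t * B 1 0 - t ^ 2 * B 0 0) (by fun_prop) (by simp; linarith)
  have k3 := ev (f := fun t => B 1 0 - t * B 1 1 + t * B 0 0) (by fun_prop) (by simpa using hB1)
  have k4 := ev (f := fun t => B 1 1 - B 0 0 - t * B 1 0) (by fun_prop) (by simp; linarith)
  have k5 := ev (f := fun t => B 0 0 + t * B 1 0 - t ^ 2 * B 1 1) (by fun_prop) (by simpa using b00)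
  have hpos : ∀ᶠ t in 𝓝[>] (0 : ℝ), 0 < t := eventually_mem_nhdsWithin
  obtain ⟨t, h1, h2, h3, h4, h5, k2, k3, k4, k5, ht⟩ := (h1.and <| h2.and <| h3.and <| h4.and <|
    h5.and <| k2.and <| k3.and <| k4.and <| k5.and hpos).exists
  have harea : 0 < area ![1, -t] ![-t, 1] := by
    simp [area]; nlinarith
  have h4' := mul_pos ht h4
  have k4' := mul_pos ht k4
  refine ⟨basisMat _ _ harea, posMat_conj_iff harea ?_ ?_ ?_ ?_, posMat_conj_iff harea ?_ ?_ ?_ ?_⟩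
  all_goals
    simp only [area, smul_entry, Matrix.cons_val_zero, Matrix.cons_val_one, hA, hB]
    nlinarith

/-- The first axis is a common expanding direction, so a thin cone around it, with edges `(1, -t)`
and `(1, t)`, is mapped strictly inside itself. -/
theorem posPairs_of_upper {A B : SL2R} (hA : A 1 0 = 0) (hA0 : 1 < A 0 0)
    (hB : B 1 0 = 0) (hB0 : 1 < B 0 0) : (A, B) ∈ posPairs := by
  have main : ∀ C : SL2R, C 1 0 = 0 → 1 < C 0 0 → ∀ᶠ t in 𝓝[>] (0 : ℝ),
      0 < t * C 0 0 - t ^ 2 * C 0 1 + t * C 1 1 ∧ 0 < t * C 0 0 + t ^ 2 * C 0 1 - t * C 1 1 ∧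
      0 < t * C 0 0 - t ^ 2 * C 0 1 - t * C 1 1 ∧ 0 < t * C 0 0 + t ^ 2 * C 0 1 + t * C 1 1 := by
    intro C hC hC0
    have dC := det_entries C
    rw [hC] at dC
    have c11 : 0 < C 1 1 := by nlinarith
    have c11' : C 1 1 < C 0 0 := by nlinarith
    have ev : ∀ {f : ℝ → ℝ}, Continuous f → 0 < f 0 → ∀ᶠ t in 𝓝[>] (0 : ℝ), 0 < f t :=
      fun hf h0 => eventually_pos_of_continuous hf h0
    have hpos : ∀ᶠ t in 𝓝[>] (0 : ℝ), 0 < t := eventually_mem_nhdsWithin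
    filter_upwards [hpos, ev (f := fun t => C 0 0 - t * C 0 1 + C 1 1) (by fun_prop)
      (by simp; linarith), ev (f := fun t => C 0 0 + t * C 0 1 - C 1 1) (by fun_prop)
      (by simp; linarith), ev (f := fun t => C 0 0 - t * C 0 1 - C 1 1) (by fun_prop)
      (by simp; linarith), ev (f := fun t => C 0 0 + t * C 0 1 + C 1 1) (by fun_prop)
      (by simp; linarith)] with t ht h1 h2 h3 h4
    have h1 := mul_pos ht h1
    have h2 := mul_pos ht h2
    have h3 := mul_pos ht h3
    have h4 := mul_pos ht h4
    refine ⟨?_, ?_, ?_, ?_⟩ <;> nlinarith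
  have hpos : ∀ᶠ t in 𝓝[>] (0 : ℝ), 0 < t := eventually_mem_nhdsWithin
  obtain ⟨t, ⟨a1, a2, a3, a4⟩, ⟨b1, b2, b3, b4⟩, ht⟩ :=
    ((main A hA hA0).and ((main B hB hB0).and hpos)).exists
  have harea : 0 < area ![1, -t] ![1, t] := by
    simp [area]; linarith
  refine ⟨basisMat _ _ harea, posMat_conj_iff harea ?_ ?_ ?_ ?_, posMat_conj_iff harea ?_ ?_ ?_ ?_⟩
  all_goals
    simp only [area, smul_entry, Matrix.cons_val_zero, Matrix.cons_val_one, hA, hB]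
    linarith

/-- Two hyperbolic elements of positive trace are either simultaneously conjugate to positive
matrices, or conjugate to an upper and a lower triangular matrix with off-diagonal entries of
nonpositive product. -/
theorem triangular_form {A B : SL2R} (hA : 2 < tr A) (hB : 2 < tr B) (hAB : (A, B) ∉ posPairs) :
    ∃ g : SL2R, (g⁻¹ * A * g) 1 0 = 0 ∧ 1 < (g⁻¹ * A * g) 0 0 ∧ (g⁻¹ * B * g) 0 1 = 0 ∧
      1 < (g⁻¹ * B * g) 1 1 ∧ (g⁻¹ * A * g) 0 1 * (g⁻¹ * B * g) 1 0 ≤ 0 := by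
  obtain ⟨μ, hμ, u, hu, hAu⟩ := exists_expanding_eigenvector hA
  obtain ⟨ν, hν, w, hw, hBw⟩ := exists_expanding_eigenvector hB
  have area_smul_left : ∀ (a : ℝ) (u v : Fin 2 → ℝ), area (a • u) v = a * area u v := by
    intro a u v
    simp [area]; ring
  have area_smul_right : ∀ (a : ℝ) (u v : Fin 2 → ℝ), area u (a • v) = a * area u v := by
    intro a u v
    simp [area]; ring
  have area_self : ∀ u : Fin 2 → ℝ, area u u = 0 := by
    intro u
    simp [area]; ring
  -- Vanishing area means a common expanding direction; otherwise the two expanding directions form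
  -- the basis sought.
  by_cases hz : area u w = 0
  · exfalso
    have hBu : B • u = ν • u := by
      have hpt : P1.pt w = P1.pt u := by
        rw [P1.pt_eq_pt_iff hw hu]
        unfold area at hz
        linarith
      rw [P1.pt_eq_mk hw, P1.pt_eq_mk hu, Projectivization.mk_eq_mk_iff'] at hpt
      obtain ⟨a, rfl⟩ := hpt
      have ha : a ≠ 0 := by
        rintro rfl
        simp at hw
      have h1 : a • (B • u) = a • (ν • u) := by
        rw [← smul_comm B a u, hBw, smul_comm]
      exact smul_right_injective _ ha h1
    have harea : 0 < area u ![-u 1, u 0] := by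
      have := vsq_pos hu
      simp only [area, Matrix.cons_val_zero, Matrix.cons_val_one]
      unfold vsq at this
      linarith
    apply hAB
    obtain ⟨e1, -, e3, -⟩ := conj_basisMat harea A
    obtain ⟨f1, -, f3, -⟩ := conj_basisMat harea B
    apply posPairs_of_conj (basisMat _ _ harea)
    refine posPairs_of_upper ?_ ?_ ?_ ?_
    · rw [e3, hAu, area_smul_right, area_self]; simp
    · rw [e1, hAu, area_smul_left, mul_div_assoc, div_self harea.ne', mul_one]; exact hμ
    · rw [f3, hBu, area_smul_right, area_self]; simp
    · rw [f1, hBu, area_smul_left, mul_div_assoc, div_self harea.ne', mul_one]; exact hν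
  · obtain ⟨w, hw, hBw, harea⟩ : ∃ w : Fin 2 → ℝ, w ≠ 0 ∧ B • w = ν • w ∧ 0 < area u w := by
      rcases lt_or_gt_of_ne hz with h | h
      · refine ⟨(-1 : ℝ) • w, smul_ne_zero (by norm_num) hw, ?_, ?_⟩
        · rw [smul_comm, hBw, smul_comm]
        · rw [area_smul_right]; linarith
      · exact ⟨w, hw, hBw, h⟩
    obtain ⟨e1, e2, e3, e4⟩ := conj_basisMat harea A
    obtain ⟨f1, f2, f3, f4⟩ := conj_basisMat harea B
    rw [hAu, area_smul_left, mul_div_assoc, div_self harea.ne', mul_one] at e1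
    rw [hAu, area_smul_right, area_self, mul_zero, zero_div] at e3
    rw [hBw, area_smul_left, area_self, mul_zero, zero_div] at f2
    rw [hBw, area_smul_right, mul_div_assoc, div_self harea.ne', mul_one] at f4
    refine ⟨basisMat u w harea, e3, by rw [e1]; exact hμ, f2, by rw [f4]; exact hν, ?_⟩
    by_contra hcon
    push Not at hcon
    apply hAB
    rcases lt_trichotomy ((( basisMat u w harea)⁻¹ * A * basisMat u w harea) 0 1) 0 with h | h | h
    · have h' : ((basisMat u w harea)⁻¹ * B * basisMat u w harea) 1 0 < 0 := by
        by_contra hge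
        push Not at hge
        nlinarith
      -- Both off-diagonal entries are negative. The basis `(w, -u)` exchanges the roles of `A` and
      -- `B` and makes them positive.
      have harea' : 0 < area w ((-1 : ℝ) • u) := by
        rw [area_smul_right]
        unfold area at harea ⊢
        linarith
      apply posPairs_of_conj (basisMat _ _ harea')
      apply posPairs_swap
      obtain ⟨c1, c2, c3, c4⟩ := conj_basisMat harea' A
      obtain ⟨d1, d2, d3, d4⟩ := conj_basisMat harea' B
      have key : ∀ C : SL2R, area (C • ((-1 : ℝ) • u)) ((-1 : ℝ) • u) = - area u (C • u) ∧
          area w (C • w) = - area (C • w) w := by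
        intro C
        constructor
        · simp only [area, smul_entry, Pi.smul_apply, smul_eq_mul]; ring
        · simp only [area]; ring
      rw [e2, div_lt_iff₀ harea, zero_mul] at h
      rw [f3, div_lt_iff₀ harea, zero_mul] at h'
      refine posPairs_of_triangular ?_ ?_ ?_ ?_ ?_ ?_
      · rw [d3, hBw, area_smul_right, area_self]; simp
      · rw [d1, hBw, area_smul_left, mul_div_assoc, div_self harea'.ne', mul_one]; exact hν
      · rw [d2, (key B).1]
        exact div_pos (by linarith) harea'
      · rw [c2, smul_comm, hAu, area_smul_left, area_smul_left, area_smul_right, area_self]; simp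
      · rw [c4, smul_comm, hAu, smul_comm (-1 : ℝ) μ, area_smul_right, mul_div_assoc,
          div_self harea'.ne', mul_one]
        exact hμ
      · rw [c3, (key A).2]
        exact div_pos (by linarith) harea'
    · rw [h, zero_mul] at hcon
      exact absurd hcon (lt_irrefl 0)
    · have h' : 0 < ((basisMat u w harea)⁻¹ * B * basisMat u w harea) 1 0 := by
        by_contra hge
        push Not at hge
        nlinarith
      exact posPairs_of_conj _ (posPairs_of_triangular e3 (by rw [e1]; exact hμ) h f2
        (by rw [f4]; exact hν) h')

/-! ### Traces of triangular pairs, changes of sign and free forms. -/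

theorem triangular_entries {A B : SL2R} (hA : A 1 0 = 0) (hB : B 0 1 = 0) :
    A 1 1 = (A 0 0)⁻¹ ∧ B 0 0 = (B 1 1)⁻¹ := by
  have dA := det_entries A
  have dB := det_entries B
  rw [hA] at dA
  rw [hB] at dB
  constructor
  · apply eq_inv_of_mul_eq_one_left; linarith
  · apply eq_inv_of_mul_eq_one_left; linarith

theorem fricke_conj (g : SL2R) (p : SL2R × SL2R) :
    fricke (g⁻¹ * p.1 * g, g⁻¹ * p.2 * g) = fricke p := by
  simp only [fricke, conj_inv_mul, tr_conj_inv]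

/-- With `m = A 0 1 * B 1 0`, one has `fricke - 4 = m (m - (μ - μ⁻¹)(ν - ν⁻¹))` and `tr A tr B - 2
tr AB = (μ - μ⁻¹)(ν - ν⁻¹) - 2m`. Both are nonnegative because `m ≤ 0`. -/
theorem weaklyTwisted_of_triangular {A B : SL2R} (hA : A 1 0 = 0) (hA0 : 1 < A 0 0)
    (hB : B 0 1 = 0) (hB0 : 1 < B 1 1) (hle : A 0 1 * B 1 0 ≤ 0) : (A, B) ∈ weaklyTwistedSet := by
  obtain ⟨hA1, hB1⟩ := triangular_entries hA hB
  have trA : tr A = A 0 0 + (A 0 0)⁻¹ := by rw [tr, hA1]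
  have trB : tr B = B 1 1 + (B 1 1)⁻¹ := by rw [tr, hB1]; ring
  have trAB : tr (A * B) = A 0 0 * (B 1 1)⁻¹ + (A 0 0)⁻¹ * B 1 1 + A 0 1 * B 1 0 := by
    simp only [tr, mul_entry, hA, hB, hA1, hB1]; ring
  generalize A 0 0 = μ at *
  generalize B 1 1 = ν at *
  generalize A 0 1 * B 1 0 = m at *
  have key : ∀ t : ℝ, 1 < t → 2 < t + t⁻¹ := by
    intro t ht
    have h0 : 0 < t := by linarith
    rw [← sub_pos]
    have : t + t⁻¹ - 2 = (t - 1) ^ 2 / t := by field_simp; ring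
    rw [this]
    have : 0 < t - 1 := by linarith
    positivity
  have hx := key μ hA0
  have hy := key ν hB0
  have hμ0 : 0 < μ := by linarith
  have hν0 : 0 < ν := by linarith
  have hμ' : μ⁻¹ < 1 := inv_lt_one_of_one_lt₀ hA0
  have hν' : ν⁻¹ < 1 := inv_lt_one_of_one_lt₀ hB0
  have hμi : 0 < μ⁻¹ := by positivity
  have hνi : 0 < ν⁻¹ := by positivity
  have e1 : μ * μ⁻¹ = 1 := mul_inv_cancel₀ hμ0.ne'
  have e2 : ν * ν⁻¹ = 1 := mul_inv_cancel₀ hν0.ne'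
  have hprod : 0 < (μ - μ⁻¹) * (ν - ν⁻¹) := mul_pos (by linarith) (by linarith)
  refine ⟨?_, ?_, ?_, ?_⟩
  · rw [trA, abs_of_pos (by linarith)]; exact hx
  · rw [trB, abs_of_pos (by linarith)]; exact hy
  · have : fricke (A, B) = 4 + m * (m - (μ - μ⁻¹) * (ν - ν⁻¹)) := by
      simp only [fricke, trA, trB, trAB]
      field_simp
      ring
    rw [this]
    nlinarith
  · simp only [trA, trB, trAB]
    have hxy : 0 < (μ + μ⁻¹) * (ν + ν⁻¹) := by positivity
    have h1 : 2 * (μ * ν⁻¹ + μ⁻¹ * ν + m) ≤ (μ + μ⁻¹) * (ν + ν⁻¹) := by nlinarith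
    nlinarith

theorem weaklyTwisted_conj {A B : SL2R} (g : SL2R)
    (h : (g⁻¹ * A * g, g⁻¹ * B * g) ∈ weaklyTwistedSet) : (A, B) ∈ weaklyTwistedSet := by
  obtain ⟨h1, h2, h3, h4⟩ := h
  rw [fricke_conj g (A, B)] at h3
  simp only [conj_inv_mul, tr_conj_inv] at h1 h2 h4
  exact ⟨h1, h2, h3, h4⟩

/-- Change the signs of the two components of a pair. -/
def flipSign (s : Bool × Bool) (p : SL2R × SL2R) : SL2R × SL2R :=
  (if s.1 then -p.1 else p.1, if s.2 then -p.2 else p.2)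

theorem flipSign_flipSign (s : Bool × Bool) (p : SL2R × SL2R) : flipSign s (flipSign s p) = p := by
  obtain ⟨a, b⟩ := s
  cases a <;> cases b <;> simp [flipSign]

theorem exists_flipSign_tr_pos {p : SL2R × SL2R} (hx : 2 < |tr p.1|) (hy : 2 < |tr p.2|) :
    ∃ s, 2 < tr (flipSign s p).1 ∧ 2 < tr (flipSign s p).2 := by
  have key : ∀ g : SL2R, 2 < |tr g| → ∃ b : Bool, 2 < tr (if b then -g else g) := by
    intro g hg
    rcases lt_abs.mp hg with h | h
    · exact ⟨false, by simpa using h⟩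
    · exact ⟨true, by simpa [tr_neg] using h⟩
  obtain ⟨a, ha⟩ := key _ hx
  obtain ⟨b, hb⟩ := key _ hy
  exact ⟨(a, b), ha, hb⟩

theorem flipSign_trace (s : Bool × Bool) (p : SL2R × SL2R) :
    |tr (flipSign s p).1| = |tr p.1| ∧ |tr (flipSign s p).2| = |tr p.2| ∧
    |tr ((flipSign s p).1 * (flipSign s p).2)| = |tr (p.1 * p.2)| ∧
    tr (flipSign s p).1 * tr (flipSign s p).2 * tr ((flipSign s p).1 * (flipSign s p).2) =
      tr p.1 * tr p.2 * tr (p.1 * p.2) := by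
  obtain ⟨a, b⟩ := s
  cases a <;> cases b <;> simp [flipSign, tr_neg]

theorem flipSign_mem_freeSet {s : Bool × Bool} {p : SL2R × SL2R} :
    flipSign s p ∈ freeSet ↔ p ∈ freeSet := by
  obtain ⟨h1, h2, h3, h4⟩ := flipSign_trace s p
  simp only [freeSet, Set.mem_ofPred_eq, h1, h2, h3, h4]

theorem flipSign_mem_weaklyTwistedSet {s : Bool × Bool} {p : SL2R × SL2R} :
    flipSign s p ∈ weaklyTwistedSet ↔ p ∈ weaklyTwistedSet := by
  obtain ⟨h1, h2, h3, h4⟩ := flipSign_trace s p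
  have hf : fricke (flipSign s p) = fricke p := by
    simp only [fricke]
    rw [h4, ← sq_abs (tr (flipSign s p).1), ← sq_abs (tr (flipSign s p).2),
      ← sq_abs (tr ((flipSign s p).1 * (flipSign s p).2)), h1, h2, h3, sq_abs, sq_abs, sq_abs]
  have hx : tr (flipSign s p).1 ^ 2 = tr p.1 ^ 2 := by rw [← sq_abs, h1, sq_abs]
  have hy : tr (flipSign s p).2 ^ 2 = tr p.2 ^ 2 := by rw [← sq_abs, h2, sq_abs]
  simp only [weaklyTwistedSet, Set.mem_ofPred_eq, h1, h2, h4, hf, hx, hy]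

/-- Pairs that become simultaneously conjugate to positive matrices after a prescribed change
of signs. -/
def principalSet (s : Bool × Bool) : Set (SL2R × SL2R) := {p | flipSign s p ∈ posPairs}

theorem weaklyTwisted_of_notMem_principalSet {p : SL2R × SL2R} (hx : 2 < |tr p.1|)
    (hy : 2 < |tr p.2|) (h : ∀ s, p ∉ principalSet s) : p ∈ weaklyTwistedSet := by
  obtain ⟨s, h1, h2⟩ := exists_flipSign_tr_pos hx hy
  rw [← flipSign_mem_weaklyTwistedSet (s := s)]
  obtain ⟨g, k1, k2, k3, k4, k5⟩ := triangular_form h1 h2 (h s)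
  exact weaklyTwisted_conj g (weaklyTwisted_of_triangular k1 k2 k3 k4 k5)

/-- A pair in `freeSet` with positive traces of `A` and `B` is conjugate to a pair with equal
diagonal entries, the first one positive and the second one with negative off-diagonal entries. -/
structure IsFreeForm (A B : SL2R) : Prop where
  diagA : A 1 1 = A 0 0
  diagB : B 1 1 = B 0 0
  a_pos : 1 < A 0 0
  e_pos : 1 < B 0 0
  b_pos : 0 < A 0 1
  c_pos : 0 < A 1 0
  f_neg : B 0 1 < 0
  g_neg : B 1 0 < 0
  tr_lt : 2 * A 0 0 * B 0 0 + A 0 1 * B 1 0 + A 1 0 * B 0 1 < -2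

/-- The matrix `AB - BA`, with rows `(k, l)` and `(m, -k)`, is traceless and squares to the scalar
`fricke - 4 > 0`. It is therefore diagonalizable with eigenvalues `D`, `-D`. In its eigenbasis, `tr
(A (AB - BA)) = tr (B (AB - BA)) = 0` says that the diagonals of `A` and `B` are constant. -/
theorem exists_conj_equal_diagonals {A B : SL2R} (h : 4 < fricke (A, B)) :
    ∃ g : SL2R, (g⁻¹ * A * g) 1 1 = (g⁻¹ * A * g) 0 0 ∧ (g⁻¹ * B * g) 1 1 = (g⁻¹ * B * g) 0 0 := by
  set k := A 0 1 * B 1 0 - B 0 1 * A 1 0 with hk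
  set l := A 0 0 * B 0 1 + A 0 1 * B 1 1 - B 0 0 * A 0 1 - B 0 1 * A 1 1 with hl
  set m := A 1 0 * B 0 0 + A 1 1 * B 1 0 - B 1 0 * A 0 0 - B 1 1 * A 1 0 with hm
  have dA := det_entries A
  have dB := det_entries B
  have hdisc : fricke (A, B) - 4 = k ^ 2 + l * m := by
    simp only [fricke, tr, mul_entry, hk, hl, hm]
    linear_combination (-(A 0 0 + A 1 1) ^ 2 + 4 * (A 0 0 * A 1 1 - A 0 1 * A 1 0)) * dB +
      (-(B 0 0 + B 1 1) ^ 2 + 4) * dA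
  have hpos : 0 < k ^ 2 + l * m := by linarith
  -- The eigenvectors used are `(D + k, m)` and a multiple of `(-l, D + k)`; the sign of the root
  -- `D` is chosen so that they do not degenerate.
  obtain ⟨D, hD2, hDk⟩ : ∃ D : ℝ, D ^ 2 = k ^ 2 + l * m ∧ D * (D + k) ≠ 0 := by
    have hs := Real.sqrt_pos.mpr hpos
    have hs2 := Real.sq_sqrt hpos.le
    by_cases h0 : √(k ^ 2 + l * m) + k = 0
    · refine ⟨-√(k ^ 2 + l * m), by rw [neg_sq, hs2], mul_ne_zero (by linarith) ?_⟩
      intro h1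
      linarith
    · exact ⟨√(k ^ 2 + l * m), hs2, mul_ne_zero hs.ne' h0⟩
  have hsym : ∀ C : SL2R, C 0 0 * k + C 0 1 * m + C 1 0 * l - C 1 1 * k = 0 → ∀ t : ℝ,
      area ![D + k, m] (C • ![-(t * l), t * (D + k)]) =
        area (C • ![D + k, m]) ![-(t * l), t * (D + k)] := by
    intro C hC t
    simp only [area, smul_entry, Matrix.cons_val_zero, Matrix.cons_val_one]
    linear_combination (-2 * t * (D + k)) * hC + t * (C 1 1 - C 0 0) * hD2
  have htA : A 0 0 * k + A 0 1 * m + A 1 0 * l - A 1 1 * k = 0 := by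
    rw [hk, hl, hm]; ring
  have htB : B 0 0 * k + B 0 1 * m + B 1 0 * l - B 1 1 * k = 0 := by
    rw [hk, hl, hm]; ring
  obtain ⟨t, ht⟩ : ∃ t : ℝ, 0 < area ![D + k, m] ![-(t * l), t * (D + k)] := by
    refine ⟨D * (D + k), ?_⟩
    have : area ![D + k, m] ![-(D * (D + k) * l), D * (D + k) * (D + k)] =
        2 * (D * (D + k)) ^ 2 := by
      simp only [area, Matrix.cons_val_zero, Matrix.cons_val_one]
      linear_combination (-(D * (D + k))) * hD2
    rw [this]
    positivity
  refine ⟨basisMat _ _ ht, ?_, ?_⟩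
  · obtain ⟨e1, -, -, e4⟩ := conj_basisMat ht A
    rw [e1, e4, hsym A htA]
  · obtain ⟨e1, -, -, e4⟩ := conj_basisMat ht B
    rw [e1, e4, hsym B htB]

/-- Determinant one and diagonal entries above 1 force the off-diagonal entries of each matrix to
have equal signs. If those of `B` were positive as well, all contributions to `tr AB` would be
positive. -/
theorem isFreeForm_of_tr {A B : SL2R} (hA : 2 < tr A) (hB : 2 < tr B) (hAB : tr (A * B) < -2)
    (h1 : A 1 1 = A 0 0) (h2 : B 1 1 = B 0 0) (hb : 0 < A 0 1) : IsFreeForm A B := by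
  have dA := det_entries A
  have dB := det_entries B
  rw [h1] at dA
  rw [h2] at dB
  simp only [tr, mul_entry] at hA hB hAB
  rw [h1] at hA
  rw [h2] at hB
  rw [h1, h2] at hAB
  have ha : 1 < A 0 0 := by linarith
  have he : 1 < B 0 0 := by linarith
  have hc : 0 < A 1 0 := by
    by_contra hcon
    push Not at hcon
    nlinarith
  have hz : 2 * A 0 0 * B 0 0 + A 0 1 * B 1 0 + A 1 0 * B 0 1 < -2 := by linarith
  have hfg : 0 < B 0 1 * B 1 0 := by nlinarith
  have hf : B 0 1 < 0 := by
    by_contra hcon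
    push Not at hcon
    have hg : 0 ≤ B 1 0 := by
      by_contra hcon'
      push Not at hcon'
      nlinarith
    have := mul_nonneg hb.le hg
    have := mul_nonneg hc.le hcon
    nlinarith
  have hg : B 1 0 < 0 := by
    by_contra hcon
    push Not at hcon
    nlinarith
  exact ⟨h1, h2, ha, he, hb, hc, hf, hg, hz⟩

theorem off_diagonal_mul_pos {A : SL2R} (hA : 2 < tr A) (h1 : A 1 1 = A 0 0) :
    0 < A 0 1 * A 1 0 := by
  have dA := det_entries A
  unfold tr at hA
  rw [h1] at dA hA
  nlinarith

theorem exists_isFreeForm {A B : SL2R} (hA : 2 < tr A) (hB : 2 < tr B) (hAB : tr (A * B) < -2) :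
    ∃ g : SL2R, IsFreeForm (g⁻¹ * A * g) (g⁻¹ * B * g) := by
  have hfr : 4 < fricke (A, B) := by
    simp only [fricke]
    have : tr A * tr B * tr (A * B) < 0 := mul_neg_of_pos_of_neg (by positivity) (by linarith)
    nlinarith
  obtain ⟨g, h1, h2⟩ := exists_conj_equal_diagonals hfr
  rw [← tr_conj_inv g A] at hA
  rw [← tr_conj_inv g B] at hB
  rw [← tr_conj_inv g (A * B), ← conj_inv_mul] at hAB
  have hbc := off_diagonal_mul_pos hA h1
  rcases lt_trichotomy ((g⁻¹ * A * g) 0 1) 0 with hb | hb | hb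
  · have hc : (g⁻¹ * A * g) 1 0 < 0 := by
      by_contra hcon
      push Not at hcon
      nlinarith
    -- Conjugation by the quarter turn interchanges the off-diagonal entries and changes their
    -- signs.
    set J : SL2R := SL2R.mk 0 1 (-1) 0 (by norm_num) with hJ
    refine ⟨g * J, ?_⟩
    have eA : (g * J)⁻¹ * A * (g * J) = J⁻¹ * (g⁻¹ * A * g) * J := by group
    have eB : (g * J)⁻¹ * B * (g * J) = J⁻¹ * (g⁻¹ * B * g) * J := by group
    rw [eA, eB]
    generalize g⁻¹ * A * g = A' at *
    generalize g⁻¹ * B * g = B' at *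
    obtain ⟨c1, c2, c3, c4⟩ := conj_entry A' J
    obtain ⟨d1, d2, d3, d4⟩ := conj_entry B' J
    simp only [hJ, mk_00, mk_01, mk_10, mk_11] at c1 c2 c3 c4 d1 d2 d3 d4
    refine isFreeForm_of_tr ?_ ?_ ?_ ?_ ?_ ?_
    · rw [tr_conj_inv]; exact hA
    · rw [tr_conj_inv]; exact hB
    · rw [conj_inv_mul, tr_conj_inv]; exact hAB
    · rw [c1, c4]; linarith
    · rw [d1, d4]; linarith
    · rw [c2]; linarith
  · rw [hb, zero_mul] at hbc
    exact absurd hbc (lt_irrefl 0)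
  · exact ⟨g, isFreeForm_of_tr hA hB hAB h1 h2 hb⟩

theorem exists_flipSign_isFreeForm {p : SL2R × SL2R} (hp : p ∈ freeSet) :
    ∃ s, ∃ g : SL2R, IsFreeForm (g⁻¹ * (flipSign s p).1 * g) (g⁻¹ * (flipSign s p).2 * g) := by
  obtain ⟨s, h1, h2⟩ := exists_flipSign_tr_pos hp.1 hp.2.1
  obtain ⟨-, -, h3, h4⟩ := flipSign_mem_freeSet (s := s) |>.mpr hp
  refine ⟨s, exists_isFreeForm h1 h2 ?_⟩
  rcases lt_abs.mp h3 with h | h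
  · have : 0 < tr (flipSign s p).1 * tr (flipSign s p).2 *
      tr ((flipSign s p).1 * (flipSign s p).2) := by positivity
    linarith
  · linarith

/-! ### Reflection groups of three disjoint geodesics and exponential growth -/

theorem exists_pos_forall_le {ι : Type*} [Finite ι] {f : ι → ℝ} (hf : ∀ i, 0 < f i) :
    ∃ ε, 0 < ε ∧ ∀ i, ε ≤ f i := by
  rcases isEmpty_or_nonempty ι with h | h
  · exact ⟨1, one_pos, fun i => (h.false i).elim⟩
  · obtain ⟨i, hi⟩ := Finite.exists_min f
    exact ⟨f i, hf i, hi⟩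

/-- A binary quadratic form. -/
def binForm (α β γ : ℝ) (v : Fin 2 → ℝ) : ℝ := α * v 0 ^ 2 + β * (v 0 * v 1) + γ * v 1 ^ 2

/-- The constant is determinant over trace of the symmetric matrix, a lower bound for its smaller
eigenvalue. -/
theorem binForm_posDef {α β γ : ℝ} (hα : 0 < α + γ) (h : β ^ 2 < 4 * α * γ) :
    ∃ ε, 0 < ε ∧ ∀ v, ε * vsq v ≤ binForm α β γ v := by
  refine ⟨(4 * α * γ - β ^ 2) / (4 * (α + γ)), div_pos (by linarith) (by linarith), fun v => ?_⟩
  rw [div_mul_eq_mul_div, div_le_iff₀ (by linarith)]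
  unfold binForm vsq
  have hsq : 0 ≤ (2 * α * v 0 + β * v 1) ^ 2 + (2 * γ * v 1 + β * v 0) ^ 2 := by positivity
  nlinarith

theorem binForm_le (α β γ : ℝ) : ∃ K, 0 < K ∧ ∀ v, binForm α β γ v ≤ K * vsq v := by
  refine ⟨1 + |α| + |β| + |γ|, by positivity, fun v => ?_⟩
  unfold binForm vsq
  have h1 : α * v 0 ^ 2 ≤ |α| * v 0 ^ 2 := by gcongr; exact le_abs_self α
  have h2 : γ * v 1 ^ 2 ≤ |γ| * v 1 ^ 2 := by gcongr; exact le_abs_self γ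
  have h3 : β * (v 0 * v 1) ≤ |β| * (v 0 ^ 2 + v 1 ^ 2) := by
    calc β * (v 0 * v 1) ≤ |β * (v 0 * v 1)| := le_abs_self _
      _ = |β| * |v 0 * v 1| := abs_mul _ _
      _ ≤ _ := by
        gcongr
        rw [abs_le]
        constructor <;> nlinarith [sq_nonneg (v 0 + v 1), sq_nonneg (v 0 - v 1)]
  nlinarith [abs_nonneg α, abs_nonneg β, abs_nonneg γ, sq_nonneg (v 0), sq_nonneg (v 1),
    mul_nonneg (abs_nonneg α) (sq_nonneg (v 1)), mul_nonneg (abs_nonneg γ) (sq_nonneg (v 0))]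

/-- Three reflections in pairwise disjoint geodesics of the hyperbolic plane, in coordinates where
the second one is `diag(1, -1)`. -/
structure Reflections where
  (a b c e f g : ℝ)
  a_gt : 1 < a
  e_gt : 1 < e
  b_pos : 0 < b
  c_pos : 0 < c
  f_pos : 0 < f
  g_pos : 0 < g
  detA : a ^ 2 - b * c = 1
  detB : e ^ 2 - f * g = 1
  gram_gt : 2 < b * g + c * f - 2 * a * e

namespace Reflections

variable (R : Reflections)

/-- The action of the three reflections on vectors. -/
def act : Fin 3 → (Fin 2 → ℝ) → (Fin 2 → ℝ)
  | 0, v => ![-R.a * v 0 + R.b * v 1, -R.c * v 0 + R.a * v 1]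
  | 1, v => ![v 0, -v 1]
  | 2, v => ![-R.e * v 0 + R.f * v 1, -R.g * v 0 + R.e * v 1]

/-- The quadratic forms `v ↦ det (v, Rᵢ v)`, positive on the interval attracting the `i`-th
reflection. -/
def form : Fin 3 → (Fin 2 → ℝ) → ℝ
  | 0 => binForm (-R.c) (2 * R.a) (-R.b)
  | 1 => binForm 0 (-2) 0
  | 2 => binForm (-R.g) (2 * R.e) (-R.f)

/-- The negatives of the traces of the products of two reflections. -/
def gram : Fin 3 → Fin 3 → ℝ
  | 0, 0 => -2
  | 1, 1 => -2
  | 2, 2 => -2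
  | 0, 1 => 2 * R.a
  | 1, 0 => 2 * R.a
  | 1, 2 => 2 * R.e
  | 2, 1 => 2 * R.e
  | 0, 2 => R.b * R.g + R.c * R.f - 2 * R.a * R.e
  | 2, 0 => R.b * R.g + R.c * R.f - 2 * R.a * R.e

/-- Pulling the forms back by the reflections is a geometric representation of the group generated
by three involutions: the form with index `i` changes sign and the others are translated by its
multiples. -/
theorem form_act (i k : Fin 3) (v : Fin 2 → ℝ) :
    R.form k (R.act i v) = R.form k v + R.gram i k * R.form i v := by
  have hA := R.detA
  have hB := R.detB
  fin_cases i <;> fin_cases k <;>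
    simp only [form, act, gram, binForm,
      Matrix.cons_val_zero, Matrix.cons_val_one]
  · linear_combination (R.c * v 0 ^ 2 - 2 * R.a * (v 0 * v 1) + R.b * v 1 ^ 2) * hA
  · linear_combination -(2 * (v 0 * v 1)) * hA
  · linear_combination -(R.g * v 0 ^ 2 - 2 * R.e * (v 0 * v 1) + R.f * v 1 ^ 2) * hA
  · ring
  · ring
  · ring
  · linear_combination -(R.c * v 0 ^ 2 - 2 * R.a * (v 0 * v 1) + R.b * v 1 ^ 2) * hB
  · linear_combination -(2 * (v 0 * v 1)) * hB
  · linear_combination (R.g * v 0 ^ 2 - 2 * R.e * (v 0 * v 1) + R.f * v 1 ^ 2) * hB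

theorem act_act (i : Fin 3) (v : Fin 2 → ℝ) : R.act i (R.act i v) = v := by
  have hA := R.detA
  have hB := R.detB
  fin_cases i <;> apply plane_ext <;>
    simp only [act, Matrix.cons_val_zero, Matrix.cons_val_one]
  · linear_combination (v 0) * hA
  · linear_combination (v 1) * hA
  · ring
  · linear_combination (v 0) * hB
  · linear_combination (v 1) * hB

theorem act_neg (i : Fin 3) (v : Fin 2 → ℝ) : R.act i (-v) = -R.act i v := by
  fin_cases i <;> apply plane_ext <;>
    simp only [act, Pi.neg_apply, Matrix.cons_val_zero, Matrix.cons_val_one] <;> ring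

/-- The hypothesis says that the discriminant of the combination is negative, that is, the
combination is definite. `x, z ≥ 0` makes it negative definite rather than positive definite. -/
theorem combination_posDef {x y z : ℝ} (hx : 0 ≤ x) (hz : 0 ≤ z) (hxz : 0 < x + z)
    (h : x ^ 2 + y ^ 2 + z ^ 2 < 2 * R.a * (x * y) + 2 * R.e * (y * z) + R.gram 0 2 * (x * z)) :
    ∃ ε, 0 < ε ∧ ∀ v, ε * vsq v ≤ -(x * R.form 0 v + y * R.form 1 v + z * R.form 2 v) := by
  have hA := R.detA
  have hB := R.detB
  have := R.b_pos
  have := R.c_pos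
  have := R.f_pos
  have := R.g_pos
  obtain ⟨ε, hε, hv⟩ := binForm_posDef (α := x * R.c + z * R.g)
    (β := -2 * R.a * x + 2 * y - 2 * R.e * z) (γ := x * R.b + z * R.f) (by
      rcases hx.lt_or_eq with h0 | h0
      · positivity
      · rw [← h0] at hxz ⊢
        have : 0 < z := by linarith
        positivity) (by
      simp only [gram] at h
      nlinarith)
  refine ⟨ε, hε, fun v => (hv v).trans (le_of_eq ?_)⟩
  simp only [form, binForm]
  ring

/-- By `form_act` the right side equals `-(gram i k * form i + form k + form j)`. All pairwise Gram
entries exceed 2 because the geodesics are disjoint, and this makes the combination definite. -/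
theorem step_posDef {i j k : Fin 3} (hji : j ≠ i) (hki : k ≠ i) :
    ∃ ε, 0 < ε ∧ ∀ v, ε * vsq v ≤
      (R.form i (R.act i v) - R.form k (R.act i v)) - (R.form j v - R.form i v) := by
  have ha := R.a_gt
  have he := R.e_gt
  have hg := R.gram_gt
  have main : ∃ ε, 0 < ε ∧ ∀ v, ε * vsq v ≤
      -(R.gram i k * R.form i v + R.form k v + R.form j v) := by
    have key : ∀ x y z : ℝ, 0 ≤ x → 0 ≤ z → 0 < x + z →
        x ^ 2 + y ^ 2 + z ^ 2 < 2 * R.a * (x * y) + 2 * R.e * (y * z) + R.gram 0 2 * (x * z) →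
        (∀ v, x * R.form 0 v + y * R.form 1 v + z * R.form 2 v =
          R.gram i k * R.form i v + R.form k v + R.form j v) →
        ∃ ε, 0 < ε ∧ ∀ v, ε * vsq v ≤
          -(R.gram i k * R.form i v + R.form k v + R.form j v) := by
      intro x y z hx hz hxz h heq
      obtain ⟨ε, hε, hv⟩ := R.combination_posDef hx hz hxz h
      exact ⟨ε, hε, fun v => by rw [← heq]; exact hv v⟩
    set t := R.b * R.g + R.c * R.f - 2 * R.a * R.e with ht
    have e02 : R.gram 0 2 = t := rfl
    fin_cases i <;> fin_cases j <;> fin_cases k <;>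
      simp only [Fin.zero_eta, Fin.mk_one, Fin.reduceFinMk, ne_eq, not_true_eq_false] at hji hki ⊢ key
    · exact key (2 * R.a) 2 0 (by linarith) le_rfl (by linarith) (by nlinarith)
        (fun v => by simp only [gram]; ring)
    · exact key t 1 1 (by linarith) zero_le_one (by linarith) (by rw [e02]; nlinarith)
        (fun v => by simp only [gram, ← ht]; ring)
    · exact key (2 * R.a) 1 1 (by linarith) zero_le_one (by linarith) (by rw [e02]; nlinarith)
        (fun v => by simp only [gram]; ring)
    · exact key t 0 2 (by linarith) zero_le_two (by linarith) (by rw [e02]; nlinarith)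
        (fun v => by simp only [gram, ← ht]; ring)
    · exact key 2 (2 * R.a) 0 (by linarith) le_rfl (by linarith) (by nlinarith)
        (fun v => by simp only [gram]; ring)
    · exact key 1 (2 * R.e) 1 (by linarith) zero_le_one (by linarith) (by rw [e02]; nlinarith)
        (fun v => by simp only [gram]; ring)
    · exact key 1 (2 * R.a) 1 (by linarith) zero_le_one (by linarith) (by rw [e02]; nlinarith)
        (fun v => by simp only [gram]; ring)
    · exact key 0 (2 * R.e) 2 (by linarith) zero_le_two (by linarith) (by nlinarith)
        (fun v => by simp only [gram]; ring)
    · exact key 2 0 t (by linarith) (by linarith) (by linarith) (by rw [e02]; nlinarith)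
        (fun v => by simp only [gram, ← ht]; ring)
    · exact key 1 1 (2 * R.e) (by linarith) (by linarith) (by linarith) (by rw [e02]; nlinarith)
        (fun v => by simp only [gram]; ring)
    · exact key 1 1 t (by linarith) (by linarith) (by linarith) (by rw [e02]; nlinarith)
        (fun v => by simp only [gram, ← ht]; ring)
    · exact key 0 2 (2 * R.e) le_rfl (by linarith) (by linarith) (by nlinarith)
        (fun v => by simp only [gram]; ring)
  obtain ⟨ε, hε, hv⟩ := main
  refine ⟨ε, hε, fun v => (hv v).trans (le_of_eq ?_)⟩
  rw [form_act, form_act]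
  have : R.gram i i = -2 := by fin_cases i <;> rfl
  rw [this]
  ring

/-- The additive gain of `step_posDef` is a multiple of `vsq v`, and the gap `form j v - form i v`
is itself at most a multiple of `vsq v`. Hence the gain is multiplicative, uniformly in the finitely
many indices. -/
theorem exists_step_constant : ∃ lam, 1 < lam ∧ ∀ i j k : Fin 3, j ≠ i → k ≠ i →
    ∀ v, 0 < R.form j v - R.form i v → lam * (R.form j v - R.form i v) ≤
      R.form i (R.act i v) - R.form k (R.act i v) := by
  have h1 : ∀ t : {t : Fin 3 × Fin 3 × Fin 3 // t.2.1 ≠ t.1 ∧ t.2.2 ≠ t.1}, ∃ ε, 0 < ε ∧ ∀ v,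
      ε * vsq v ≤ (R.form t.1.1 (R.act t.1.1 v) - R.form t.1.2.2 (R.act t.1.1 v)) -
        (R.form t.1.2.1 v - R.form t.1.1 v) := fun t => R.step_posDef t.2.1 t.2.2
  choose ε hε hεv using h1
  obtain ⟨ε₀, hε₀, hle⟩ := exists_pos_forall_le hε
  have h2 : ∀ i : Fin 3, ∃ K, 0 < K ∧ ∀ v, |R.form i v| ≤ K * vsq v := by
    have key : ∀ α β γ : ℝ, ∃ K, 0 < K ∧ ∀ v, |binForm α β γ v| ≤ K * vsq v := by
      intro α β γ
      obtain ⟨K, hK, h⟩ := binForm_le α β γ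
      obtain ⟨K', hK', h'⟩ := binForm_le (-α) (-β) (-γ)
      refine ⟨K + K', by positivity, fun v => abs_le.mpr ⟨?_, ?_⟩⟩
      · have h1 := h' v
        have h2 := mul_nonneg hK.le (vsq_nonneg v)
        unfold binForm at h1 ⊢
        linarith
      · have h1 := h v
        have h2 := mul_nonneg hK'.le (vsq_nonneg v)
        linarith
    intro i
    fin_cases i
    · exact key _ _ _
    · exact key _ _ _
    · exact key _ _ _
  choose K hK hKv using h2
  have hKsum : ∀ i, K i ≤ ∑ i, K i := fun i =>
    Finset.single_le_sum (fun i _ => (hK i).le) (Finset.mem_univ i)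
  set S := 2 * ∑ i, K i with hS
  have hSpos : 0 < S := by
    have := hKsum 0
    have := hK 0
    linarith
  refine ⟨1 + ε₀ / S, by linarith [div_pos hε₀ hSpos], fun i j k hj hk v hv => ?_⟩
  have e1 := hεv ⟨(i, j, k), hj, hk⟩ v
  have e2 := hle ⟨(i, j, k), hj, hk⟩
  have hvs := vsq_nonneg v
  have e3 : R.form j v - R.form i v ≤ S * vsq v := by
    have k1 := (le_abs_self _).trans (hKv j v)
    have k2 := (neg_le_abs _).trans (hKv i v)
    have k3 := mul_le_mul_of_nonneg_right (hKsum j) hvs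
    have k4 := mul_le_mul_of_nonneg_right (hKsum i) hvs
    rw [hS]
    linarith
  have e4 : ε₀ / S * (R.form j v - R.form i v) ≤ ε₀ * vsq v := by
    rw [div_mul_eq_mul_div, div_le_iff₀ hSpos]
    nlinarith
  have e5 := mul_le_mul_of_nonneg_right e2 hvs
  simp only at e1
  linarith

/-- The action of a word in the three reflections. -/
def actWord : List (Fin 3) → (Fin 2 → ℝ) → (Fin 2 → ℝ)
  | [], v => v
  | i :: l, v => R.act i (actWord l v)

/-- A vector on which words ending in a given letter grow. -/
def seed (i : Fin 3) : Fin 2 → ℝ := if i = 1 then ![R.b, R.a] else ![1, -1]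

theorem exists_seed_pos (i : Fin 3) : ∃ j, j ≠ i ∧ 0 < R.form j (R.seed i) - R.form i (R.seed i) := by
  have := R.a_gt
  have := R.e_gt
  have := R.b_pos
  have := R.c_pos
  have := R.f_pos
  have := R.g_pos
  have hd := R.detA
  fin_cases i
  · exact ⟨1, by decide, by simp [form, seed, binForm]; linarith⟩
  · refine ⟨0, by decide, ?_⟩
    have h1 : R.form 0 (R.seed 1) = R.b := by
      simp [form, seed, binForm]
      linear_combination R.b * hd
    have h2 : R.form 1 (R.seed 1) = -(2 * (R.b * R.a)) := by
      simp [form, seed, binForm]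
    show 0 < R.form 0 (R.seed 1) - R.form 1 (R.seed 1)
    rw [h1, h2]
    have : 0 < R.b * R.a := mul_pos R.b_pos (by linarith)
    linarith
  · exact ⟨1, by decide, by simp [form, seed, binForm]; linarith⟩

/-- After applying a word with first letter `h`, the form of index `h` dominates the other two by a
gap. Applying a different letter next turns this gap into one at least `lam` times larger, and the
gap bounds the length of the vector from below. -/
theorem exists_word_growth : ∃ lam δ, 1 < lam ∧ 0 < δ ∧ ∀ l : List (Fin 3), l.IsChain (· ≠ ·) →
    ∃ i, lam ^ l.length * δ ≤ vsq (R.actWord l (R.seed i)) := by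
  obtain ⟨lam, hlam, hstep⟩ := R.exists_step_constant
  have hlam0 : 0 < lam := by linarith
  choose p hp hpos using R.exists_seed_pos
  obtain ⟨δ, hδ, hδle⟩ := exists_pos_forall_le hpos
  have main : ∀ (l : List (Fin 3)) (h : Fin 3), (h :: l).IsChain (· ≠ ·) → ∃ i, ∀ k, k ≠ h →
      lam ^ (l.length + 1) * δ ≤ R.form h (R.actWord (h :: l) (R.seed i)) -
        R.form k (R.actWord (h :: l) (R.seed i)) := by
    intro l
    induction l with
    | nil =>
      intro h _
      refine ⟨h, fun k hk => ?_⟩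
      have h1 := hstep h (p h) k (hp h) hk (R.seed h) (hpos h)
      have h2 := mul_le_mul_of_nonneg_left (hδle h) hlam0.le
      simp only [actWord, List.length_nil, zero_add, pow_one]
      linarith
    | cons j l ih =>
      intro h hch
      rw [List.isChain_cons_cons] at hch
      obtain ⟨i, hi⟩ := ih j hch.2
      refine ⟨i, fun k hk => ?_⟩
      have h0 := hi h hch.1
      have hpos' : 0 < lam ^ (l.length + 1) * δ := by positivity
      have h1 := hstep h j k hch.1.symm hk _ (lt_of_lt_of_le hpos' h0)
      have h2 := mul_le_mul_of_nonneg_left h0 hlam0.le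
      rw [show R.actWord (h :: j :: l) (R.seed i) = R.act h (R.actWord (j :: l) (R.seed i)) from rfl]
      calc _ = lam * (lam ^ (l.length + 1) * δ) := by rw [List.length_cons]; ring
        _ ≤ _ := h2.trans h1
  obtain ⟨S, hS, hSle⟩ : ∃ S, 0 < S ∧ ∀ (h k : Fin 3) v, R.form h v - R.form k v ≤ S * vsq v := by
    have h1 : ∀ t : Fin 3 × Fin 3, ∃ K, 0 < K ∧
        ∀ v, R.form t.1 v - R.form t.2 v ≤ K * vsq v := by
      have sub : ∀ α β γ α' β' γ' : ℝ, ∃ K, 0 < K ∧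
          ∀ v, binForm α β γ v - binForm α' β' γ' v ≤ K * vsq v := by
        intro α β γ α' β' γ'
        obtain ⟨K, hK, h⟩ := binForm_le (α - α') (β - β') (γ - γ')
        refine ⟨K, hK, fun v => ?_⟩
        have := h v
        unfold binForm at this ⊢
        linarith
      rintro ⟨h, k⟩
      fin_cases h <;> fin_cases k <;> exact sub _ _ _ _ _ _
    choose K hK hKv using h1
    refine ⟨∑ t, K t, Finset.sum_pos (fun t _ => hK t) Finset.univ_nonempty, fun h k v => ?_⟩
    refine (hKv (h, k) v).trans ?_
    have := vsq_nonneg v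
    gcongr
    exact Finset.single_le_sum (fun t _ => (hK t).le) (Finset.mem_univ (h, k))
  obtain ⟨m, hm, hmle⟩ := exists_pos_forall_le (f := fun i => vsq (R.seed i)) (fun i => by
    have := R.b_pos
    apply vsq_pos
    apply plane_ne_zero
    left
    unfold seed
    split_ifs
    · simpa using this.ne'
    · simp)
  refine ⟨lam, min (δ / S) m, hlam, lt_min (by positivity) hm, fun l hl => ?_⟩
  cases l with
  | nil =>
    refine ⟨0, ?_⟩
    simp only [actWord, List.length_nil, pow_zero, one_mul]
    exact (min_le_right _ _).trans (hmle 0)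
  | cons h l =>
    obtain ⟨i, hi⟩ := main l h hl
    obtain ⟨k, hk⟩ := exists_ne h
    refine ⟨i, ?_⟩
    have h1 := (hi k hk).trans (hSle h k _)
    rw [List.length_cons]
    calc _ ≤ lam ^ (l.length + 1) * (δ / S) := by gcongr; exact min_le_left _ _
      _ = lam ^ (l.length + 1) * δ / S := by ring
      _ ≤ _ := by rw [div_le_iff₀ hS]; linarith

end Reflections

/-! ### Growth of the free group generated by a pair -/

/-- The homomorphism from the free group on two generators given by a pair. -/
def pairHom (p : SL2R × SL2R) : FreeGroup Bool →* SL2R :=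
  FreeGroup.lift fun b => if b then p.1 else p.2

@[simp] theorem pairHom_true (p : SL2R × SL2R) : pairHom p (FreeGroup.of true) = p.1 := by
  simp [pairHom]

@[simp] theorem pairHom_false (p : SL2R × SL2R) : pairHom p (FreeGroup.of false) = p.2 := by
  simp [pairHom]

theorem pairHom_mk_cons (p : SL2R × SL2R) (x : Bool × Bool) (L : List (Bool × Bool)) :
    pairHom p (FreeGroup.mk (x :: L)) =
      cond x.2 (if x.1 then p.1 else p.2) (if x.1 then p.1 else p.2)⁻¹ *
        pairHom p (FreeGroup.mk L) := by
  simp [pairHom]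

/-- The norms of the elements of the group generated by a pair grow exponentially in the word
length. -/
def GroupGrowth (p : SL2R × SL2R) : Prop :=
  ∃ c ρ : ℝ, 0 < c ∧ 0 < ρ ∧ ρ < 1 ∧ ∀ w : FreeGroup Bool, c ≤ nsq (pairHom p w) * ρ ^ w.norm

/-- The reflections attached to a pair in free form. -/
def IsFreeForm.reflections {A B : SL2R} (h : IsFreeForm A B) : Reflections where
  a := A 0 0
  b := A 0 1
  c := A 1 0
  e := B 0 0
  f := -B 0 1
  g := -B 1 0
  a_gt := h.a_pos
  e_gt := h.e_pos
  b_pos := h.b_pos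
  c_pos := h.c_pos
  f_pos := by linarith [h.f_neg]
  g_pos := by linarith [h.g_neg]
  detA := by have := det_entries A; rw [h.diagA] at this; linarith
  detB := by have := det_entries B; rw [h.diagB] at this; linarith
  gram_gt := by linarith [h.tr_lt]

namespace IsFreeForm

variable {A B : SL2R} (h : IsFreeForm A B)

theorem smul_A (v : Fin 2 → ℝ) : A • v = -h.reflections.act 0 (h.reflections.act 1 v) := by
  apply plane_ext <;>
    simp only [smul_entry, Reflections.act, reflections, Pi.neg_apply, Matrix.cons_val_zero,
      Matrix.cons_val_one, h.diagA] <;> ring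

theorem smul_A_inv (v : Fin 2 → ℝ) : A⁻¹ • v = -h.reflections.act 1 (h.reflections.act 0 v) := by
  apply plane_ext <;>
    simp only [smul_entry, Reflections.act, reflections, Pi.neg_apply, Matrix.cons_val_zero,
      Matrix.cons_val_one, inv_entry00, inv_entry01, inv_entry10, inv_entry11, h.diagA] <;> ring

theorem smul_B (v : Fin 2 → ℝ) : B • v = -h.reflections.act 1 (h.reflections.act 2 v) := by
  apply plane_ext <;>
    simp only [smul_entry, Reflections.act, reflections, Pi.neg_apply, Matrix.cons_val_zero,
      Matrix.cons_val_one, h.diagB] <;> ring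

theorem smul_B_inv (v : Fin 2 → ℝ) : B⁻¹ • v = -h.reflections.act 2 (h.reflections.act 1 v) := by
  apply plane_ext <;>
    simp only [smul_entry, Reflections.act, reflections, Pi.neg_apply, Matrix.cons_val_zero,
      Matrix.cons_val_one, inv_entry00, inv_entry01, inv_entry10, inv_entry11, h.diagB] <;> ring

/-- The shape of the reflection word `r` attached to the reduced word `L`. -/
def WordShape : List (Bool × Bool) → List (Fin 3) → Prop
  | [], r => r = []
  | (true, true) :: _, r => ∃ t, r = 0 :: t
  | (true, false) :: L, r => (∃ t, r = 1 :: 0 :: t) ∧ L.length + 2 ≤ r.length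
  | (false, true) :: L, r => (∃ t, r = 1 :: 2 :: t) ∧ L.length + 2 ≤ r.length
  | (false, false) :: _, r => ∃ t, r = 2 :: t

/-- Substitute `A = -R₀R₁` and `B = -R₁R₂`. In a reduced word the only cancellations come from `A B`
and `B⁻¹ A⁻¹`, where two middle reflections meet. Each costs two letters, so the induction records
through `WordShape` that words starting with `B` or `A⁻¹` have a spare letter. -/
theorem exists_reflection_word (L : List (Bool × Bool)) (hL : FreeGroup.IsReduced L) :
    ∃ r : List (Fin 3), r.IsChain (· ≠ ·) ∧ L.length ≤ r.length ∧ WordShape L r ∧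
      ∀ v, pairHom (A, B) (FreeGroup.mk L) • v = h.reflections.actWord r v ∨
        pairHom (A, B) (FreeGroup.mk L) • v = -h.reflections.actWord r v := by
  induction L with
  | nil =>
    refine ⟨[], by simp, by simp, rfl, fun v => Or.inl ?_⟩
    simp [Reflections.actWord, ← FreeGroup.one_eq_mk]
  | cons x L ih =>
    have hL' : FreeGroup.IsReduced L := hL.infix (List.suffix_cons x L).isInfix
    obtain ⟨r, hch, hlen, hshape, hr⟩ := ih hL'
    have sign : ∀ (C : SL2R) (i j : Fin 3),
        (∀ v, C • v = -h.reflections.act i (h.reflections.act j v)) → ∀ v,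
        (C * pairHom (A, B) (FreeGroup.mk L)) • v = h.reflections.actWord (i :: j :: r) v ∨
        (C * pairHom (A, B) (FreeGroup.mk L)) • v = -h.reflections.actWord (i :: j :: r) v := by
      intro C i j hC v
      rw [mul_smul, hC]
      simp only [Reflections.actWord]
      rcases hr v with e | e
      · right; rw [e]
      · left; rw [e, Reflections.act_neg, Reflections.act_neg, neg_neg]
    have cancel : ∀ (i j : Fin 3) (t : List (Fin 3)) (v : Fin 2 → ℝ),
        h.reflections.actWord (i :: j :: j :: t) v = h.reflections.actWord (i :: t) v := by
      intro i j t v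
      simp only [Reflections.actWord, Reflections.act_act]
    simp only [pairHom_mk_cons]
    rcases x with ⟨x1, x2⟩
    cases L with
    | nil =>
      simp only [WordShape] at hshape
      subst hshape
      cases x1 <;> cases x2
      · exact ⟨[2, 1], by simp, by simp, ⟨_, rfl⟩, sign _ 2 1 h.smul_B_inv⟩
      · exact ⟨[1, 2], by simp, by simp, ⟨⟨_, rfl⟩, by simp⟩, sign _ 1 2 h.smul_B⟩
      · exact ⟨[1, 0], by simp, by simp, ⟨⟨_, rfl⟩, by simp⟩, sign _ 1 0 h.smul_A_inv⟩
      · exact ⟨[0, 1], by simp, by simp, ⟨_, rfl⟩, sign _ 0 1 h.smul_A⟩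
    | cons y L =>
      rw [FreeGroup.isReduced_cons_cons] at hL
      obtain ⟨y1, y2⟩ := y
      have hxy := hL.1
      cases x1 <;> cases x2 <;> cases y1 <;> cases y2 <;> simp at hxy <;>
        simp only [WordShape] at hshape
      · obtain ⟨t, rfl⟩ := hshape
        exact ⟨2 :: 1 :: 2 :: t, by simpa using hch, by simp at hlen ⊢; omega, ⟨_, rfl⟩,
          sign _ 2 1 h.smul_B_inv⟩
      · obtain ⟨⟨t, rfl⟩, hl⟩ := hshape
        refine ⟨2 :: 0 :: t, ?_, by simp at hl ⊢; omega, ⟨_, rfl⟩, fun v => ?_⟩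
        · rw [List.isChain_cons_cons] at hch ⊢
          exact ⟨by decide, hch.2⟩
        · rw [← cancel 2 1]; exact sign _ 2 1 h.smul_B_inv v
      · obtain ⟨t, rfl⟩ := hshape
        exact ⟨2 :: 1 :: 0 :: t, by simpa using hch, by simp at hlen ⊢; omega, ⟨_, rfl⟩,
          sign _ 2 1 h.smul_B_inv⟩
      · obtain ⟨⟨t, rfl⟩, hl⟩ := hshape
        exact ⟨1 :: 2 :: 1 :: 2 :: t, by simpa using hch, by simp at hl ⊢; omega,
          ⟨⟨_, rfl⟩, by simp at hl ⊢; omega⟩, sign _ 1 2 h.smul_B⟩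
      · obtain ⟨⟨t, rfl⟩, hl⟩ := hshape
        exact ⟨1 :: 2 :: 1 :: 0 :: t, by simpa using hch, by simp at hl ⊢; omega,
          ⟨⟨_, rfl⟩, by simp at hl ⊢; omega⟩, sign _ 1 2 h.smul_B⟩
      · obtain ⟨t, rfl⟩ := hshape
        exact ⟨1 :: 2 :: 0 :: t, by simpa using hch, by simp at hlen ⊢; omega,
          ⟨⟨_, rfl⟩, by simp at hlen ⊢; omega⟩, sign _ 1 2 h.smul_B⟩
      · obtain ⟨t, rfl⟩ := hshape
        exact ⟨1 :: 0 :: 2 :: t, by simpa using hch, by simp at hlen ⊢; omega,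
          ⟨⟨_, rfl⟩, by simp at hlen ⊢; omega⟩, sign _ 1 0 h.smul_A_inv⟩
      · obtain ⟨⟨t, rfl⟩, hl⟩ := hshape
        exact ⟨1 :: 0 :: 1 :: 2 :: t, by simpa using hch, by simp at hl ⊢; omega,
          ⟨⟨_, rfl⟩, by simp at hl ⊢; omega⟩, sign _ 1 0 h.smul_A_inv⟩
      · obtain ⟨⟨t, rfl⟩, hl⟩ := hshape
        exact ⟨1 :: 0 :: 1 :: 0 :: t, by simpa using hch, by simp at hl ⊢; omega,
          ⟨⟨_, rfl⟩, by simp at hl ⊢; omega⟩, sign _ 1 0 h.smul_A_inv⟩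
      · obtain ⟨t, rfl⟩ := hshape
        exact ⟨0 :: 1 :: 2 :: t, by simpa using hch, by simp at hlen ⊢; omega, ⟨_, rfl⟩,
          sign _ 0 1 h.smul_A⟩
      · obtain ⟨⟨t, rfl⟩, hl⟩ := hshape
        refine ⟨0 :: 2 :: t, ?_, by simp at hl ⊢; omega, ⟨_, rfl⟩, fun v => ?_⟩
        · rw [List.isChain_cons_cons] at hch ⊢
          exact ⟨by decide, hch.2⟩
        · rw [← cancel 0 1]; exact sign _ 0 1 h.smul_A v
      · obtain ⟨t, rfl⟩ := hshape
        exact ⟨0 :: 1 :: 0 :: t, by simpa using hch, by simp at hlen ⊢; omega, ⟨_, rfl⟩,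
          sign _ 0 1 h.smul_A⟩

theorem groupGrowth {A B : SL2R} (h : IsFreeForm A B) : GroupGrowth (A, B) := by
  obtain ⟨lam, δ, hlam, hδ, hgr⟩ := h.reflections.exists_word_growth
  set S := ∑ i, vsq (h.reflections.seed i) with hS
  have hSle : ∀ i, vsq (h.reflections.seed i) ≤ S := fun i =>
    Finset.single_le_sum (fun i _ => vsq_nonneg _) (Finset.mem_univ i)
  have hlam0 : 0 < lam := by linarith
  have hSpos : 0 < S + 1 := by
    have := hSle 0
    have := vsq_nonneg (h.reflections.seed 0)
    linarith
  refine ⟨δ / (S + 1), lam⁻¹, by positivity, by positivity, inv_lt_one_of_one_lt₀ hlam,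
    fun w => ?_⟩
  obtain ⟨r, hch, hlen, -, hr⟩ := h.exists_reflection_word w.toWord FreeGroup.isReduced_toWord
  rw [FreeGroup.mk_toWord] at hr
  obtain ⟨i, hi⟩ := hgr r hch
  have e1 : vsq (pairHom (A, B) w • h.reflections.seed i) =
      vsq (h.reflections.actWord r (h.reflections.seed i)) := by
    rcases hr (h.reflections.seed i) with e | e
    · rw [e]
    · rw [e]; simp [vsq]
  have e2 := vsq_smul_le (pairHom (A, B) w) (h.reflections.seed i)
  have e3 := nsq_pos (pairHom (A, B) w)
  have e4 : lam ^ w.norm ≤ lam ^ r.length := pow_le_pow_right₀ hlam.le hlen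
  have e5 : lam ^ w.norm * δ ≤ nsq (pairHom (A, B) w) * (S + 1) := by
    calc _ ≤ lam ^ r.length * δ := by gcongr
      _ ≤ _ := hi
      _ = _ := e1.symm
      _ ≤ _ := e2
      _ ≤ _ := by
        gcongr
        linarith [hSle i]
  rw [inv_pow, div_le_iff₀ hSpos, mul_right_comm, ← div_eq_mul_inv, le_div_iff₀ (by positivity)]
  linarith

end IsFreeForm

/-! ### Growth under conjugation, changes of sign and automorphisms. -/

theorem pairHom_conj (g : SL2R) (p : SL2R × SL2R) (w : FreeGroup Bool) :
    pairHom (g⁻¹ * p.1 * g, g⁻¹ * p.2 * g) w = g⁻¹ * pairHom p w * g := by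
  induction w using FreeGroup.induction_on with
  | C1 => simp
  | of b => cases b <;> simp
  | inv_of b ih => rw [map_inv, map_inv, ih]; group
  | mul x y hx hy => rw [map_mul, map_mul, hx, hy]; group

theorem GroupGrowth.of_conj {A B : SL2R} (g : SL2R)
    (h : GroupGrowth (g⁻¹ * A * g, g⁻¹ * B * g)) : GroupGrowth (A, B) := by
  obtain ⟨c, ρ, hc, hρ0, hρ1, hG⟩ := h
  have hg := nsq_pos g
  refine ⟨c / (nsq g * nsq g), ρ, by positivity, hρ0, hρ1, fun w => ?_⟩
  have h1 := hG w
  rw [pairHom_conj g (A, B)] at h1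
  have h2 : nsq (g⁻¹ * pairHom (A, B) w * g) ≤ nsq g * nsq (pairHom (A, B) w) * nsq g := by
    have k1 := nsq_mul_le (g⁻¹ * pairHom (A, B) w) g
    have k2 := nsq_mul_le g⁻¹ (pairHom (A, B) w)
    rw [nsq_inv] at k2
    exact k1.trans (by gcongr)
  rw [div_le_iff₀ (by positivity)]
  have h3 : 0 < ρ ^ w.norm := by positivity
  nlinarith

theorem pairHom_flipSign (s : Bool × Bool) (p : SL2R × SL2R) (w : FreeGroup Bool) :
    pairHom (flipSign s p) w = pairHom p w ∨ pairHom (flipSign s p) w = -pairHom p w := by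
  induction w using FreeGroup.induction_on with
  | C1 => simp
  | of b =>
    obtain ⟨s1, s2⟩ := s
    cases b <;> cases s1 <;> cases s2 <;> simp [flipSign]
  | inv_of b ih =>
    rw [map_inv, map_inv]
    rcases ih with ih | ih
    · left; rw [ih]
    · right
      rw [ih, inv_eq_iff_mul_eq_one]
      simp
  | mul x y hx hy =>
    rw [map_mul, map_mul]
    rcases hx with hx | hx <;> rcases hy with hy | hy <;> rw [hx, hy] <;> simp

theorem GroupGrowth.of_flipSign {s : Bool × Bool} {p : SL2R × SL2R}
    (h : GroupGrowth (flipSign s p)) : GroupGrowth p := by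
  obtain ⟨c, ρ, hc, hρ0, hρ1, hG⟩ := h
  refine ⟨c, ρ, hc, hρ0, hρ1, fun w => ?_⟩
  have h1 := hG w
  rcases pairHom_flipSign s p w with e | e
  · rwa [e] at h1
  · rwa [e, nsq_neg] at h1

theorem freeSet_groupGrowth {p : SL2R × SL2R} (hp : p ∈ freeSet) : GroupGrowth p := by
  obtain ⟨s, g, h⟩ := exists_flipSign_isFreeForm hp
  exact GroupGrowth.of_flipSign (s := s) (GroupGrowth.of_conj g h.groupGrowth)

theorem norm_map_le {k : ℕ} {φ : FreeGroup Bool →* FreeGroup Bool}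
    (hφ : ∀ b, (φ (FreeGroup.of b)).norm ≤ k) (w : FreeGroup Bool) :
    (φ w).norm ≤ k * w.norm := by
  have main : ∀ L : List (Bool × Bool), (φ (FreeGroup.mk L)).norm ≤ k * L.length := by
    intro L
    induction L with
    | nil => simp [← FreeGroup.one_eq_mk]
    | cons x L ih =>
      have e : (FreeGroup.mk (x :: L) : FreeGroup Bool) = FreeGroup.mk [x] * FreeGroup.mk L := by
        simp
      have hx : (φ (FreeGroup.mk [x])).norm ≤ k := by
        obtain ⟨b, s⟩ := x
        cases s
        · have : (FreeGroup.mk [(b, false)] : FreeGroup Bool) = (FreeGroup.of b)⁻¹ := by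
            simp [FreeGroup.of, FreeGroup.invRev]
          rw [this, map_inv, FreeGroup.norm_inv_eq]
          exact hφ b
        · exact hφ b
      rw [e, map_mul, List.length_cons, mul_add, mul_one, add_comm]
      exact (FreeGroup.norm_mul_le _ _).trans (add_le_add hx ih)
  have := main w.toWord
  rwa [FreeGroup.mk_toWord] at this

/-- As `ψ` inverts `φ` and at most doubles word length, `φ` shortens words at most by half; the rate
`√ρ` absorbs this. -/
theorem GroupGrowth.of_automorphism {p q : SL2R × SL2R} {φ ψ : FreeGroup Bool →* FreeGroup Bool}
    (hφ : ∀ w, pairHom p w = pairHom q (φ w)) (hψ : ∀ b, (ψ (FreeGroup.of b)).norm ≤ 2)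
    (hψφ : ∀ w, ψ (φ w) = w) (h : GroupGrowth q) : GroupGrowth p := by
  obtain ⟨c, ρ, hc, hρ0, hρ1, hG⟩ := h
  have hs1 : √ρ < 1 := by rw [Real.sqrt_lt' one_pos]; simpa using hρ1
  refine ⟨c, √ρ, hc, by positivity, hs1, fun w => ?_⟩
  have h1 := hG (φ w)
  rw [← hφ] at h1
  have h2 := norm_map_le hψ (φ w)
  rw [hψφ] at h2
  have h3 : ρ ^ (φ w).norm ≤ √ρ ^ w.norm := by
    calc ρ ^ (φ w).norm = √ρ ^ (2 * (φ w).norm) := by rw [pow_mul, Real.sq_sqrt hρ0.le]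
      _ ≤ √ρ ^ w.norm := pow_le_pow_of_le_one (Real.sqrt_nonneg _) hs1.le h2
  have := nsq_pos (pairHom p w)
  calc c ≤ _ := h1
    _ ≤ _ := by gcongr

theorem GroupGrowth.of_Fplus {p : SL2R × SL2R} (h : GroupGrowth (Fplus p)) : GroupGrowth p := by
  refine GroupGrowth.of_automorphism
    (φ := FreeGroup.lift fun b => if b then FreeGroup.of true
      else (FreeGroup.of true)⁻¹ * FreeGroup.of false)
    (ψ := FreeGroup.lift fun b => if b then FreeGroup.of true
      else FreeGroup.of true * FreeGroup.of false) (fun w => ?_) (fun b => ?_) (fun w => ?_) h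
  · rw [← MonoidHom.comp_apply]
    congr 1
    apply FreeGroup.ext_hom
    intro b
    cases b <;> simp [Fplus]
  · cases b
    · simpa using FreeGroup.norm_mul_le (FreeGroup.of true) (FreeGroup.of false)
    · simp
  · rw [← MonoidHom.comp_apply, ← MonoidHom.id_apply (FreeGroup Bool) w]
    congr 1
    apply FreeGroup.ext_hom
    intro b
    cases b <;> simp

theorem GroupGrowth.of_Fminus {p : SL2R × SL2R} (h : GroupGrowth (Fminus p)) : GroupGrowth p := by
  refine GroupGrowth.of_automorphism
    (φ := FreeGroup.lift fun b => if b then (FreeGroup.of false)⁻¹ * FreeGroup.of true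
      else FreeGroup.of false)
    (ψ := FreeGroup.lift fun b => if b then FreeGroup.of false * FreeGroup.of true
      else FreeGroup.of false) (fun w => ?_) (fun b => ?_) (fun w => ?_) h
  · rw [← MonoidHom.comp_apply]
    congr 1
    apply FreeGroup.ext_hom
    intro b
    cases b <;> simp [Fminus]
  · cases b
    · simp
    · simpa using FreeGroup.norm_mul_le (FreeGroup.of false) (FreeGroup.of true)
  · rw [← MonoidHom.comp_apply, ← MonoidHom.id_apply (FreeGroup Bool) w]
    congr 1
    apply FreeGroup.ext_hom
    intro b
    cases b <;> simp

theorem groupGrowth_of_wordMap {l : List Bool} {p : SL2R × SL2R} (h : wordMap l p ∈ freeSet) :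
    GroupGrowth p := by
  induction l generalizing p with
  | nil => exact freeSet_groupGrowth h
  | cons b l ih =>
    cases b
    · exact GroupGrowth.of_Fminus (ih (p := Fminus p) h)
    · exact GroupGrowth.of_Fplus (ih (p := Fplus p) h)

/-- The homomorphism to the integers sending both generators to 1 is bounded above by word length,
so a product of `n` generators without inverses cannot be shortened. -/
theorem exists_positive_word (p : SL2R × SL2R) (x : FullShift 2) (n : ℕ) :
    ∃ w : FreeGroup Bool, pairHom p w = forwardProd ![p.1, p.2] x n ∧ n ≤ w.norm := by
  let deg : FreeGroup Bool →* Multiplicative ℤ := FreeGroup.lift fun _ => Multiplicative.ofAdd 1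
  have hdeg : ∀ L : List (Bool × Bool), Multiplicative.toAdd (deg (FreeGroup.mk L)) ≤ L.length := by
    intro L
    induction L with
    | nil => simp [← FreeGroup.one_eq_mk]
    | cons y L ih =>
      have e : (FreeGroup.mk (y :: L) : FreeGroup Bool) = FreeGroup.mk [y] * FreeGroup.mk L := by
        simp
      have hy : Multiplicative.toAdd (deg (FreeGroup.mk [y])) ≤ 1 := by
        obtain ⟨b, s⟩ := y
        cases s <;> simp [deg]
      rw [e, map_mul, toAdd_mul, List.length_cons]
      push_cast
      linarith
  suffices h : ∃ w : FreeGroup Bool, pairHom p w = forwardProd ![p.1, p.2] x n ∧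
      Multiplicative.toAdd (deg w) = n by
    obtain ⟨w, h1, h2⟩ := h
    refine ⟨w, h1, ?_⟩
    have h3 := hdeg w.toWord
    rw [FreeGroup.mk_toWord, h2] at h3
    exact_mod_cast h3
  induction n with
  | zero => exact ⟨1, by simp [forwardProd], by simp⟩
  | succ n ih =>
    obtain ⟨w, h1, h2⟩ := ih
    refine ⟨FreeGroup.of (decide (x n = 0)) * w, ?_, ?_⟩
    · rw [map_mul, h1, forwardProd]
      congr 1
      generalize x n = i
      fin_cases i <;> simp
    · rw [map_mul, toAdd_mul, h2]
      simp [deg]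
      ring

theorem GroupGrowth.mem_hyperbolicLocus {p : SL2R × SL2R} (h : GroupGrowth p) :
    p ∈ hyperbolicLocus := by
  obtain ⟨c, ρ, hc, hρ0, hρ1, hG⟩ := h
  refine isUniformlyHyperbolic_of_growth hc hρ0 hρ1 fun x n => ?_
  obtain ⟨w, h1, h2⟩ := exists_positive_word p x n
  have h3 := hG w
  rw [h1] at h3
  have h4 : ρ ^ w.norm ≤ ρ ^ n := pow_le_pow_of_le_one hρ0.le hρ1.le h2
  have := nsq_pos (forwardProd ![p.1, p.2] x n)
  calc c ≤ _ := h3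
    _ ≤ _ := by gcongr

/-- On a vector with positive coordinates, a positive matrix multiplies the product of the
coordinates at least by `A₀₀A₁₁ + A₀₁A₁₀ = 1 + 2 A₀₁A₁₀`. -/
theorem growth_of_posMat {A : Fin 2 → SL2R} (hA : ∀ i, A i ∈ posMat) :
    ∃ ρ : ℝ, 0 < ρ ∧ ρ < 1 ∧ ∀ x n, 1 ≤ nsq (forwardProd A x n) * ρ ^ n := by
  obtain ⟨ε, hε, hle⟩ := exists_pos_forall_le (f := fun i => A i 0 1 * A i 1 0)
    fun i => mul_pos (hA i).2.1 (hA i).2.2.1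
  have h1ε : 0 < 1 + 2 * ε := by linarith
  refine ⟨(1 + 2 * ε)⁻¹, by positivity, inv_lt_one_of_one_lt₀ (by linarith), fun x n => ?_⟩
  have main : ∀ n, 0 < (forwardProd A x n • (![1, 1] : Fin 2 → ℝ)) 0 ∧ 0 < (forwardProd A x n • (![1, 1] : Fin 2 → ℝ)) 1 ∧
      (1 + 2 * ε) ^ n ≤ (forwardProd A x n • (![1, 1] : Fin 2 → ℝ)) 0 * (forwardProd A x n • (![1, 1] : Fin 2 → ℝ)) 1 := by
    intro n
    induction n with
    | zero => simp [forwardProd]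
    | succ n ih =>
      obtain ⟨h0, h1, h2⟩ := ih
      rw [forwardProd, mul_smul]
      set v := forwardProd A x n • (![1, 1] : Fin 2 → ℝ)
      obtain ⟨a0, a1, a2, a3⟩ := hA (x n)
      have hd := det_entries (A (x n))
      have hl : ε ≤ A (x n) 0 1 * A (x n) 1 0 := hle (x n)
      simp only [smul_entry]
      refine ⟨by positivity, by positivity, ?_⟩
      have hq : 0 < v 0 * v 1 := mul_pos h0 h1
      have e1 : 0 ≤ A (x n) 0 0 * A (x n) 1 0 * v 0 ^ 2 := by positivity
      have e2 : 0 ≤ A (x n) 0 1 * A (x n) 1 1 * v 1 ^ 2 := by positivity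
      calc (1 + 2 * ε) ^ (n + 1) = (1 + 2 * ε) ^ n * (1 + 2 * ε) := pow_succ _ _
        _ ≤ v 0 * v 1 * (1 + 2 * (A (x n) 0 1 * A (x n) 1 0)) := by
          gcongr
        _ ≤ _ := by
          have : v 0 * v 1 * (1 + 2 * (A (x n) 0 1 * A (x n) 1 0)) =
            (A (x n) 0 0 * A (x n) 1 1 + A (x n) 0 1 * A (x n) 1 0) * (v 0 * v 1) := by
              linear_combination (-(v 0 * v 1)) * hd
          rw [this]
          linarith
  obtain ⟨h0, h1, h2⟩ := main n
  have h3 := vsq_smul_le (forwardProd A x n) (![1, 1] : Fin 2 → ℝ)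
  have h4 : vsq (![1, 1] : Fin 2 → ℝ) = 2 := by simp [vsq]; norm_num
  rw [h4] at h3
  have h5 : 2 * ((forwardProd A x n • (![1, 1] : Fin 2 → ℝ)) 0 * (forwardProd A x n • (![1, 1] : Fin 2 → ℝ)) 1) ≤
      vsq (forwardProd A x n • (![1, 1] : Fin 2 → ℝ)) := by
    unfold vsq
    nlinarith [sq_nonneg ((forwardProd A x n • (![1, 1] : Fin 2 → ℝ)) 0 - (forwardProd A x n • (![1, 1] : Fin 2 → ℝ)) 1)]
  rw [inv_pow, ← div_eq_mul_inv, le_div_iff₀ (by positivity)]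
  linarith

theorem forwardProd_of_conj_sign {N : ℕ} {A A' : Fin N → SL2R} {g : SL2R}
    (h : ∀ i, A' i = g⁻¹ * A i * g ∨ A' i = -(g⁻¹ * A i * g)) (x : FullShift N) (n : ℕ) :
    forwardProd A' x n = g⁻¹ * forwardProd A x n * g ∨
      forwardProd A' x n = -(g⁻¹ * forwardProd A x n * g) := by
  induction n with
  | zero => left; simp [forwardProd]
  | succ n ih =>
    have e : (g⁻¹ * A (x n) * g) * (g⁻¹ * forwardProd A x n * g) =
        g⁻¹ * (A (x n) * forwardProd A x n) * g := conj_inv_mul _ _ _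
    simp only [forwardProd]
    rcases h (x n) with h | h <;> rcases ih with ih | ih <;> rw [h, ih] <;>
      simp only [neg_mul, mul_neg, neg_neg, e, true_or, or_true]

theorem principalSet_subset_hyperbolicLocus (s : Bool × Bool) :
    principalSet s ⊆ hyperbolicLocus := by
  rintro p ⟨g, h1, h2⟩
  set A' : Fin 2 → SL2R := ![g⁻¹ * (flipSign s p).1 * g, g⁻¹ * (flipSign s p).2 * g] with hA'
  obtain ⟨ρ, hρ0, hρ1, hG⟩ := growth_of_posMat (A := A') (by
    intro i
    fin_cases i
    · exact h1
    · exact h2)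
  have hg := nsq_pos g
  refine isUniformlyHyperbolic_of_growth (c := 1 / (nsq g * nsq g)) (by positivity) hρ0 hρ1
    fun x n => ?_
  have h3 := hG x n
  have h4 := forwardProd_of_conj_sign (A := ![p.1, p.2]) (A' := A') (g := g) (by
    intro i
    obtain ⟨s1, s2⟩ := s
    fin_cases i <;> cases s1 <;> cases s2 <;> simp [hA', flipSign]) x n
  have h5 : nsq (forwardProd A' x n) = nsq (g⁻¹ * forwardProd ![p.1, p.2] x n * g) := by
    rcases h4 with h4 | h4
    · rw [h4]
    · rw [h4, nsq_neg]
  have h6 : nsq (g⁻¹ * forwardProd ![p.1, p.2] x n * g) ≤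
      nsq g * nsq (forwardProd ![p.1, p.2] x n) * nsq g := by
    have k1 := nsq_mul_le (g⁻¹ * forwardProd ![p.1, p.2] x n) g
    have k2 := nsq_mul_le g⁻¹ (forwardProd ![p.1, p.2] x n)
    rw [nsq_inv] at k2
    exact k1.trans (by gcongr)
  rw [div_le_iff₀ (by positivity)]
  have h7 : 0 < ρ ^ n := by positivity
  rw [h5] at h3
  nlinarith

theorem wordMap_preimage_subset_hyperbolicLocus {l : List Bool} {p : SL2R × SL2R}
    (h : wordMap l p ∈ freeSet) : p ∈ hyperbolicLocus :=
  (groupGrowth_of_wordMap h).mem_hyperbolicLocus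

/-- Every uniformly hyperbolic pair is principal or sent to `freeSet` by the monoid. -/
theorem mem_principalSet_or_of_mem_hyperbolicLocus {p : SL2R × SL2R} (hp : p ∈ hyperbolicLocus) :
    (∃ s, p ∈ principalSet s) ∨ ∃ l, wordMap l p ∈ freeSet := by
  obtain ⟨η, hη, htr⟩ := exists_trace_bound hp
  by_cases h : ∃ s, p ∈ principalSet s
  · exact Or.inl h
  · push Not at h
    right
    have hx := htr p.1 (Subsemigroup.subset_closure (by simp))
    have hy := htr p.2 (Subsemigroup.subset_closure (by simp))
    exact exists_wordMap_mem_freeSet hη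
      (weaklyTwisted_of_notMem_principalSet (by linarith) (by linarith) h) htr

/-! ### Strictly invariant open subsets of the projective line -/

/-- `M` is an open, nonempty, nondense subset of the projective line, sent by `g` to a subset
whose closure is contained in `M`. -/
structure StrictlyInvariant (g : SL2R) (M : Set P1) : Prop where
  isOpen : IsOpen M
  nonempty : M.Nonempty
  closure_ne : closure M ≠ Set.univ
  maps_into : closure ((fun q : P1 => g • q) '' M) ⊆ M

namespace StrictlyInvariant

variable {g h : SL2R} {M : Set P1}

theorem smul_mem (H : StrictlyInvariant g M) {q : P1} (hq : q ∈ M) : g • q ∈ M :=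
  H.maps_into (subset_closure ⟨q, hq, rfl⟩)

theorem neg (H : StrictlyInvariant g M) : StrictlyInvariant (-g) M := by
  refine ⟨H.isOpen, H.nonempty, H.closure_ne, ?_⟩
  simp only [P1.neg_smul]
  exact H.maps_into

theorem mul (H : StrictlyInvariant g M) (H' : StrictlyInvariant h M) :
    StrictlyInvariant (g * h) M := by
  refine ⟨H.isOpen, H.nonempty, H.closure_ne, ?_⟩
  refine (closure_mono ?_).trans H.maps_into
  rintro _ ⟨q, hq, rfl⟩
  exact ⟨h • q, H'.smul_mem hq, (mul_smul g h q).symm⟩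

theorem pow_smul_mem (H : StrictlyInvariant g M) {q : P1} (hq : q ∈ M) (n : ℕ) : g ^ n • q ∈ M := by
  induction n with
  | zero => simpa using hq
  | succ n ih => rw [pow_succ', mul_smul]; exact H.smul_mem ih

theorem pow_succ_smul_mem (H : StrictlyInvariant g M) {q : P1} (hq : q ∈ M) (n : ℕ) :
    g ^ (n + 1) • q ∈ (fun q : P1 => g • q) '' M :=
  ⟨g ^ n • q, H.pow_smul_mem hq n, by rw [pow_succ', mul_smul]⟩

end StrictlyInvariant

/-! ### Attracting and repelling directions, recurrence and strictly invariant sets. -/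

theorem tendsto_pt {ι : Type*} {l : Filter ι} {f : ι → Fin 2 → ℝ} {v : Fin 2 → ℝ} (hv : v ≠ 0)
    (hf : Tendsto f l (𝓝 v)) : Tendsto (fun i => P1.pt (f i)) l (𝓝 (P1.pt v)) :=
  (P1.continuousAt_pt hv).tendsto.comp hf

theorem exists_pt_mem_area_ne {U : Set P1} (hU : IsOpen U) (hne : U.Nonempty) {w : Fin 2 → ℝ}
    (hw : w ≠ 0) : ∃ v, v ≠ 0 ∧ P1.pt v ∈ U ∧ area v w ≠ 0 := by
  obtain ⟨q, hq⟩ := hne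
  obtain ⟨v, hv, rfl⟩ := P1.exists_pt q
  by_cases h : area v w = 0
  · have h1 : Tendsto (fun t : ℝ => v + t • ![-w 1, w 0]) (𝓝 0) (𝓝 v) := by
      have : Continuous fun t : ℝ => v + t • ![-w 1, w 0] := by fun_prop
      simpa using this.tendsto 0
    have h2 := (tendsto_pt hv h1).eventually (hU.mem_nhds hq)
    have h3 : ∀ᶠ t in 𝓝[>] (0 : ℝ), P1.pt (v + t • ![-w 1, w 0]) ∈ U :=
      h2.filter_mono nhdsWithin_le_nhds
    have h4 : ∀ᶠ t in 𝓝[>] (0 : ℝ), 0 < t := eventually_mem_nhdsWithin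
    obtain ⟨t, ht, ht0⟩ := (h3.and h4).exists
    have ha : area (v + t • ![-w 1, w 0]) w ≠ 0 := by
      have : area (v + t • ![-w 1, w 0]) w = -(t * vsq w) := by
        simp only [area, vsq, Pi.add_apply, Pi.smul_apply, smul_eq_mul, Matrix.cons_val_zero,
          Matrix.cons_val_one] at h ⊢
        linear_combination h
      rw [this]
      have := vsq_pos hw
      exact neg_ne_zero.mpr (by positivity)
    refine ⟨_, ?_, ht, ha⟩
    intro h0
    rw [h0] at ha
    simp [area] at ha
  · exact ⟨v, hv, hq, h⟩

theorem decompose {u w : Fin 2 → ℝ} (h : area u w ≠ 0) (v : Fin 2 → ℝ) :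
    v = (area v w / area u w) • u + (area u v / area u w) • w := by
  apply plane_ext
  · simp only [Pi.add_apply, Pi.smul_apply, smul_eq_mul]
    field_simp
    simp only [area]
    ring
  · simp only [Pi.add_apply, Pi.smul_apply, smul_eq_mul]
    field_simp
    simp only [area]
    ring

theorem smul_add_vec (g : SL2R) (v w : Fin 2 → ℝ) : g • (v + w) = g • v + g • w := smul_add g v w

/-- Iterates of a hyperbolic element, renormalized, converge to the expanding direction. -/
theorem tendsto_hyperbolic {g : SL2R} {u w : Fin 2 → ℝ} {μ : ℝ} (hμ : 1 < |μ|) (h : area u w ≠ 0)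
    (hu : g • u = μ • u) (hw : g • w = μ⁻¹ • w) (v : Fin 2 → ℝ) :
    Tendsto (fun n : ℕ => (μ⁻¹) ^ n • (g ^ n • v)) atTop (𝓝 ((area v w / area u w) • u)) := by
  have hμ0 : μ ≠ 0 := by rintro rfl; simp at hμ; linarith
  have e : ∀ n : ℕ, (μ⁻¹) ^ n • (g ^ n • v) = (area v w / area u w) • u +
      ((μ⁻¹ ^ 2) ^ n * (area u v / area u w)) • w := by
    intro n
    conv_lhs => rw [decompose h v]
    rw [smul_add_vec, smul_comm (g ^ n), smul_comm (g ^ n), pow_smul_of_eigenvector hu,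
      pow_smul_of_eigenvector hw, smul_add, smul_smul, smul_smul, smul_smul, smul_smul]
    congr 2
    · rw [mul_right_comm, ← mul_pow, inv_mul_cancel₀ hμ0, one_pow, one_mul]
    · rw [mul_right_comm, ← mul_pow, ← sq]
  simp only [e]
  have h1 : Tendsto (fun n : ℕ => (μ⁻¹ ^ 2) ^ n) atTop (𝓝 0) := by
    apply tendsto_pow_atTop_nhds_zero_of_lt_one (by positivity)
    rw [← sq_abs, abs_inv]
    exact pow_lt_one₀ (by positivity) (inv_lt_one_of_one_lt₀ hμ) two_ne_zero
  have h2 : Tendsto (fun n : ℕ => ((μ⁻¹ ^ 2) ^ n * (area u v / area u w)) • w) atTop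
      (𝓝 ((0 * (area u v / area u w)) • w)) := (h1.mul_const _).smul_const w
  simpa using h2.const_add ((area v w / area u w) • u)

theorem area_ne_zero_left {u w : Fin 2 → ℝ} (h : area u w ≠ 0) : u ≠ 0 := by
  rintro rfl
  simp [area] at h

theorem area_swap (u w : Fin 2 → ℝ) : area w u = -area u w := by
  unfold area; ring

theorem area_ne_zero_right {u w : Fin 2 → ℝ} (h : area u w ≠ 0) : w ≠ 0 := by
  rintro rfl
  simp [area] at h

/-- A point of the open set off the contracting direction has iterates converging to the expanding
one, so the latter lies in the closure of the image. -/
theorem StrictlyInvariant.expanding_mem {g : SL2R} {M : Set P1} (H : StrictlyInvariant g M)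
    {u w : Fin 2 → ℝ} {μ : ℝ} (hμ : 1 < |μ|) (h : area u w ≠ 0) (hu : g • u = μ • u)
    (hw : g • w = μ⁻¹ • w) : P1.pt u ∈ M := by
  have hμ0 : μ ≠ 0 := by rintro rfl; simp at hμ; linarith
  obtain ⟨v, hv, hvM, ha⟩ := exists_pt_mem_area_ne H.isOpen H.nonempty (area_ne_zero_right h)
  have hc : area v w / area u w ≠ 0 := div_ne_zero ha h
  have h1 := tendsto_pt (smul_ne_zero hc (area_ne_zero_left h)) (tendsto_hyperbolic hμ h hu hw v)
  rw [P1.pt_smul hc] at h1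
  apply H.maps_into
  refine mem_closure_of_tendsto (h1.comp (tendsto_add_atTop_nat 1)) (Eventually.of_forall ?_)
  intro n
  simp only [Function.comp]
  rw [P1.pt_smul (pow_ne_zero _ (inv_ne_zero hμ0)), ← P1.smul_pt _ hv]
  exact H.pow_succ_smul_mem hvM n

/-- The complement is closed and invariant under `g⁻¹`, so it contains limits of backward orbits.
The scalars `a n` renormalize the vectors without affecting their lines. -/
theorem StrictlyInvariant.notMem_of_tendsto {g : SL2R} {M : Set P1} (H : StrictlyInvariant g M)
    {v w : Fin 2 → ℝ} (hv : v ≠ 0) (hw : w ≠ 0) (hvM : P1.pt v ∉ M) {a : ℕ → ℝ}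
    (ha : ∀ᶠ n in atTop, a n ≠ 0)
    (hlim : Tendsto (fun n : ℕ => a n • ((g⁻¹) ^ n • v)) atTop (𝓝 w)) : P1.pt w ∉ M := by
  intro hwM
  have h1 := (tendsto_pt hw hlim).eventually (H.isOpen.mem_nhds hwM)
  obtain ⟨n, hn, hn0⟩ := (h1.and ha).exists
  rw [P1.pt_smul hn0, ← P1.smul_pt _ hv] at hn
  apply hvM
  have := H.pow_smul_mem hn n
  rwa [inv_pow, smul_inv_smul] at this

theorem StrictlyInvariant.exists_notMem {g : SL2R} {M : Set P1} (H : StrictlyInvariant g M)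
    {w : Fin 2 → ℝ} (hw : w ≠ 0) : ∃ v, v ≠ 0 ∧ P1.pt v ∉ M ∧ area v w ≠ 0 := by
  have hne : ((closure M)ᶜ).Nonempty := by
    rw [Set.nonempty_compl]
    exact H.closure_ne
  obtain ⟨v, hv, hvM, ha⟩ := exists_pt_mem_area_ne isClosed_closure.isOpen_compl hne hw
  exact ⟨v, hv, fun h => hvM (subset_closure h), ha⟩

theorem StrictlyInvariant.contracting_notMem {g : SL2R} {M : Set P1} (H : StrictlyInvariant g M)
    {u w : Fin 2 → ℝ} {μ : ℝ} (hμ : 1 < |μ|) (h : area u w ≠ 0) (hu : g • u = μ • u)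
    (hw : g • w = μ⁻¹ • w) : P1.pt w ∉ M := by
  have hμ0 : μ ≠ 0 := by rintro rfl; simp at hμ; linarith
  obtain ⟨v, hv, hvM, ha⟩ := H.exists_notMem (area_ne_zero_left h)
  have hu' : g⁻¹ • u = μ⁻¹ • u := by
    rw [inv_smul_eq_iff, smul_comm, hu, smul_smul, inv_mul_cancel₀ hμ0, one_smul]
  have hw' : g⁻¹ • w = μ • w := by
    rw [inv_smul_eq_iff, smul_comm, hw, smul_smul, mul_inv_cancel₀ hμ0, one_smul]
  have h' : area w u ≠ 0 := by rw [area_swap]; exact neg_ne_zero.mpr h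
  have hc : area v u / area w u ≠ 0 := div_ne_zero ha h'
  have := H.notMem_of_tendsto hv (smul_ne_zero hc (area_ne_zero_right h)) hvM
    (Eventually.of_forall fun n => pow_ne_zero n (inv_ne_zero hμ0))
    (tendsto_hyperbolic hμ h' hw' hu' v)
  rwa [P1.pt_smul hc] at this

instance : ConnectedSpace P1 := by
  have h1 : IsConnected ({0}ᶜ : Set (Fin 2 → ℝ)) :=
    isConnected_compl_singleton_of_one_lt_rank (by simp) 0
  have h2 : IsConnected (P1.pt '' ({0}ᶜ : Set (Fin 2 → ℝ))) := by
    refine h1.image _ fun v hv => ?_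
    exact (P1.continuousAt_pt hv).continuousWithinAt
  have h3 : P1.pt '' ({0}ᶜ : Set (Fin 2 → ℝ)) = Set.univ := by
    rw [Set.eq_univ_iff_forall]
    intro q
    obtain ⟨v, hv, rfl⟩ := P1.exists_pt q
    exact ⟨v, hv, rfl⟩
  rw [h3] at h2
  exact connectedSpace_iff_univ.mpr h2

/-- A transformation all of whose orbits are recurrent has no strictly invariant open set. -/
theorem StrictlyInvariant.not_recurrent {g : SL2R} {M : Set P1} (H : StrictlyInvariant g M)
    (hrec : ∀ (v : Fin 2 → ℝ) (U : Set P1), v ≠ 0 → IsOpen U → P1.pt v ∈ U →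
      ∃ n : ℕ, P1.pt (g ^ (n + 1) • v) ∈ U) : False := by
  set K := closure ((fun q : P1 => g • q) '' M) with hK
  -- Points of the open set `M \ K` enter `K` and never return. If this set is empty, `M` is open
  -- and closed, contradicting connectedness of the projective line.
  by_cases h : (M \ K).Nonempty
  · obtain ⟨q, hq⟩ := h
    obtain ⟨v, hv, rfl⟩ := P1.exists_pt q
    obtain ⟨n, hn⟩ := hrec v (M \ K) hv (H.isOpen.sdiff isClosed_closure) hq
    rw [← P1.smul_pt _ hv] at hn
    exact hn.2 (subset_closure (H.pow_succ_smul_mem hq.1 n))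
  · rw [Set.not_nonempty_iff_eq_empty, Set.sdiff_eq_empty] at h
    have hMK : M = K := Set.Subset.antisymm h H.maps_into
    have hclosed : IsClosed M := by rw [hMK]; exact isClosed_closure
    have huniv : M = Set.univ := (IsClopen.eq_univ ⟨hclosed, H.isOpen⟩ H.nonempty)
    apply H.closure_ne
    rw [huniv, closure_univ]

theorem smul_area (g : SL2R) (v w : Fin 2 → ℝ) : area (g • v) (g • w) = area v w := by
  have := det_entries g
  simp only [area, smul_entry]
  linear_combination (v 0 * w 1 - v 1 * w 0) * this

theorem smul_sub_vec (g : SL2R) (v w : Fin 2 → ℝ) : g • (v - w) = g • v - g • w := smul_sub g v w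

/-- For an elliptic element the form `v ↦ area v (g • v)` is invariant and definite, so `g` acts by
isometries of an equivalent norm and its orbits are bounded. -/
theorem recurrent_of_abs_tr_lt {g : SL2R} (hg : |tr g| < 2) (v : Fin 2 → ℝ) (U : Set P1)
    (hv : v ≠ 0) (hU : IsOpen U) (hvU : P1.pt v ∈ U) : ∃ n : ℕ, P1.pt (g ^ (n + 1) • v) ∈ U := by
  obtain ⟨E, hEinv, c, hc, hcE, K, hK, hEK⟩ : ∃ E : (Fin 2 → ℝ) → ℝ, (∀ v, E (g • v) = E v) ∧
      ∃ c, 0 < c ∧ (∀ v, c * vsq v ≤ E v) ∧ ∃ K, 0 < K ∧ ∀ v, E v ≤ K * vsq v := by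
    have hd := det_entries g
    have hdisc : (g 1 1 - g 0 0) ^ 2 < 4 * g 1 0 * (-g 0 1) := by
      have h1 : tr g ^ 2 < 4 := by
        rw [← sq_abs]
        nlinarith [abs_nonneg (tr g)]
      unfold tr at h1
      nlinarith
    have hneg : 0 < g 1 0 * (-g 0 1) := by nlinarith [sq_nonneg (g 1 1 - g 0 0)]
    have hE : ∀ v : Fin 2 → ℝ, area v (g • v) =
        binForm (g 1 0) (g 1 1 - g 0 0) (-g 0 1) v := by
      intro v
      simp only [area, smul_entry, binForm]; ring
    rcases lt_trichotomy (g 1 0) 0 with h0 | h0 | h0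
    · obtain ⟨c, hc, h1⟩ := binForm_posDef (α := -g 1 0) (β := -(g 1 1 - g 0 0)) (γ := g 0 1)
        (by nlinarith) (by nlinarith)
      obtain ⟨K, hK, h2⟩ := binForm_le (-g 1 0) (-(g 1 1 - g 0 0)) (g 0 1)
      have hE' : ∀ v : Fin 2 → ℝ, -area v (g • v) =
          binForm (-g 1 0) (-(g 1 1 - g 0 0)) (g 0 1) v := by
        intro v
        rw [hE]
        unfold binForm; ring
      refine ⟨fun v => -area v (g • v), fun v => by simp only [smul_area], c, hc, fun v => ?_,
        K, hK, fun v => ?_⟩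
      · simp only [hE']; exact h1 v
      · simp only [hE']; exact h2 v
    · rw [h0, zero_mul] at hneg
      exact absurd hneg (lt_irrefl 0)
    · obtain ⟨c, hc, h1⟩ := binForm_posDef (α := g 1 0) (β := g 1 1 - g 0 0) (γ := -g 0 1)
        (by nlinarith) (by nlinarith)
      obtain ⟨K, hK, h2⟩ := binForm_le (g 1 0) (g 1 1 - g 0 0) (-g 0 1)
      refine ⟨fun v => area v (g • v), fun v => by simp only [smul_area], c, hc, fun v => ?_,
        K, hK, fun v => ?_⟩
      · simp only [hE]; exact h1 v
      · simp only [hE]; exact h2 v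
  have hEpow : ∀ (n : ℕ) v, E (g ^ n • v) = E v := by
    intro n
    induction n with
    | zero => simp
    | succ n ih => intro v; rw [pow_succ, mul_smul, ih, hEinv]
  have hbdd : Bornology.IsBounded (Set.range fun n : ℕ => g ^ n • v) := by
    rw [isBounded_iff_forall_norm_le]
    refine ⟨√(E v / c), ?_⟩
    rintro _ ⟨n, rfl⟩
    apply Real.le_sqrt_of_sq_le
    refine (sq_norm_le_vsq _).trans ?_
    rw [le_div_iff₀ hc, mul_comm]
    simpa only [hEpow] using hcE (g ^ n • v)
  -- Two nearby points of the orbit, brought back by a power of `g` that preserves `E`, show that a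
  -- positive power moves `v` very little. The radius accounts for the comparison constants of `E`
  -- with the norm.
  obtain ⟨a, -, φ, hφ, hlim⟩ := tendsto_subseq_of_bounded hbdd fun n => Set.mem_range_self n
  have hopen : IsOpen {w : Fin 2 → ℝ | w ≠ 0 ∧ P1.pt w ∈ U} := (P1.isOpen_iff U).mp hU
  obtain ⟨ε, hε, hball⟩ := Metric.isOpen_iff.mp hopen v ⟨hv, hvU⟩
  have hcau := hlim.cauchySeq
  rw [Metric.cauchySeq_iff] at hcau
  obtain ⟨N, hN⟩ := hcau (√(c / (2 * K)) * ε) (by positivity)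
  have h1 := hN (N + 1) (by omega) N le_rfl
  have hlt : φ N < φ (N + 1) := hφ (by omega)
  obtain ⟨k, hk⟩ := Nat.exists_eq_add_of_lt hlt
  refine ⟨k, (hball ?_).2⟩
  rw [mem_ball_iff_norm]
  simp only [Function.comp, dist_eq_norm] at h1
  have e1 : g ^ φ (N + 1) • v - g ^ φ N • v = g ^ φ N • (g ^ (k + 1) • v - v) := by
    rw [smul_sub_vec, smul_smul, ← pow_add, hk, add_assoc]
  have h2 : c * ‖g ^ (k + 1) • v - v‖ ^ 2 ≤ 2 * K * ‖g ^ φ (N + 1) • v - g ^ φ N • v‖ ^ 2 := by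
    calc c * ‖g ^ (k + 1) • v - v‖ ^ 2 ≤ c * vsq (g ^ (k + 1) • v - v) := by
          gcongr; exact sq_norm_le_vsq _
      _ ≤ E (g ^ (k + 1) • v - v) := hcE _
      _ = E (g ^ φ (N + 1) • v - g ^ φ N • v) := by rw [e1, hEpow]
      _ ≤ K * vsq (g ^ φ (N + 1) • v - g ^ φ N • v) := hEK _
      _ ≤ K * (2 * ‖g ^ φ (N + 1) • v - g ^ φ N • v‖ ^ 2) := by
          gcongr; exact vsq_le_sq_norm _
      _ = _ := by ring
  have h3 : ‖g ^ φ (N + 1) • v - g ^ φ N • v‖ ^ 2 < c / (2 * K) * ε ^ 2 := by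
    calc _ < (√(c / (2 * K)) * ε) ^ 2 := by gcongr
      _ = _ := by rw [mul_pow, Real.sq_sqrt (by positivity)]
  have h4 : ‖g ^ (k + 1) • v - v‖ ^ 2 < ε ^ 2 := by
    have h5 : 2 * K * ‖g ^ φ (N + 1) • v - g ^ φ N • v‖ ^ 2 < c * ε ^ 2 := by
      calc _ < 2 * K * (c / (2 * K) * ε ^ 2) := by gcongr
        _ = _ := by field_simp
    exact lt_of_mul_lt_mul_left (h2.trans_lt h5) hc.le
  exact lt_of_pow_lt_pow_left₀ 2 hε.le h4

/-- A parabolic element attracts all points to its single fixed direction both in the future and in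
the past. That direction would have to lie both in the set and in its complement. -/
theorem StrictlyInvariant.tr_ne_two {g : SL2R} {M : Set P1} (H : StrictlyInvariant g M) :
    tr g ≠ 2 := by
  intro htr
  have hd := det_entries g
  unfold tr at htr
  by_cases hone : g = 1
  · refine H.not_recurrent fun v U _ _ hvU => ⟨0, ?_⟩
    simpa [hone] using hvU
  obtain ⟨e, he, hge⟩ : ∃ e : Fin 2 → ℝ, e ≠ 0 ∧ g • e = e := by
    by_cases hz : g 0 1 = 0
    · refine ⟨![0, 1], plane_ne_zero (Or.inr (by simp)), plane_ext ?_ ?_⟩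
      · simp [smul_entry, hz]
      · rw [hz] at hd
        have : (g 1 1 - 1) ^ 2 = 0 := by linear_combination (-1 : ℝ) * hd + (g 1 1) * htr
        have := pow_eq_zero_iff two_ne_zero |>.mp this
        simp [smul_entry]; linarith
    · refine ⟨![g 0 1, 1 - g 0 0], plane_ne_zero (Or.inl (by simpa using hz)), plane_ext ?_ ?_⟩
      · simp [smul_entry]; ring
      · simp only [smul_entry, Matrix.cons_val_zero, Matrix.cons_val_one]
        linear_combination (-1 : ℝ) * hd + htr
  set f : Fin 2 → ℝ := ![-e 1, e 0] with hf
  have hef : area e f ≠ 0 := by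
    have : area e f = vsq e := by simp [area, hf, vsq]; ring
    rw [this]
    exact (vsq_pos he).ne'
  set k := area (g • f) f / area e f with hk
  have hgf : g • f = f + k • e := by
    have h1 := decompose hef (g • f)
    have h2 : area e (g • f) = area e f := by
      conv_lhs => rw [← hge]
      rw [smul_area]
    rw [h2, div_self hef, one_smul] at h1
    rw [add_comm]
    exact h1
  have hk0 : k ≠ 0 := by
    intro h0
    rw [h0, zero_smul, add_zero] at hgf
    apply hone
    have h1 := congrFun hge 0
    have h2 := congrFun hge 1
    have h3 := congrFun hgf 0
    have h4 := congrFun hgf 1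
    have hvp := (vsq_pos he).ne'
    simp only [smul_entry, hf, Matrix.cons_val_zero, Matrix.cons_val_one, vsq] at h1 h2 h3 h4 hvp
    have hent : ∀ r : ℝ, r * (e 0 ^ 2 + e 1 ^ 2) = 0 → r = 0 := fun r hr =>
      (mul_eq_zero.mp hr).resolve_right hvp
    refine ext_entries ?_ ?_ ?_ ?_
    · have := hent (g 0 0 - 1) (by linear_combination (e 0) * h1 - (e 1) * h3)
      simp; linarith
    · have := hent (g 0 1) (by linear_combination (e 1) * h1 + (e 0) * h3)
      simpa using this
    · have := hent (g 1 0) (by linear_combination (e 0) * h2 - (e 1) * h4)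
      simpa using this
    · have := hent (g 1 1 - 1) (by linear_combination (e 1) * h2 + (e 0) * h4)
      simp; linarith
  have key : ∀ (h : SL2R) (k : ℝ), k ≠ 0 → h • e = e → h • f = f + k • e → ∀ v, area v e ≠ 0 →
      ∃ c : ℝ, c ≠ 0 ∧ Tendsto (fun n : ℕ => ((n : ℝ)⁻¹) • (h ^ n • v)) atTop (𝓝 (c • e)) := by
    intro h k hk0 hhe hhf v hv
    have hpe : ∀ n : ℕ, h ^ n • e = e := by
      intro n
      induction n with
      | zero => simp
      | succ n ih => rw [pow_succ, mul_smul, hhe, ih]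
    have hpf : ∀ n : ℕ, h ^ n • f = f + (n * k) • e := by
      intro n
      induction n with
      | zero => simp
      | succ n ih =>
        rw [pow_succ, mul_smul, hhf, smul_add_vec, ih, smul_comm (h ^ n), hpe, add_assoc, ← add_smul]
        congr 2
        push_cast
        ring
    set α := area v f / area e f
    set β := area e v / area e f with hβ
    have hβ0 : β ≠ 0 := div_ne_zero (by rw [area_swap]; exact neg_ne_zero.mpr hv) hef
    refine ⟨β * k, mul_ne_zero hβ0 hk0, ?_⟩
    have e1 : ∀ᶠ n : ℕ in atTop, (n : ℝ)⁻¹ • (α • e + β • f) + (β * k) • e =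
        ((n : ℝ)⁻¹) • (h ^ n • v) := by
      filter_upwards [eventually_ne_atTop 0] with n hn
      have hn' : (n : ℝ) ≠ 0 := by exact_mod_cast hn
      have hdec : v = α • e + β • f := decompose hef v
      have hpv : h ^ n • v = α • e + β • (f + (n * k) • e) := by
        conv_lhs => rw [hdec]
        rw [smul_add_vec, smul_comm (h ^ n), smul_comm (h ^ n), hpe, hpf]
      rw [hpv]
      apply plane_ext <;>
      · simp only [Pi.add_apply, Pi.smul_apply, smul_eq_mul]
        field_simp
        ring
    refine Tendsto.congr' e1 ?_
    have h1 : Tendsto (fun n : ℕ => (n : ℝ)⁻¹ • (α • e + β • f)) atTop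
        (𝓝 ((0 : ℝ) • (α • e + β • f))) :=
      (tendsto_inv_atTop_nhds_zero_nat (𝕜 := ℝ)).smul_const _
    simpa using h1.add_const ((β * k) • e)
  have hinvpos : ∀ᶠ n : ℕ in atTop, (n : ℝ)⁻¹ ≠ 0 := by
    filter_upwards [eventually_ne_atTop 0] with n hn
    exact inv_ne_zero (by exact_mod_cast hn)
  have hmem : P1.pt e ∈ M := by
    obtain ⟨v, hv, hvM, ha⟩ := exists_pt_mem_area_ne H.isOpen H.nonempty he
    obtain ⟨c, hc, hlim⟩ := key g k hk0 hge hgf v ha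
    have h1 := tendsto_pt (smul_ne_zero hc he) hlim
    rw [P1.pt_smul hc] at h1
    apply H.maps_into
    refine mem_closure_of_tendsto h1 ?_
    filter_upwards [hinvpos, eventually_ge_atTop 1] with n hn hn1
    rw [P1.pt_smul hn, ← P1.smul_pt _ hv]
    obtain ⟨m, rfl⟩ := Nat.exists_eq_add_of_le' hn1
    exact H.pow_succ_smul_mem hvM m
  obtain ⟨v, hv, hvM, ha⟩ := H.exists_notMem he
  have hge' : g⁻¹ • e = e := by rw [inv_smul_eq_iff, hge]
  have hgf' : g⁻¹ • f = f + (-k) • e := by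
    rw [inv_smul_eq_iff, smul_add_vec, hgf, smul_comm, hge, add_assoc, ← add_smul]
    simp
  obtain ⟨c, hc, hlim⟩ := key g⁻¹ (-k) (neg_ne_zero.mpr hk0) hge' hgf' v ha
  have := H.notMem_of_tendsto hv (smul_ne_zero hc he) hvM hinvpos hlim
  rw [P1.pt_smul hc] at this
  exact this hmem

theorem StrictlyInvariant.two_lt_abs_tr {g : SL2R} {M : Set P1} (H : StrictlyInvariant g M) :
    2 < |tr g| := by
  by_contra hcon
  push Not at hcon
  rcases hcon.lt_or_eq with h | h
  · exact H.not_recurrent (recurrent_of_abs_tr_lt h)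
  · rcases abs_eq (by norm_num : (0 : ℝ) ≤ 2) |>.mp h with h | h
    · exact H.tr_ne_two h
    · exact H.neg.tr_ne_two (by rw [tr_neg, h, neg_neg])

/-! ### Connected components of open sets -/

section Components

variable {X : Type*} [TopologicalSpace X]

theorem connectedComponentIn_union_left {U V : Set X} (hU : IsOpen U) (hV : IsOpen V)
    (hd : Disjoint U V) {x : X} (hx : x ∈ U) :
    connectedComponentIn (U ∪ V) x = connectedComponentIn U x := by
  apply Set.Subset.antisymm
  · refine isPreconnected_connectedComponentIn.subset_connectedComponentIn
      (mem_connectedComponentIn (Or.inl hx)) ?_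
    exact isPreconnected_connectedComponentIn.subset_left_of_subset_union hU hV hd
      (connectedComponentIn_subset _ _) ⟨x, mem_connectedComponentIn (Or.inl hx), hx⟩
  · exact connectedComponentIn_mono _ Set.subset_union_left

theorem connectedComponentIn_iUnion {ι : Type*} {U : ι → Set X} (hU : ∀ i, IsOpen (U i))
    (hd : Pairwise fun i j => Disjoint (U i) (U j)) {i : ι} {x : X} (hx : x ∈ U i) :
    connectedComponentIn (⋃ j, U j) x = connectedComponentIn (U i) x := by
  have h : (⋃ j, U j) = U i ∪ ⋃ j : {j // j ≠ i}, U j := by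
    ext y
    simp only [Set.mem_iUnion, Set.mem_union, Subtype.exists]
    constructor
    · rintro ⟨j, hj⟩
      by_cases hji : j = i
      · exact Or.inl (hji ▸ hj)
      · exact Or.inr ⟨j, hji, hj⟩
    · rintro (h | ⟨j, -, h⟩)
      · exact ⟨i, h⟩
      · exact ⟨j, h⟩
  rw [h]
  refine connectedComponentIn_union_left (hU i) (isOpen_iUnion fun j : {j // j ≠ i} => hU j) ?_ hx
  rw [Set.disjoint_iUnion_right]
  exact fun j => hd j.2.symm

theorem componentsOf_iUnion {ι : Type*} {U : ι → Set X} (hU : ∀ i, IsOpen (U i))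
    (hd : Pairwise fun i j => Disjoint (U i) (U j)) :
    componentsOf (⋃ i, U i) = ⋃ i, componentsOf (U i) := by
  ext C
  simp only [componentsOf, Set.mem_image, Set.mem_iUnion]
  constructor
  · rintro ⟨x, ⟨i, hx⟩, rfl⟩
    exact ⟨i, x, hx, (connectedComponentIn_iUnion hU hd hx).symm⟩
  · rintro ⟨i, x, hx, rfl⟩
    exact ⟨x, ⟨i, hx⟩, connectedComponentIn_iUnion hU hd hx⟩

theorem componentsOf_union {U V : Set X} (hU : IsOpen U) (hV : IsOpen V) (hd : Disjoint U V) :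
    componentsOf (U ∪ V) = componentsOf U ∪ componentsOf V := by
  rw [componentsOf, Set.image_union]
  congr 1
  · exact Set.image_congr fun x hx => connectedComponentIn_union_left hU hV hd hx
  · rw [Set.union_comm U V]
    exact Set.image_congr fun x hx => connectedComponentIn_union_left hV hU hd.symm hx

theorem componentsOf_eq_singleton {S : Set X} (h : IsPreconnected S) (hne : S.Nonempty) :
    componentsOf S = {S} := by
  obtain ⟨x, hx⟩ := hne
  ext C
  simp only [componentsOf, Set.mem_image, Set.mem_singleton_iff]
  constructor
  · rintro ⟨y, hy, rfl⟩
    exact h.connectedComponentIn hy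
  · rintro rfl
    exact ⟨x, hx, h.connectedComponentIn hx⟩

theorem componentsOf_image {Y : Type*} [TopologicalSpace Y] (e : X ≃ₜ Y) (S : Set X) :
    componentsOf (e '' S) = Set.image e '' componentsOf S := by
  rw [componentsOf, componentsOf, Set.image_image, Set.image_image]
  exact Set.image_congr fun x hx => (e.image_connectedComponentIn hx).symm

end Components

/-! ### Multicones of conjugate pairs and changes of sign -/

theorem IsMulticone.strictlyInvariant {N : ℕ} {A : Fin N → SL2R} {M : Set P1}
    (h : IsMulticone A M) (i : Fin N) : StrictlyInvariant (A i) M :=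
  ⟨h.isOpen, h.nonempty, h.closure_ne, (h.maps_into i).trans interior_subset⟩

theorem IsMulticone.conj {N : ℕ} {A : Fin N → SL2R} {M : Set P1} (h : IsMulticone A M) (g : SL2R) :
    IsMulticone (fun i => g⁻¹ * A i * g) (Homeomorph.smul g⁻¹ '' M) := by
  set e : P1 ≃ₜ P1 := Homeomorph.smul g⁻¹ with he
  refine ⟨e.isOpenMap M h.isOpen, h.nonempty.image e, ?_, ?_, ?_, ?_⟩
  · rw [← e.image_closure]
    intro hcon
    apply h.closure_ne
    rw [← e.injective.image_injective.eq_iff, hcon, Set.image_univ, e.surjective.range_eq]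
  · rw [componentsOf_image]
    exact h.finite_components.image _
  · rw [componentsOf_image]
    rintro _ ⟨C, hC, rfl⟩ _ ⟨D, hD, rfl⟩ hne
    have hCD : C ≠ D := fun hCD => hne (by rw [hCD])
    simp only [Function.onFun, ← e.image_closure]
    exact (Set.disjoint_image_iff e.injective).mpr (h.disjoint_closures hC hD hCD)
  · intro i
    have h1 : (fun q : P1 => (g⁻¹ * A i * g) • q) '' (e '' M) =
        e '' ((fun q : P1 => A i • q) '' M) := by
      rw [Set.image_image, Set.image_image]
      refine Set.image_congr fun q _ => ?_
      simp [he, mul_smul]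
    rw [h1, ← e.image_closure, ← e.image_interior]
    exact Set.image_mono (h.maps_into i)

theorem HasMulticoneWith.conj {k : ℕ} {p : SL2R × SL2R} (h : HasMulticoneWith k p) (g : SL2R) :
    HasMulticoneWith k (g⁻¹ * p.1 * g, g⁻¹ * p.2 * g) := by
  obtain ⟨M, hM, hk⟩ := h
  refine ⟨Homeomorph.smul g⁻¹ '' M, ?_, ?_⟩
  · convert hM.conj g using 1
    ext1 i
    fin_cases i <;> rfl
  · rw [componentsOf_image, Set.ncard_image_of_injective _ (Homeomorph.injective _).image_injective,
      hk]

theorem HasMulticoneWith.of_conj {k : ℕ} {p : SL2R × SL2R} {g : SL2R}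
    (h : HasMulticoneWith k (g⁻¹ * p.1 * g, g⁻¹ * p.2 * g)) : HasMulticoneWith k p := by
  have h1 := h.conj g⁻¹
  have e : ∀ A : SL2R, (g⁻¹)⁻¹ * (g⁻¹ * A * g) * g⁻¹ = A := fun A => by group
  simpa only [e] using h1

theorem HasMulticoneWith.flipSign {k : ℕ} {p : SL2R × SL2R} (h : HasMulticoneWith k p)
    (s : Bool × Bool) : HasMulticoneWith k (flipSign s p) := by
  obtain ⟨M, hM, hk⟩ := h
  refine ⟨M, ⟨hM.isOpen, hM.nonempty, hM.closure_ne, hM.finite_components, hM.disjoint_closures,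
    fun i => ?_⟩, hk⟩
  have h1 : (fun q : P1 => ![(_root_.flipSign s p).1, (_root_.flipSign s p).2] i • q) =
      fun q : P1 => ![p.1, p.2] i • q := by
    funext q
    obtain ⟨a, b⟩ := s
    fin_cases i <;> cases a <;> cases b <;> simp [_root_.flipSign, P1.neg_smul]
  rw [h1]
  exact hM.maps_into i

/-! ### Intervals of the projective line defined by quadratic forms -/

theorem binForm_smul (α β γ a : ℝ) (v : Fin 2 → ℝ) :
    binForm α β γ (a • v) = a ^ 2 * binForm α β γ v := by
  simp only [binForm, Pi.smul_apply, smul_eq_mul]; ring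

theorem continuous_binForm (α β γ : ℝ) : Continuous (binForm α β γ) := by
  unfold binForm; fun_prop

namespace P1

/-- The points of the projective line where a quadratic form is positive. -/
def posSet (α β γ : ℝ) : Set P1 := {q | 0 < binForm α β γ q.rep}

theorem pt_mem_posSet {α β γ : ℝ} {v : Fin 2 → ℝ} (hv : v ≠ 0) :
    pt v ∈ posSet α β γ ↔ 0 < binForm α β γ v := by
  rw [pt_eq_mk hv]
  obtain ⟨a, ha⟩ := Projectivization.exists_smul_eq_mk_rep ℝ v hv
  have h0 : 0 < (a : ℝ) ^ 2 := sq_pos_of_ne_zero a.ne_zero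
  rw [posSet, Set.mem_ofPred_eq, ← ha, Units.smul_def, binForm_smul]
  exact mul_pos_iff_of_pos_left h0

theorem isOpen_posSet (α β γ : ℝ) : IsOpen (posSet α β γ) := by
  rw [isOpen_iff]
  have : {v : Fin 2 → ℝ | v ≠ 0 ∧ pt v ∈ posSet α β γ} =
      {v | v ≠ 0} ∩ {v | 0 < binForm α β γ v} := by
    ext v
    simp only [Set.mem_ofPred_eq, Set.mem_inter_iff]
    exact and_congr_right fun hv => pt_mem_posSet hv
  rw [this]
  exact isOpen_ne_zero.inter (isOpen_lt continuous_const (continuous_binForm α β γ))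

theorem pt_mem_compl_posSet_neg {α β γ : ℝ} {v : Fin 2 → ℝ} (hv : v ≠ 0) :
    pt v ∈ (posSet (-α) (-β) (-γ))ᶜ ↔ 0 ≤ binForm α β γ v := by
  rw [Set.mem_compl_iff, pt_mem_posSet hv, not_lt]
  have : binForm (-α) (-β) (-γ) v = -binForm α β γ v := by unfold binForm; ring
  rw [this, neg_nonpos]

theorem isClosed_compl_posSet (α β γ : ℝ) : IsClosed (posSet α β γ)ᶜ :=
  (isOpen_posSet α β γ).isClosed_compl

theorem closure_posSet_subset (α β γ : ℝ) :
    closure (posSet α β γ) ⊆ (posSet (-α) (-β) (-γ))ᶜ := by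
  refine closure_minimal ?_ (isClosed_compl_posSet _ _ _)
  intro q hq
  obtain ⟨v, hv, rfl⟩ := exists_pt q
  rw [pt_mem_posSet hv] at hq
  rw [pt_mem_compl_posSet_neg hv]
  exact hq.le

/-- A quadratic form without zeros on a connected set has constant sign there. -/
theorem binForm_mul_pos {α β γ : ℝ} {C : Set P1} (hC : IsPreconnected C)
    (hne : ∀ v, v ≠ 0 → pt v ∈ C → binForm α β γ v ≠ 0) {v w : Fin 2 → ℝ} (hv : v ≠ 0) (hw : w ≠ 0)
    (hvC : pt v ∈ C) (hwC : pt w ∈ C) : 0 < binForm α β γ v * binForm α β γ w := by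
  have hneg : ∀ v, binForm (-α) (-β) (-γ) v = -binForm α β γ v := by
    intro v; unfold binForm; ring
  have hd : Disjoint (posSet α β γ) (posSet (-α) (-β) (-γ)) := by
    rw [Set.disjoint_left]
    intro q h1 h2
    obtain ⟨u, hu, rfl⟩ := exists_pt q
    rw [pt_mem_posSet hu] at h1 h2
    rw [hneg] at h2
    linarith
  have hsub : C ⊆ posSet α β γ ∪ posSet (-α) (-β) (-γ) := by
    intro q hq
    obtain ⟨u, hu, rfl⟩ := exists_pt q
    rw [Set.mem_union, pt_mem_posSet hu, pt_mem_posSet hu, hneg, neg_pos]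
    exact (lt_or_gt_of_ne (hne u hu hq)).symm
  rcases lt_or_gt_of_ne (hne v hv hvC) with h | h
  · have h1 := hC.subset_right_of_subset_union (isOpen_posSet _ _ _) (isOpen_posSet _ _ _) hd hsub
      ⟨pt v, hvC, (pt_mem_posSet hv).mpr (by rw [hneg]; linarith)⟩ hwC
    rw [pt_mem_posSet hw, hneg] at h1
    exact mul_pos_of_neg_of_neg h (by linarith)
  · have h1 := hC.subset_left_of_subset_union (isOpen_posSet _ _ _) (isOpen_posSet _ _ _) hd hsub
      ⟨pt v, hvC, (pt_mem_posSet hv).mpr h⟩ hwC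
    rw [pt_mem_posSet hw] at h1
    exact mul_pos h h1

theorem isPreconnected_posSet {α β γ κ a b c d : ℝ} (hκ : 0 < κ)
    (h : ∀ v, κ * binForm α β γ v = (a * v 0 + b * v 1) * (c * v 0 + d * v 1)) :
    IsPreconnected (posSet α β γ) := by
  set S : Set (Fin 2 → ℝ) := {v | 0 < a * v 0 + b * v 1 ∧ 0 < c * v 0 + d * v 1} with hS
  have hne : ∀ v ∈ S, v ≠ 0 := by
    rintro v hv rfl
    simp [hS] at hv
  have hconv : Convex ℝ S := by
    have hlin : ∀ a b : ℝ, IsLinearMap ℝ fun v : Fin 2 → ℝ => a * v 0 + b * v 1 := by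
      intro a b
      constructor
      · intro v w; simp only [Pi.add_apply]; ring
      · intro t v; simp only [Pi.smul_apply, smul_eq_mul]; ring
    exact (convex_halfSpace_gt (hlin a b) 0).inter (convex_halfSpace_gt (hlin c d) 0)
  have himg : pt '' S = posSet α β γ := by
    ext q
    constructor
    · rintro ⟨v, hv, rfl⟩
      rw [pt_mem_posSet (hne v hv)]
      have := mul_pos hv.1 hv.2
      rw [← h] at this
      exact (mul_pos_iff_of_pos_left hκ).mp this
    · intro hq
      obtain ⟨v, hv, rfl⟩ := exists_pt q
      rw [pt_mem_posSet hv] at hq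
      have h1 := mul_pos hκ hq
      rw [h] at h1
      rcases pos_and_pos_or_neg_and_neg_of_mul_pos h1 with h2 | h2
      · exact ⟨v, h2, rfl⟩
      · refine ⟨(-1 : ℝ) • v, ⟨?_, ?_⟩, pt_smul (by norm_num) v⟩
        · simp only [Pi.smul_apply, smul_eq_mul]; linarith [h2.1]
        · simp only [Pi.smul_apply, smul_eq_mul]; linarith [h2.2]
  rw [← himg]
  exact hconv.isPreconnected.image _ fun v hv => (continuousAt_pt (hne v hv)).continuousWithinAt

theorem closure_smul_image_subset {g : SL2R} {M K N : Set P1} (hMK : M ⊆ K) (hK : IsClosed K)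
    (h : ∀ q ∈ K, g • q ∈ N) : closure ((fun q : P1 => g • q) '' M) ⊆ N := by
  have h1 : IsClosed ((fun q : P1 => g • q) '' K) := (Homeomorph.smul g).isClosedMap K hK
  refine (closure_minimal (Set.image_mono hMK) h1).trans ?_
  rintro _ ⟨q, hq, rfl⟩
  exact h q hq

end P1

/-! ### Pairs with a multicone -/

/-- The multicone is the set of lines through the open first quadrant. -/
theorem hasMulticoneWith_one_of_posMat {A B : SL2R} (hA : A ∈ posMat) (hB : B ∈ posMat) :
    HasMulticoneWith 1 (A, B) := by
  have hform : ∀ v, binForm 0 1 0 v = v 0 * v 1 := fun v => by unfold binForm; ring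
  have hpre : IsPreconnected (P1.posSet 0 1 0) :=
    P1.isPreconnected_posSet (κ := 1) (a := 1) (b := 0) (c := 0) (d := 1) one_pos fun v => by
      rw [hform]; ring
  have hv : (![1, 1] : Fin 2 → ℝ) ≠ 0 := plane_ne_zero (Or.inl (by simp))
  have hw : (![1, -1] : Fin 2 → ℝ) ≠ 0 := plane_ne_zero (Or.inl (by simp))
  have hne : (P1.posSet 0 1 0).Nonempty :=
    ⟨P1.pt ![1, 1], (P1.pt_mem_posSet hv).mpr (by simp [hform])⟩
  have hcomp := componentsOf_eq_singleton hpre hne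
  have hK := P1.closure_posSet_subset 0 1 0
  have hmap : ∀ C ∈ posMat, ∀ q ∈ (P1.posSet (-0) (-1) (-0))ᶜ, C • q ∈ P1.posSet 0 1 0 := by
    rintro C ⟨h1, h2, h3, h4⟩ q hq
    obtain ⟨v, hv, rfl⟩ := P1.exists_pt q
    rw [P1.pt_mem_compl_posSet_neg hv, hform] at hq
    rw [P1.smul_pt _ hv, P1.pt_mem_posSet (P1.smul_ne_zero' _ hv), hform, smul_entry, smul_entry]
    have hs := vsq_pos hv
    unfold vsq at hs
    have e : (C 0 0 * v 0 + C 0 1 * v 1) * (C 1 0 * v 0 + C 1 1 * v 1) =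
        C 0 0 * C 1 0 * v 0 ^ 2 + C 0 1 * C 1 1 * v 1 ^ 2 +
          (C 0 0 * C 1 1 + C 0 1 * C 1 0) * (v 0 * v 1) := by ring
    rw [e]
    have h5 : 0 ≤ (C 0 0 * C 1 1 + C 0 1 * C 1 0) * (v 0 * v 1) := by positivity
    have h6 : 0 < C 0 0 * C 1 0 * v 0 ^ 2 + C 0 1 * C 1 1 * v 1 ^ 2 := by
      by_cases h0 : v 0 = 0
      · have : 0 < v 1 ^ 2 := by rw [h0] at hs; linarith
        positivity
      · positivity
    linarith
  refine ⟨P1.posSet 0 1 0, ⟨P1.isOpen_posSet _ _ _, hne, ?_, ?_, ?_, ?_⟩, ?_⟩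
  · intro hcon
    have h1 : P1.pt ![1, -1] ∈ closure (P1.posSet 0 1 0) := hcon ▸ Set.mem_univ _
    have h2 := (P1.pt_mem_compl_posSet_neg hw).mp (hK h1)
    simp only [hform, Matrix.cons_val_zero, Matrix.cons_val_one] at h2
    linarith
  · rw [hcomp]; exact Set.finite_singleton _
  · rw [hcomp]; exact Set.pairwiseDisjoint_singleton _ _
  · rw [(P1.isOpen_posSet _ _ _).interior_eq]
    intro i
    refine P1.closure_smul_image_subset (subset_closure.trans hK) (P1.isClosed_compl_posSet _ _ _) ?_
    fin_cases i
    · exact hmap A hA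
    · exact hmap B hB
  · rw [hcomp, Set.ncard_singleton]

theorem hasMulticoneWith_one_of_mem_principalSet {s : Bool × Bool} {p : SL2R × SL2R}
    (hp : p ∈ principalSet s) : HasMulticoneWith 1 p := by
  obtain ⟨g, h1, h2⟩ := hp
  have h := (HasMulticoneWith.of_conj (hasMulticoneWith_one_of_posMat h1 h2)).flipSign s
  rwa [flipSign_flipSign] at h

/-- Let `I` be the interval where the form of the reflection 0 is positive, and `J` the image under
the reflection 1 of the corresponding interval of the reflection 2. By ping-pong, `A = -R₀R₁` maps
the closures of both into `I`, and `B = -R₁R₂` maps them into `J`. -/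
theorem IsFreeForm.hasMulticoneWith_two {A B : SL2R} (h : IsFreeForm A B) :
    HasMulticoneWith 2 (A, B) := by
  set R := h.reflections with hR
  have ha := R.a_gt
  have he := R.e_gt
  have hb := R.b_pos
  have hc := R.c_pos
  have hf := R.f_pos
  have hg := R.g_pos
  have hdA := R.detA
  have hdB := R.detB
  set I := P1.posSet (-R.c) (2 * R.a) (-R.b) with hI
  set J := P1.posSet (-R.g) (-(2 * R.e)) (-R.f) with hJ
  have formI : ∀ v, binForm (-R.c) (2 * R.a) (-R.b) v = R.form 0 v := fun v => rfl
  have formJ : ∀ v, binForm (-R.g) (-(2 * R.e)) (-R.f) v = R.form 2 (R.act 1 v) := by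
    intro v
    simp only [Reflections.form, Reflections.act, binForm, Matrix.cons_val_zero,
      Matrix.cons_val_one]
    ring
  have form_neg : ∀ i v, R.form i (-v) = R.form i v := by
    intro i v
    fin_cases i <;> simp only [Reflections.form, binForm, Pi.neg_apply] <;> ring
  have neg_of : ∀ {x y z : ℝ}, 0 ≤ x → 0 ≤ z → 0 < x + z →
      x ^ 2 + y ^ 2 + z ^ 2 < 2 * R.a * (x * y) + 2 * R.e * (y * z) + R.gram 0 2 * (x * z) →
      ∀ v, v ≠ 0 → x * R.form 0 v + y * R.form 1 v + z * R.form 2 v < 0 := by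
    intro x y z hx hz hxz hlt v hv
    obtain ⟨ε, hε, hle⟩ := R.combination_posDef hx hz hxz hlt
    have := hle v
    have := mul_pos hε (vsq_pos hv)
    linarith
  have hgram : 2 < R.gram 0 2 := R.gram_gt
  have h02 : ∀ v, v ≠ 0 → R.form 0 v + R.form 2 v < 0 := by
    intro v hv
    have := neg_of (x := 1) (y := 0) (z := 1) zero_le_one zero_le_one (by norm_num) (by linarith) v hv
    linarith
  have h01 : ∀ v, v ≠ 0 → R.form 0 v + R.a * R.form 1 v < 0 := by
    intro v hv
    have := neg_of (x := 1) (y := R.a) (z := 0) zero_le_one le_rfl (by norm_num) (by nlinarith) v hv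
    linarith
  have h21 : ∀ v, v ≠ 0 → R.form 2 v + R.e * R.form 1 v < 0 := by
    intro v hv
    have := neg_of (x := 0) (y := R.e) (z := 1) le_rfl zero_le_one (by norm_num) (by nlinarith) v hv
    linarith
  have act_ne : ∀ v, v ≠ 0 → R.act 1 v ≠ 0 := by
    intro v hv h0
    apply hv
    rw [← R.act_act 1 v, h0]
    apply plane_ext <;> simp [Reflections.act]
  have g01 : ∀ v, R.form 0 (R.act 1 v) = R.form 0 v + 2 * R.a * R.form 1 v := fun v =>
    R.form_act 1 0 v
  have g21 : ∀ v, R.form 2 (R.act 1 v) = R.form 2 v + 2 * R.e * R.form 1 v := fun v =>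
    R.form_act 1 2 v
  set KI := (P1.posSet (-(-R.c)) (-(2 * R.a)) (-(-R.b)))ᶜ with hKI
  set KJ := (P1.posSet (-(-R.g)) (-(-(2 * R.e))) (-(-R.f)))ᶜ with hKJ
  have memKI : ∀ {v : Fin 2 → ℝ}, v ≠ 0 → (P1.pt v ∈ KI ↔ 0 ≤ R.form 0 v) := fun hv => by
    rw [hKI, P1.pt_mem_compl_posSet_neg hv, formI]
  have memKJ : ∀ {v : Fin 2 → ℝ}, v ≠ 0 → (P1.pt v ∈ KJ ↔ 0 ≤ R.form 2 (R.act 1 v)) := fun hv => by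
    rw [hKJ, P1.pt_mem_compl_posSet_neg hv, formJ]
  have memI : ∀ {v : Fin 2 → ℝ}, v ≠ 0 → (P1.pt v ∈ I ↔ 0 < R.form 0 v) := fun hv => by
    rw [hI, P1.pt_mem_posSet hv, formI]
  have memJ : ∀ {v : Fin 2 → ℝ}, v ≠ 0 → (P1.pt v ∈ J ↔ 0 < R.form 2 (R.act 1 v)) := fun hv => by
    rw [hJ, P1.pt_mem_posSet hv, formJ]
  have hIK : closure I ⊆ KI := P1.closure_posSet_subset _ _ _
  have hJK : closure J ⊆ KJ := P1.closure_posSet_subset _ _ _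
  -- A nonnegative form 0 makes the forms 1 and 2 negative, and then the form 2 is also negative
  -- after the reflection 1.
  have hdisjK : Disjoint KI KJ := by
    rw [Set.disjoint_left]
    intro q h1 h2
    obtain ⟨v, hv, rfl⟩ := P1.exists_pt q
    rw [memKI hv] at h1
    rw [memKJ hv, g21] at h2
    have k1 := h02 v hv
    have k2 := h01 v hv
    have k3 : R.form 1 v < 0 := by
      by_contra hcon
      push Not at hcon
      nlinarith
    nlinarith
  have hdisj : Disjoint I J :=
    hdisjK.mono (subset_closure.trans hIK) (subset_closure.trans hJK)
  have hopenI : IsOpen I := P1.isOpen_posSet _ _ _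
  have hopenJ : IsOpen J := P1.isOpen_posSet _ _ _
  have hvI : (![R.b, R.a] : Fin 2 → ℝ) ≠ 0 := plane_ne_zero (Or.inl (by simpa using hb.ne'))
  have hvJ : (![R.f, -R.e] : Fin 2 → ℝ) ≠ 0 := plane_ne_zero (Or.inl (by simpa using hf.ne'))
  have hneI : I.Nonempty := by
    refine ⟨P1.pt ![R.b, R.a], (P1.pt_mem_posSet hvI).mpr ?_⟩
    simp only [binForm, Matrix.cons_val_zero, Matrix.cons_val_one]
    nlinarith
  have hneJ : J.Nonempty := by
    refine ⟨P1.pt ![R.f, -R.e], (P1.pt_mem_posSet hvJ).mpr ?_⟩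
    simp only [binForm, Matrix.cons_val_zero, Matrix.cons_val_one]
    nlinarith
  have hpreI : IsPreconnected I := by
    refine P1.isPreconnected_posSet (κ := R.b) (a := 1 + R.a) (b := -R.b) (c := 1 - R.a) (d := R.b)
      hb fun v => ?_
    simp only [binForm]
    linear_combination (v 0 ^ 2) * hdA
  have hpreJ : IsPreconnected J := by
    refine P1.isPreconnected_posSet (κ := R.f) (a := 1 - R.e) (b := -R.f) (c := 1 + R.e) (d := R.f)
      hf fun v => ?_
    simp only [binForm]
    linear_combination (v 0 ^ 2) * hdB
  have hcomp : componentsOf (I ∪ J) = {I, J} := by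
    rw [componentsOf_union hopenI hopenJ hdisj, componentsOf_eq_singleton hpreI hneI,
      componentsOf_eq_singleton hpreJ hneJ]
    rfl
  have hIJ : I ≠ J := by
    intro hEq
    obtain ⟨q, hq⟩ := hneI
    exact Set.disjoint_left.mp hdisj hq (hEq ▸ hq)
  have hclosure : closure (I ∪ J) ⊆ KI ∪ KJ := by
    rw [closure_union]
    exact Set.union_subset_union hIK hJK
  have hKclosed : IsClosed (KI ∪ KJ) :=
    (P1.isClosed_compl_posSet _ _ _).union (P1.isClosed_compl_posSet _ _ _)
  have mapA : ∀ q ∈ KI ∪ KJ, A • q ∈ I ∪ J := by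
    rintro q hq
    obtain ⟨v, hv, rfl⟩ := P1.exists_pt q
    left
    have e : R.form 0 (A • v) = -R.form 0 (R.act 1 v) := by
      rw [h.smul_A, form_neg, R.form_act 0 0]
      simp only [Reflections.gram]
      ring
    rw [P1.smul_pt _ hv, memI (P1.smul_ne_zero' _ hv), e]
    rcases hq with hq | hq
    · rw [memKI hv] at hq
      have := h01 v hv
      rw [g01]
      nlinarith
    · rw [memKJ hv] at hq
      have := h02 _ (act_ne v hv)
      linarith
  have mapB : ∀ q ∈ KI ∪ KJ, B • q ∈ I ∪ J := by
    rintro q hq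
    obtain ⟨v, hv, rfl⟩ := P1.exists_pt q
    right
    have e : R.form 2 (R.act 1 (B • v)) = -R.form 2 v := by
      rw [h.smul_B, R.act_neg, R.act_act, form_neg, R.form_act 2 2]
      simp only [Reflections.gram]
      ring
    rw [P1.smul_pt _ hv, memJ (P1.smul_ne_zero' _ hv), e]
    rcases hq with hq | hq
    · rw [memKI hv] at hq
      have := h02 v hv
      linarith
    · rw [memKJ hv] at hq
      have h1 := h21 _ (act_ne v hv)
      have h2 := R.form_act 1 2 (R.act 1 v)
      rw [R.act_act] at h2
      have h3 : R.gram 1 2 = 2 * R.e := rfl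
      rw [h2, h3]
      nlinarith
  have hv : (![1, 0] : Fin 2 → ℝ) ≠ 0 := plane_ne_zero (Or.inl (by simp))
  refine ⟨I ∪ J, ⟨hopenI.union hopenJ, hneI.mono Set.subset_union_left, ?_, ?_, ?_, ?_⟩, ?_⟩
  · intro hcon
    have h1 : P1.pt ![1, 0] ∈ KI ∪ KJ := hclosure (hcon ▸ Set.mem_univ _)
    rcases h1 with h1 | h1
    · rw [memKI hv, ← formI] at h1
      simp only [binForm, Matrix.cons_val_zero, Matrix.cons_val_one] at h1
      linarith
    · rw [memKJ hv, ← formJ] at h1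
      simp only [binForm, Matrix.cons_val_zero, Matrix.cons_val_one] at h1
      linarith
  · rw [hcomp]; exact Set.toFinite _
  · rw [hcomp]
    have h1 : Disjoint (closure I) (closure J) := hdisjK.mono hIK hJK
    rintro C (rfl | rfl) D (rfl | rfl) hne
    · exact absurd rfl hne
    · exact h1
    · exact h1.symm
    · exact absurd rfl hne
  · rw [(hopenI.union hopenJ).interior_eq]
    intro i
    refine P1.closure_smul_image_subset (subset_closure.trans hclosure) hKclosed ?_
    fin_cases i
    · exact mapA
    · exact mapB
  · rw [hcomp, Set.ncard_pair hIJ]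

theorem hasMulticoneWith_two_of_mem_freeSet {p : SL2R × SL2R} (hp : p ∈ freeSet) :
    HasMulticoneWith 2 p := by
  obtain ⟨s, g, hg⟩ := exists_flipSign_isFreeForm hp
  have h := (HasMulticoneWith.of_conj hg.hasMulticoneWith_two).flipSign s
  rwa [flipSign_flipSign] at h

/-! ### Consequences of the existence of a multicone -/

/-- A point of a multicone with two components that lies in a different component than the
expanding direction of `g` is mapped to the component of the expanding direction. -/
theorem StrictlyInvariant.crossing {g : SL2R} {M : Set P1} (H : StrictlyInvariant g M)
    (hM : (componentsOf M).ncard = 2) {u w v : Fin 2 → ℝ} {μ : ℝ} (hμ : 1 < |μ|)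
    (h : area u w ≠ 0) (hu : g • u = μ • u) (hw : g • w = μ⁻¹ • w) (hvw : area v w ≠ 0)
    (huM : P1.pt u ∈ M) (hvM : P1.pt v ∈ M) {α β γ : ℝ}
    (hne : ∀ v, v ≠ 0 → P1.pt v ∈ M → binForm α β γ v ≠ 0)
    (huv : binForm α β γ u * binForm α β γ v < 0) :
    0 < binForm α β γ (g • v) * binForm α β γ u := by
  have hu0 := area_ne_zero_left h
  have hv0 := area_ne_zero_left hvw
  have hgv0 := P1.smul_ne_zero' g hv0
  have hgvM : P1.pt (g • v) ∈ M := by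
    rw [← P1.smul_pt g hv0]; exact H.smul_mem hvM
  have hsign : ∀ {a b q}, a ≠ 0 → b ≠ 0 → P1.pt a ∈ connectedComponentIn M q →
      P1.pt b ∈ connectedComponentIn M q → 0 < binForm α β γ a * binForm α β γ b := by
    intro a b q ha hb haq hbq
    exact P1.binForm_mul_pos isPreconnected_connectedComponentIn
      (fun v hv hvq => hne v hv (connectedComponentIn_subset _ _ hvq)) ha hb haq hbq
  obtain ⟨X, Y, -, hXY⟩ := Set.ncard_eq_two.mp hM
  have hmem : ∀ {q}, q ∈ M → connectedComponentIn M q = X ∨ connectedComponentIn M q = Y := by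
    intro q hq
    have : connectedComponentIn M q ∈ componentsOf M := ⟨q, hq, rfl⟩
    rw [hXY] at this
    exact this
  have hneq : connectedComponentIn M (P1.pt u) ≠ connectedComponentIn M (P1.pt v) := by
    intro hcon
    have h1 := hsign hu0 hv0 (mem_connectedComponentIn huM)
      (hcon ▸ mem_connectedComponentIn hvM)
    linarith
  -- Otherwise `g` would map the component of `v` into itself, and the iterates of `v` converging to
  -- the expanding direction would give `u` the sign of `v`.
  have hnot : connectedComponentIn M (P1.pt (g • v)) ≠ connectedComponentIn M (P1.pt v) := by
    intro hcon
    have hsub : (fun q : P1 => g • q) '' connectedComponentIn M (P1.pt v) ⊆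
        connectedComponentIn M (P1.pt v) := by
      rw [← hcon]
      refine IsPreconnected.subset_connectedComponentIn ?_ ?_ ?_
      · rw [hcon]
        exact isPreconnected_connectedComponentIn.image _
          (continuous_const_smul g).continuousOn
      · rw [hcon]
        exact ⟨P1.pt v, mem_connectedComponentIn hvM, P1.smul_pt g hv0⟩
      · rintro _ ⟨q, hq, rfl⟩
        exact H.smul_mem (connectedComponentIn_subset _ _ hq)
    have hpow : ∀ n : ℕ, P1.pt (g ^ n • v) ∈ connectedComponentIn M (P1.pt v) := by
      intro n
      induction n with
      | zero => simpa using mem_connectedComponentIn hvM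
      | succ n ih =>
        rw [pow_succ', mul_smul, ← P1.smul_pt g (P1.smul_ne_zero' _ hv0)]
        exact hsub ⟨_, ih, rfl⟩
    have hlim := tendsto_hyperbolic hμ h hu hw v
    have h1 := ((continuous_binForm α β γ).tendsto _).comp hlim
    have h2 := h1.mul_const (binForm α β γ v)
    have h3 : 0 ≤ binForm α β γ ((area v w / area u w) • u) * binForm α β γ v := by
      refine ge_of_tendsto' h2 fun n => ?_
      simp only [Function.comp_apply, binForm_smul]
      have := hsign (P1.smul_ne_zero' (g ^ n) hv0) hv0 (hpow n) (mem_connectedComponentIn hvM)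
      rw [mul_assoc]
      positivity
    rw [binForm_smul, mul_assoc] at h3
    have h4 : 0 < (area v w / area u w) ^ 2 := by
      have := div_ne_zero hvw h
      positivity
    have := mul_neg_of_pos_of_neg h4 huv
    linarith
  have heq : connectedComponentIn M (P1.pt (g • v)) = connectedComponentIn M (P1.pt u) := by
    rcases hmem huM with h1 | h1 <;> rcases hmem hvM with h2 | h2 <;>
      rcases hmem hgvM with h3 | h3 <;> rw [h1, h2] at hneq <;> rw [h3, h2] at hnot <;> simp_all
  exact hsign hgv0 hu0 (heq ▸ mem_connectedComponentIn hgvM) (mem_connectedComponentIn huM)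

/-- The expanding directions of a triangular pair lie in every common multicone, on different sides
of the contracting ones. -/
theorem triangular_signs {A B : SL2R} (hA : A 1 0 = 0) (hA0 : 1 < A 0 0) (hB : B 0 1 = 0)
    (hB0 : 1 < B 1 1) (hle : A 0 1 * B 1 0 ≤ 0) {M : Set P1} (HA : StrictlyInvariant A M)
    (HB : StrictlyInvariant B M) :
    A 0 1 * B 1 0 < 0 ∧ (IsPreconnected M → False) ∧ ((componentsOf M).ncard = 2 →
      A 0 1 * B 1 0 < -((B 1 1 - (B 1 1)⁻¹) * (A 0 0)⁻¹) ∧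
      A 0 1 * B 1 0 < -((A 0 0 - (A 0 0)⁻¹) * (B 1 1)⁻¹)) := by
  obtain ⟨hA1, hB1⟩ := triangular_entries hA hB
  set μ := A 0 0 with hμ
  set ν := B 1 1 with hν
  set m := A 0 1 with hm
  set n := B 1 0 with hn
  have hμ0 : 0 < μ := by linarith
  have hν0 : 0 < ν := by linarith
  have hμi : 0 < μ⁻¹ := by positivity
  have hνi : 0 < ν⁻¹ := by positivity
  have hμμ : μ * μ⁻¹ = 1 := mul_inv_cancel₀ hμ0.ne'
  have hνν : ν * ν⁻¹ = 1 := mul_inv_cancel₀ hν0.ne'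
  set x := μ - μ⁻¹ with hx
  set y := ν - ν⁻¹ with hy
  have hx0 : 0 < x := by have := inv_lt_one_of_one_lt₀ hA0; linarith
  have hy0 : 0 < y := by have := inv_lt_one_of_one_lt₀ hB0; linarith
  have smulA : ∀ v : Fin 2 → ℝ, (A • v) 0 = μ * v 0 + m * v 1 ∧ (A • v) 1 = μ⁻¹ * v 1 := by
    intro v
    simp only [smul_entry, hA, hA1, ← hμ, ← hm]
    exact ⟨trivial, by ring⟩
  have smulB : ∀ v : Fin 2 → ℝ, (B • v) 0 = ν⁻¹ * v 0 ∧ (B • v) 1 = n * v 0 + ν * v 1 := by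
    intro v
    simp only [smul_entry, hB, hB1, ← hν, ← hn]
    exact ⟨by ring, trivial⟩
  have aμ : 1 < |μ| := lt_abs.mpr (Or.inl hA0)
  have aν : 1 < |ν| := lt_abs.mpr (Or.inl hB0)
  have eA : A • (![1, 0] : Fin 2 → ℝ) = μ • ![1, 0] := by
    apply plane_ext
    · rw [(smulA _).1]; simp
    · rw [(smulA _).2]; simp
  have eB : B • (![0, 1] : Fin 2 → ℝ) = ν • ![0, 1] := by
    apply plane_ext
    · rw [(smulB _).1]; simp
    · rw [(smulB _).2]; simp
  have sA : A • (![m, -x] : Fin 2 → ℝ) = μ⁻¹ • ![m, -x] := by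
    apply plane_ext
    · rw [(smulA _).1]; simp; rw [hx]; ring
    · rw [(smulA _).2]; simp
  have sB : B • (![-y, n] : Fin 2 → ℝ) = ν⁻¹ • ![-y, n] := by
    apply plane_ext
    · rw [(smulB _).1]; simp
    · rw [(smulB _).2]; simp; rw [hy]; ring
  have arA : area ![1, 0] ![m, -x] ≠ 0 := by simpa [area] using hx0.ne'
  have arB : area ![0, 1] ![-y, n] ≠ 0 := by simpa [area] using hy0.ne'
  have e0M := HA.expanding_mem aμ arA eA sA
  have e1M := HB.expanding_mem aν arB eB sB
  have sAM := HA.contracting_notMem aμ arA eA sA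
  have sBM := HB.contracting_notMem aν arB eB sB
  have e0 : (![1, 0] : Fin 2 → ℝ) ≠ 0 := area_ne_zero_left arA
  have e1 : (![0, 1] : Fin 2 → ℝ) ≠ 0 := area_ne_zero_left arB
  have sA0 := area_ne_zero_right arA
  have sB0 := area_ne_zero_right arB
  have hm0 : m ≠ 0 := by
    intro h0
    apply sAM
    rw [(P1.pt_eq_pt_iff sA0 e1).mpr (by simp [h0])]
    exact e1M
  have hn0 : n ≠ 0 := by
    intro h0
    apply sBM
    rw [(P1.pt_eq_pt_iff sB0 e0).mpr (by simp [h0])]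
    exact e0M
  have hmn : m * n < 0 := lt_of_le_of_ne hle (mul_ne_zero hm0 hn0)
  -- The form vanishes exactly at the two contracting directions, which lie outside the multicone,
  -- so it has a constant sign on each component.
  have hQ : ∀ v, binForm (x * n) (x * y + m * n) (m * y) v =
      (x * v 0 + m * v 1) * (n * v 0 + y * v 1) := by
    intro v; unfold binForm; ring
  have hne : ∀ v, v ≠ 0 → P1.pt v ∈ M → binForm (x * n) (x * y + m * n) (m * y) v ≠ 0 := by
    intro v hv hvM h0
    rw [hQ] at h0
    rcases mul_eq_zero.mp h0 with h0 | h0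
    · apply sAM
      rw [(P1.pt_eq_pt_iff sA0 hv).mpr (by simp; linarith)]
      exact hvM
    · apply sBM
      rw [(P1.pt_eq_pt_iff sB0 hv).mpr (by simp; linarith)]
      exact hvM
  have Qe0 : binForm (x * n) (x * y + m * n) (m * y) ![1, 0] = x * n := by simp [hQ]
  have Qe1 : binForm (x * n) (x * y + m * n) (m * y) ![0, 1] = m * y := by simp [hQ]
  have hxy := mul_pos hx0 hy0
  have hneg : x * n * (m * y) < 0 := by
    have := mul_neg_of_pos_of_neg hxy hmn
    linarith
  refine ⟨hmn, fun hpre => ?_, fun hcard => ⟨?_, ?_⟩⟩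
  · have := P1.binForm_mul_pos hpre hne e0 e1 e0M e1M
    rw [Qe0, Qe1] at this
    linarith
  -- The expanding direction of `B` must be carried by `A` into the component of the expanding
  -- direction of `A`; the sign condition at the image vector is the required inequality.
  · have h1 := HA.crossing hcard aμ arA eA sA (v := ![0, 1]) (by simpa [area] using hm0) e0M e1M hne
      (by rw [Qe0, Qe1]; exact hneg)
    rw [Qe0, hQ, (smulA _).1, (smulA _).2] at h1
    simp only [Matrix.cons_val_zero, Matrix.cons_val_one] at h1
    have h2 : 0 < (μ * x) * ((m * n) * (m * n + y * μ⁻¹)) := by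
      rw [hx] at h1 ⊢; linarith
    have h3 := (mul_pos_iff_of_pos_left (mul_pos hμ0 hx0)).mp h2
    by_contra hcon
    push Not at hcon
    nlinarith
  · have h1 := HB.crossing hcard aν arB eB sB (v := ![1, 0]) (by simpa [area] using hn0) e1M e0M hne
      (by rw [Qe0, Qe1]; linarith)
    rw [Qe1, hQ, (smulB _).1, (smulB _).2] at h1
    simp only [Matrix.cons_val_zero, Matrix.cons_val_one] at h1
    have h2 : 0 < (ν * y) * ((m * n) * (m * n + x * ν⁻¹)) := by
      rw [hy] at h1 ⊢; linarith
    have h3 := (mul_pos_iff_of_pos_left (mul_pos hν0 hy0)).mp h2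
    by_contra hcon
    push Not at hcon
    nlinarith

theorem HasMulticoneWith.exists_strictlyInvariant {k : ℕ} {p : SL2R × SL2R}
    (h : HasMulticoneWith k p) : ∃ M, StrictlyInvariant p.1 M ∧ StrictlyInvariant p.2 M ∧
      (componentsOf M).ncard = k := by
  obtain ⟨M, hM, hk⟩ := h
  exact ⟨M, hM.strictlyInvariant 0, hM.strictlyInvariant 1, hk⟩

theorem HasMulticoneWith.two_lt_abs_tr {k : ℕ} {p : SL2R × SL2R} (h : HasMulticoneWith k p) :
    2 < |tr p.1| ∧ 2 < |tr p.2| ∧ 2 < |tr (p.1 * p.2)| := by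
  obtain ⟨M, h1, h2, -⟩ := h.exists_strictlyInvariant
  exact ⟨h1.two_lt_abs_tr, h2.two_lt_abs_tr, (h1.mul h2).two_lt_abs_tr⟩

theorem isPreconnected_of_ncard_componentsOf {X : Type*} [TopologicalSpace X] {S : Set X}
    (h : (componentsOf S).ncard = 1) : IsPreconnected S := by
  obtain ⟨C, hC⟩ := Set.ncard_eq_one.mp h
  have hmem : ∀ x ∈ S, connectedComponentIn S x = C := by
    intro x hx
    have : connectedComponentIn S x ∈ componentsOf S := ⟨x, hx, rfl⟩
    rw [hC] at this
    exact this
  rcases S.eq_empty_or_nonempty with rfl | ⟨x, hx⟩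
  · exact isPreconnected_empty
  · have : S = C := by
      apply Set.Subset.antisymm
      · intro y hy
        rw [← hmem y hy]
        exact mem_connectedComponentIn hy
      · rw [← hmem x hx]
        exact connectedComponentIn_subset _ _
    rw [this, ← hmem x hx]
    exact isPreconnected_connectedComponentIn

theorem exists_mem_principalSet_of_hasMulticoneWith_one {p : SL2R × SL2R}
    (h : HasMulticoneWith 1 p) : ∃ s, p ∈ principalSet s := by
  obtain ⟨hx, hy, -⟩ := h.two_lt_abs_tr
  obtain ⟨s, h1, h2⟩ := exists_flipSign_tr_pos hx hy
  refine ⟨s, ?_⟩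
  by_contra hcon
  obtain ⟨g, k1, k2, k3, k4, k5⟩ := triangular_form h1 h2 hcon
  obtain ⟨M, HA, HB, hM⟩ := ((h.flipSign s).conj g).exists_strictlyInvariant
  exact (triangular_signs k1 k2 k3 k4 k5 HA HB).2.1 (isPreconnected_of_ncard_componentsOf hM)

/-- With diagonal entries `μ`, `ν` as above, the first bound gives `tr AB < μ/ν + 1/(μν)`, which
suffices if `μ ≤ ν`; the second gives the symmetric estimate for `ν ≤ μ`. -/
theorem tr_mul_lt_two_of_triangular {A B : SL2R} (hA : A 1 0 = 0) (hA0 : 1 < A 0 0) (hB : B 0 1 = 0)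
    (hB0 : 1 < B 1 1) (h1 : A 0 1 * B 1 0 < -((B 1 1 - (B 1 1)⁻¹) * (A 0 0)⁻¹))
    (h2 : A 0 1 * B 1 0 < -((A 0 0 - (A 0 0)⁻¹) * (B 1 1)⁻¹)) : tr (A * B) < 2 := by
  obtain ⟨hA1, hB1⟩ := triangular_entries hA hB
  have trAB : tr (A * B) = A 0 0 * (B 1 1)⁻¹ + (A 0 0)⁻¹ * B 1 1 + A 0 1 * B 1 0 := by
    simp only [tr, mul_entry, hA, hB, hA1, hB1]; ring
  rw [trAB]
  generalize A 0 0 = μ at *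
  generalize B 1 1 = ν at *
  have hμ0 : 0 < μ := by linarith
  have hν0 : 0 < ν := by linarith
  have hμi : 0 < μ⁻¹ := by positivity
  have hνi : 0 < ν⁻¹ := by positivity
  have hμ' : μ⁻¹ < 1 := inv_lt_one_of_one_lt₀ hA0
  have hν' : ν⁻¹ < 1 := inv_lt_one_of_one_lt₀ hB0
  have hprod : μ⁻¹ * ν⁻¹ < 1 := by nlinarith
  rcases le_total μ ν with h | h
  · have : μ * ν⁻¹ ≤ 1 := by rw [← div_eq_mul_inv]; exact div_le_one_of_le₀ h hν0.le
    nlinarith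
  · have : ν * μ⁻¹ ≤ 1 := by rw [← div_eq_mul_inv]; exact div_le_one_of_le₀ h hμ0.le
    nlinarith

/-- After the signs make `tr A` and `tr B` positive, the two intervals force `tr AB < 2`. As `AB`
also preserves the multicone strictly, `|tr AB| > 2`, which leaves `tr AB < -2`. -/
theorem mem_freeSet_of_hasMulticoneWith_two {p : SL2R × SL2R} (h : HasMulticoneWith 2 p)
    (hp : ∀ s, p ∉ principalSet s) : p ∈ freeSet := by
  obtain ⟨hx, hy, hz⟩ := h.two_lt_abs_tr
  obtain ⟨s, h1, h2⟩ := exists_flipSign_tr_pos hx hy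
  rw [← flipSign_mem_freeSet (s := s)]
  obtain ⟨g, k1, k2, k3, k4, k5⟩ := triangular_form h1 h2 (hp s)
  obtain ⟨M, HA, HB, hM⟩ := ((h.flipSign s).conj g).exists_strictlyInvariant
  obtain ⟨l1, l2⟩ := (triangular_signs k1 k2 k3 k4 k5 HA HB).2.2 hM
  have h3 := tr_mul_lt_two_of_triangular k1 k2 k3 k4 l1 l2
  rw [conj_inv_mul, tr_conj_inv] at h3
  obtain ⟨hx', hy', hz'⟩ := (h.flipSign s).two_lt_abs_tr
  refine ⟨hx', hy', hz', ?_⟩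
  have h4 : tr ((flipSign s p).1 * (flipSign s p).2) < 0 := by
    rcases lt_abs.mp hz' with h' | h' <;> linarith
  exact mul_neg_of_pos_of_neg (by positivity) h4

/-! ### Principal sets are open, connected and pairwise disjoint -/

namespace SL2R

theorem continuous_of_entries {X : Type*} [TopologicalSpace X] {f : X → SL2R}
    (h : ∀ i j, Continuous fun x => f x i j) : Continuous f :=
  continuous_induced_rng.mpr (continuous_matrix h)

theorem continuous_mk {X : Type*} [TopologicalSpace X] {a b c d : X → ℝ} (ha : Continuous a)
    (hb : Continuous b) (hc : Continuous c) (hd : Continuous d)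
    (h : ∀ x, a x * d x - b x * c x = 1) :
    Continuous fun x => SL2R.mk (a x) (b x) (c x) (d x) (h x) := by
  refine continuous_of_entries fun i j => ?_
  fin_cases i <;> fin_cases j
  · exact ha
  · exact hb
  · exact hc
  · exact hd

theorem continuous_tr : Continuous tr := (continuous_entry 0 0).add (continuous_entry 1 1)

/-- The upper unipotent matrices. -/
def upper (t : ℝ) : SL2R := SL2R.mk 1 t 0 1 (by ring)

/-- The lower unipotent matrices. -/
def lower (t : ℝ) : SL2R := SL2R.mk 1 0 t 1 (by ring)

theorem continuous_upper : Continuous upper :=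
  continuous_mk continuous_const continuous_id continuous_const continuous_const _

theorem continuous_lower : Continuous lower :=
  continuous_mk continuous_const continuous_const continuous_id continuous_const _

theorem exists_upper_lower_upper {g : SL2R} (h : g 1 0 ≠ 0) :
    ∃ r s t, g = upper r * lower s * upper t := by
  refine ⟨(g 0 0 - 1) / g 1 0, g 1 0, (g 1 1 - 1) / g 1 0, ?_⟩
  have hd := det_entries g
  apply ext_entries <;>
    simp only [mul_entry, upper, lower, mk_00, mk_01, mk_10, mk_11] <;> field_simp
  · ring
  · linear_combination (-1 : ℝ) * hd
  · ring
  · ring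

/-- Every element is a product of four unipotent matrices, alternately upper and lower, so the group
is a continuous image of a four-dimensional real space. -/
instance : PreconnectedSpace SL2R := by
  have hcont : Continuous fun x : ℝ × ℝ × ℝ × ℝ =>
      upper x.1 * lower x.2.1 * upper x.2.2.1 * lower x.2.2.2 := by
    have h1 := continuous_upper
    have h2 := continuous_lower
    fun_prop
  have hsurj : Function.Surjective fun x : ℝ × ℝ × ℝ × ℝ =>
      upper x.1 * lower x.2.1 * upper x.2.2.1 * lower x.2.2.2 := by
    intro g
    have hL : ∀ t, lower t * lower (-t) = 1 := by
      intro t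
      apply ext_entries <;>
        simp [mul_entry, lower, mk_00, mk_01, mk_10, mk_11]
    obtain ⟨u, hu⟩ : ∃ u : ℝ, (g * lower u) 1 0 ≠ 0 := by
      by_cases hc : g 1 0 = 0
      · refine ⟨1, ?_⟩
        have hd := det_entries g
        rw [hc] at hd
        simp only [mul_entry, lower, mk_00, mk_10, hc]
        intro h0
        have : g 1 1 = 0 := by linarith
        rw [this] at hd
        linarith
      · refine ⟨0, ?_⟩
        simpa [mul_entry, lower, mk_00, mk_10] using hc
    obtain ⟨r, s, t, h⟩ := exists_upper_lower_upper hu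
    refine ⟨(r, s, t, -u), ?_⟩
    simp only
    rw [← h, mul_assoc, hL, mul_one]
  refine ⟨?_⟩
  rw [← hsurj.range_eq]
  exact isPreconnected_range hcont

end SL2R

theorem isOpen_posMat : IsOpen posMat := by
  have h := fun i j => isOpen_lt continuous_const (continuous_entry i j) (f := fun _ : SL2R => (0 : ℝ))
  exact (h 0 0).inter ((h 0 1).inter ((h 1 0).inter (h 1 1)))

/-- The logarithms of three entries are free parameters, and the determinant fixes the fourth entry.
-/
theorem isPreconnected_posMat : IsPreconnected posMat := by
  set f : ℝ × ℝ × ℝ → SL2R := fun x => SL2R.mk (Real.exp x.1) (Real.exp x.2.1) (Real.exp x.2.2)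
    ((1 + Real.exp x.2.1 * Real.exp x.2.2) * Real.exp (-x.1)) (by
      have : Real.exp x.1 * Real.exp (-x.1) = 1 := by rw [← Real.exp_add]; simp
      linear_combination (1 + Real.exp x.2.1 * Real.exp x.2.2) * this) with hf
  have hcont : Continuous f := continuous_mk (by fun_prop) (by fun_prop) (by fun_prop) (by fun_prop) _
  have hrange : Set.range f = posMat := by
    ext g
    constructor
    · rintro ⟨x, rfl⟩
      simp only [posMat, Set.mem_ofPred_eq, hf, mk_00, mk_01, mk_10, mk_11]
      exact ⟨by positivity, by positivity, by positivity, by positivity⟩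
    · rintro ⟨h1, h2, h3, h4⟩
      refine ⟨(Real.log (g 0 0), Real.log (g 0 1), Real.log (g 1 0)), ?_⟩
      have hd := det_entries g
      apply ext_entries <;>
        simp only [hf, mk_00, mk_01, mk_10, mk_11, Real.exp_neg, Real.exp_log h1, Real.exp_log h2,
          Real.exp_log h3]
      field_simp
      linarith
  rw [← hrange]
  exact isPreconnected_range hcont

theorem continuous_flipSign (s : Bool × Bool) : Continuous (flipSign s) := by
  have hneg : Continuous fun g : SL2R => -g := by
    refine continuous_of_entries fun i j => ?_
    simp only [neg_entry]
    exact (continuous_entry i j).neg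
  obtain ⟨a, b⟩ := s
  unfold flipSign
  refine Continuous.prodMk ?_ ?_
  · cases a
    · simpa using continuous_fst
    · exact hneg.comp continuous_fst
  · cases b
    · simpa using continuous_snd
    · exact hneg.comp continuous_snd

theorem isOpen_principalSet (s : Bool × Bool) : IsOpen (principalSet s) := by
  have h1 : IsOpen posPairs := by
    have : posPairs = ⋃ g : SL2R, (fun p : SL2R × SL2R => g⁻¹ * p.1 * g) ⁻¹' posMat ∩
        (fun p : SL2R × SL2R => g⁻¹ * p.2 * g) ⁻¹' posMat := by
      ext p
      simp [posPairs]
    rw [this]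
    refine isOpen_iUnion fun g => (isOpen_posMat.preimage ?_).inter (isOpen_posMat.preimage ?_)
    · fun_prop
    · fun_prop
  exact h1.preimage (continuous_flipSign s)

theorem isPreconnected_principalSet (s : Bool × Bool) : IsPreconnected (principalSet s) := by
  set f : SL2R × SL2R × SL2R → SL2R × SL2R := fun x =>
    flipSign s (x.1 * x.2.1 * x.1⁻¹, x.1 * x.2.2 * x.1⁻¹) with hf
  have hcont : Continuous f := (continuous_flipSign s).comp (by fun_prop)
  have himg : f '' (Set.univ ×ˢ posMat ×ˢ posMat) = principalSet s := by
    ext p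
    constructor
    · rintro ⟨⟨g, A, B⟩, ⟨-, hA, hB⟩, rfl⟩
      simp only [principalSet, Set.mem_ofPred_eq, hf, flipSign_flipSign]
      refine ⟨g, ?_, ?_⟩
      · simpa [mul_assoc] using hA
      · simpa [mul_assoc] using hB
    · rintro ⟨g, hA, hB⟩
      refine ⟨(g, _, _), ⟨Set.mem_univ _, hA, hB⟩, ?_⟩
      simp only [hf]
      rw [← flipSign_flipSign s p]
      congr 1
      simp [mul_assoc, flipSign_flipSign]
  rw [← himg]
  exact (isPreconnected_univ.prod (isPreconnected_posMat.prod isPreconnected_posMat)).image f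
    hcont.continuousOn

theorem principalSet_nonempty (s : Bool × Bool) : (principalSet s).Nonempty := by
  set g : SL2R := SL2R.mk 2 1 1 1 (by norm_num) with hg
  have h : g ∈ posMat := by
    simp only [posMat, Set.mem_ofPred_eq, hg, mk_00, mk_01, mk_10, mk_11]
    norm_num
  refine ⟨flipSign s (g, g), ?_⟩
  rw [principalSet, Set.mem_ofPred_eq, flipSign_flipSign]
  exact ⟨1, by simpa using h, by simpa using h⟩

theorem tr_pos_of_mem_posPairs {p : SL2R × SL2R} (hp : p ∈ posPairs) : 0 < tr p.1 ∧ 0 < tr p.2 := by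
  obtain ⟨g, h1, h2⟩ := hp
  rw [← tr_conj_inv g p.1, ← tr_conj_inv g p.2]
  exact ⟨add_pos h1.1 h1.2.2.2, add_pos h2.1 h2.2.2.2⟩

theorem principalSet_disjoint {s t : Bool × Bool} (h : s ≠ t) :
    Disjoint (principalSet s) (principalSet t) := by
  rw [Set.disjoint_left]
  intro p hs ht
  apply h
  obtain ⟨h1, h2⟩ := tr_pos_of_mem_posPairs hs
  obtain ⟨h3, h4⟩ := tr_pos_of_mem_posPairs ht
  have key : ∀ (a b : Bool) (g : SL2R), 0 < tr (if a then -g else g) →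
      0 < tr (if b then -g else g) → a = b := by
    intro a b g ha hb
    cases a <;> cases b <;> simp [tr_neg] at ha hb ⊢ <;> linarith
  exact Prod.ext (key _ _ _ h1 h3) (key _ _ _ h2 h4)

/-- Put `P = A₀₁B₁₀ + A₁₀B₀₁ > 0`. The last twisted inequality gives `(A₀₀ - A₁₁)(B₁₁ - B₀₀) ≥ 2P`.
In the expansion of `fricke - 4` the square of the commutator's diagonal entry is less than `P²`,
while at least `2P²` is subtracted, so `fricke < 4`. -/
theorem notMem_weaklyTwistedSet_of_posMat {A B : SL2R} (hA : A ∈ posMat) (hB : B ∈ posMat) :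
    (A, B) ∉ weaklyTwistedSet := by
  rintro ⟨-, -, h3, h4⟩
  obtain ⟨a0, b0, c0, d0⟩ := hA
  obtain ⟨e0, f0, g0, h0⟩ := hB
  have dA := det_entries A
  have dB := det_entries B
  have hdisc : fricke (A, B) - 4 = (A 0 1 * B 1 0 - B 0 1 * A 1 0) ^ 2 -
      ((A 0 0 - A 1 1) * B 0 1 + (B 1 1 - B 0 0) * A 0 1) *
        ((A 0 0 - A 1 1) * B 1 0 + (B 1 1 - B 0 0) * A 1 0) := by
    simp only [fricke, tr, mul_entry]
    linear_combination (-(A 0 0 + A 1 1) ^ 2 + 4 * (A 0 0 * A 1 1 - A 0 1 * A 1 0)) * dB +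
      (-(B 0 0 + B 1 1) ^ 2 + 4) * dA
  have hxy : 0 < tr A * tr B := mul_pos (add_pos a0 d0) (add_pos e0 h0)
  simp only at h4
  have h5 : 2 * tr (A * B) ≤ tr A * tr B := by
    refine le_of_mul_le_mul_left ?_ hxy
    linarith
  simp only [tr, mul_entry] at h5
  have hP : 0 < A 0 1 * B 1 0 + A 1 0 * B 0 1 := by positivity
  have h6 : 2 * (A 0 1 * B 1 0 + A 1 0 * B 0 1) ≤ (A 0 0 - A 1 1) * (B 1 1 - B 0 0) := by linarith
  have h7 := mul_le_mul_of_nonneg_right h6 hP.le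
  have h8 : 0 ≤ (A 0 0 - A 1 1) ^ 2 * (B 0 1 * B 1 0) := by positivity
  have h9 : 0 ≤ (B 1 1 - B 0 0) ^ 2 * (A 0 1 * A 1 0) := by positivity
  have h10 : 0 < (A 0 1 * B 1 0) * (A 1 0 * B 0 1) := by positivity
  have h11 : 0 < (A 0 1 * B 1 0 + A 1 0 * B 0 1) ^ 2 := by positivity
  nlinarith

theorem notMem_principalSet_of_mem_weaklyTwistedSet {p : SL2R × SL2R} (h : p ∈ weaklyTwistedSet)
    (s : Bool × Bool) : p ∉ principalSet s := by
  rintro ⟨g, hA, hB⟩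
  rw [← flipSign_mem_weaklyTwistedSet (s := s)] at h
  refine notMem_weaklyTwistedSet_of_posMat hA hB (weaklyTwisted_conj g⁻¹ ?_)
  have e : ∀ A : SL2R, (g⁻¹)⁻¹ * (g⁻¹ * A * g) * g⁻¹ = A := fun A => by group
  simpa only [e] using h

/-! ### The monoid acts by homeomorphisms -/

/-- `Fplus` as a homeomorphism. -/
def FplusHomeo : SL2R × SL2R ≃ₜ SL2R × SL2R where
  toFun := Fplus
  invFun p := (p.1, p.1⁻¹ * p.2)
  left_inv p := by simp [Fplus]
  right_inv p := by simp [Fplus]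
  continuous_toFun := by unfold Fplus; fun_prop
  continuous_invFun := by fun_prop

/-- `Fminus` as a homeomorphism. -/
def FminusHomeo : SL2R × SL2R ≃ₜ SL2R × SL2R where
  toFun := Fminus
  invFun p := (p.2⁻¹ * p.1, p.2)
  left_inv p := by simp [Fminus]
  right_inv p := by simp [Fminus]
  continuous_toFun := by unfold Fminus; fun_prop
  continuous_invFun := by fun_prop

theorem exists_wordMap_homeo (l : List Bool) :
    ∃ e : SL2R × SL2R ≃ₜ SL2R × SL2R, ∀ p, e p = wordMap l p := by
  induction l with
  | nil => exact ⟨Homeomorph.refl _, fun p => rfl⟩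
  | cons b l ih =>
    obtain ⟨e, he⟩ := ih
    cases b
    · exact ⟨FminusHomeo.trans e, fun p => he (Fminus p)⟩
    · exact ⟨FplusHomeo.trans e, fun p => he (Fplus p)⟩

theorem isOpen_freeSet : IsOpen freeSet := by
  have h1 : Continuous fun p : SL2R × SL2R => tr p.1 := continuous_tr.comp continuous_fst
  have h2 : Continuous fun p : SL2R × SL2R => tr p.2 := continuous_tr.comp continuous_snd
  have h3 : Continuous fun p : SL2R × SL2R => tr (p.1 * p.2) := continuous_tr.comp continuous_mul
  exact (isOpen_lt continuous_const h1.abs).inter ((isOpen_lt continuous_const h2.abs).inter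
    ((isOpen_lt continuous_const h3.abs).inter (isOpen_lt ((h1.mul h2).mul h3) continuous_const)))

theorem continuous_wordMap (l : List Bool) : Continuous (wordMap l) := by
  obtain ⟨e, he⟩ := exists_wordMap_homeo l
  exact e.continuous.congr he

theorem wordMap_surjective (l : List Bool) : Function.Surjective (wordMap l) := by
  obtain ⟨e, he⟩ := exists_wordMap_homeo l
  intro q
  obtain ⟨p, rfl⟩ := e.surjective q
  exact ⟨p, (he p).symm⟩

theorem componentsOf_pullback_wordMap (l : List Bool) (S : Set (SL2R × SL2R)) :
    componentsOf (pullback (wordMap l) S) = pullback (wordMap l) '' componentsOf S := by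
  obtain ⟨e, he⟩ := exists_wordMap_homeo l
  have h : ∀ T, pullback (wordMap l) T = e.symm '' T := by
    intro T
    rw [e.symm.image_eq_preimage_symm]
    ext p
    simp [pullback, he]
  simp only [h, componentsOf_image]

/-! ### The components of the hyperbolic locus -/

/-- The open pieces of the hyperbolic locus. -/
def locusPiece : (Bool × Bool) ⊕ List Bool → Set (SL2R × SL2R) :=
  Sum.elim principalSet fun l => pullback (wordMap l) freeSet

theorem isOpen_locusPiece (i : (Bool × Bool) ⊕ List Bool) : IsOpen (locusPiece i) := by
  cases i with
  | inl s => exact isOpen_principalSet s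
  | inr l => exact isOpen_freeSet.preimage (continuous_wordMap l)

theorem notMem_principalSet_of_wordMap {l : List Bool} {p : SL2R × SL2R}
    (h : wordMap l p ∈ freeSet) (s : Bool × Bool) : p ∉ principalSet s :=
  notMem_principalSet_of_mem_weaklyTwistedSet
    (twistedSet_subset_weaklyTwistedSet (mem_twistedSet_of_wordMap h)) s

theorem locusPiece_disjoint : Pairwise fun i j => Disjoint (locusPiece i) (locusPiece j) := by
  intro i j hij
  cases i with
  | inl s =>
    cases j with
    | inl t => exact principalSet_disjoint fun h => hij (by rw [h])
    | inr l => exact Set.disjoint_right.mpr fun p hp => notMem_principalSet_of_wordMap hp s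
  | inr l =>
    cases j with
    | inl t => exact Set.disjoint_left.mpr fun p hp => notMem_principalSet_of_wordMap hp t
    | inr l' =>
      refine Set.disjoint_left.mpr fun p hp hp' => hij ?_
      rw [word_unique hp hp']

theorem hyperbolicLocus_eq : hyperbolicLocus = ⋃ i, locusPiece i := by
  ext p
  rw [Set.mem_iUnion]
  constructor
  · intro hp
    rcases mem_principalSet_or_of_mem_hyperbolicLocus hp with ⟨s, hs⟩ | ⟨l, hl⟩
    · exact ⟨Sum.inl s, hs⟩
    · exact ⟨Sum.inr l, hl⟩
  · rintro ⟨s | l, h⟩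
    · exact principalSet_subset_hyperbolicLocus s h
    · exact wordMap_preimage_subset_hyperbolicLocus h

theorem componentsOf_principalSet (s : Bool × Bool) :
    componentsOf (principalSet s) = {principalSet s} :=
  componentsOf_eq_singleton (isPreconnected_principalSet s) (principalSet_nonempty s)

/-- The pieces are open and pairwise disjoint, so components can be taken piece by piece. Each
principal set is connected, and a word, being a homeomorphism, pulls components back to components.
-/
theorem componentsOf_hyperbolicLocus : componentsOf hyperbolicLocus =
    Set.range principalSet ∪ ⋃ l, pullback (wordMap l) '' componentsOf freeSet := by
  rw [hyperbolicLocus_eq, componentsOf_iUnion isOpen_locusPiece locusPiece_disjoint,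
    Set.iUnion_sum]
  congr 1
  · ext C
    simp [locusPiece, componentsOf_principalSet, eq_comm]
  · refine Set.iUnion_congr fun l => ?_
    exact componentsOf_pullback_wordMap l freeSet

theorem nonempty_of_mem_componentsOf {X : Type*} [TopologicalSpace X] {S C : Set X}
    (hC : C ∈ componentsOf S) : C.Nonempty := by
  obtain ⟨x, hx, rfl⟩ := hC
  exact ⟨x, mem_connectedComponentIn hx⟩

theorem subset_of_mem_componentsOf {X : Type*} [TopologicalSpace X] {S C : Set X}
    (hC : C ∈ componentsOf S) : C ⊆ S := by
  obtain ⟨x, hx, rfl⟩ := hC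
  exact connectedComponentIn_subset S x

theorem exists_mem_pullback {l : List Bool} {C : Set (SL2R × SL2R)}
    (hC : C ∈ componentsOf freeSet) :
    ∃ p ∈ pullback (wordMap l) C, wordMap l p ∈ freeSet := by
  obtain ⟨q, hq⟩ := nonempty_of_mem_componentsOf hC
  obtain ⟨p, rfl⟩ := wordMap_surjective l q
  exact ⟨p, hq, subset_of_mem_componentsOf hC hq⟩

theorem principalComponents_eq : principalComponents = Set.range principalSet := by
  ext C
  constructor
  · rintro ⟨hC, h1⟩
    rw [componentsOf_hyperbolicLocus] at hC
    rcases hC with hC | hC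
    · exact hC
    · obtain ⟨l, D, hD, rfl⟩ := Set.mem_iUnion.mp hC
      obtain ⟨p, hp, hpf⟩ := exists_mem_pullback (l := l) hD
      obtain ⟨s, hs⟩ := exists_mem_principalSet_of_hasMulticoneWith_one (h1 p hp)
      exact absurd hs (notMem_principalSet_of_wordMap hpf s)
  · rintro ⟨s, rfl⟩
    refine ⟨?_, fun p hp => hasMulticoneWith_one_of_mem_principalSet hp⟩
    rw [componentsOf_hyperbolicLocus]
    exact Or.inl ⟨s, rfl⟩

/-- Trace conditions and the geometric definition meet here: two-interval multicones of nonprincipal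
pairs force the inequalities, and the ping-pong intervals realize them. -/
theorem Hid_eq_freeSet : Hid = freeSet := by
  ext p
  simp only [Hid, principalComponents_eq, Set.forall_mem_range, Set.mem_ofPred_eq]
  constructor
  · rintro ⟨h1, h2⟩
    exact mem_freeSet_of_hasMulticoneWith_two h2 h1
  · intro hp
    exact ⟨notMem_principalSet_of_wordMap (l := []) hp, hasMulticoneWith_two_of_mem_freeSet hp⟩

theorem principalSet_injective : Function.Injective principalSet := by
  intro s t h
  by_contra hne
  obtain ⟨p, hp⟩ := principalSet_nonempty s
  exact Set.disjoint_left.mp (principalSet_disjoint hne) hp (h ▸ hp)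

theorem theorem3p1 :
    principalComponents.ncard = 4 ∧
    componentsOf hyperbolicLocus =
      principalComponents ∪
        {C | ∃ F ∈ monoidFpm, ∃ H' ∈ freeComponents, C = pullback F H'} ∧
    (∀ F ∈ monoidFpm, ∀ H' ∈ freeComponents, pullback F H' ∉ principalComponents) ∧
    (∀ F ∈ monoidFpm, ∀ G ∈ monoidFpm, ∀ H' ∈ freeComponents, ∀ H'' ∈ freeComponents,
      pullback F H' = pullback G H'' → F = G ∧ H' = H'') := by
  rw [freeComponents, Hid_eq_freeSet, principalComponents_eq, componentsOf_hyperbolicLocus]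
  refine ⟨?_, ?_, ?_, ?_⟩
  · rw [← Set.image_univ, Set.ncard_image_of_injective _ principalSet_injective, Set.ncard_univ,
      Nat.card_eq_fintype_card]
    rfl
  · congr 1
    ext C
    simp only [Set.mem_iUnion, Set.mem_image, Set.mem_ofPred_eq]
    constructor
    · rintro ⟨l, D, hD, rfl⟩
      exact ⟨wordMap l, wordMap_mem l, D, hD, rfl⟩
    · rintro ⟨F, hF, D, hD, rfl⟩
      obtain ⟨l, rfl⟩ := exists_wordMap hF
      exact ⟨l, D, hD, rfl⟩
  · rintro F hF D hD ⟨s, hs⟩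
    obtain ⟨l, rfl⟩ := exists_wordMap hF
    obtain ⟨p, hp, hpf⟩ := exists_mem_pullback (l := l) hD
    rw [← hs] at hp
    exact notMem_principalSet_of_wordMap hpf s hp
  · intro F hF G hG D hD E hE h
    obtain ⟨l, rfl⟩ := exists_wordMap hF
    obtain ⟨l', rfl⟩ := exists_wordMap hG
    obtain ⟨p, hp, hpf⟩ := exists_mem_pullback (l := l) hD
    rw [h] at hp
    obtain rfl := word_unique hpf (subset_of_mem_componentsOf hE hp)
    exact ⟨rfl, (wordMap_surjective l).preimage_injective h⟩
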